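/- **Setting.** Let $(X,Y)$ be a random pair with $X\in\mathbb R^p$, $Y\in\{1,\dots,h\}$, $E\|X\|^4<\infty$, $\Sigma=\operatorname{Var}(X)>0$ and $f_y=\Pr(Y=y)>0$ for every $y$; let $(X_i,Y_i)_{i\ge1}$ be i.i.d. copies of $(X,Y)$. Put $Z=\Sigma^{-1/2}(X-E X)$, and write $P_S$ for the orthogonal projection onto a subspace $S$ and $Q_S=I_p-P_S$. A subspace $S\subseteq\mathbb R^p$ is a dimension reduction subspace if $Y$ and $Z$ are conditionally independent given $P_SZ$. Assume that the intersection $\mathcal S$ of all dimension reduction subspaces is itself one (that is, the central subspace $\mathcal S=\mathcal S_{Y|Z}$ exists), and let $d=\dim\mathcal S$. Assume - linearity: $E(Z\mid P_{\mathcal S}Z)=P_{\mathcal S}Z$; - coverage: $\operatorname{Span}\{E(Z\mid Y=y):y=1,\dots,h\}=\mathcal S$; - constant covariance: $\operatorname{Var}(Z\mid P_{\mathcal S}Z)=Q_{\mathcal S}$. Let $\alpha_x$ be a $p\times r$ matrix of rank $r$, $\mathcal H=\operatorname{Span}(\Sigma^{-1/2}\alpha_x)$, $\alpha=\Sigma^{-1/2}\alpha_x(\alpha_x^T\Sigma^{-1}\alpha_x)^{-1/2}$,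 and assume the coordinate hypothesis $P_{\mathcal H}\mathcal S=\{0\}$. Let $g_y=\sqrt{f_y}$, $D_g=\operatorname{diag}(g_1,\dots,g_h)$, and let $\mu$ be the $p\times h$ matrix with columns $g_yE(Z\mid Y=y)$. Let $\varepsilon\in\mathbb R^h$ have the entries $\varepsilon_y=J_y-f_y-\beta_y^T(X-EX)$, where $J_y=1_{\{Y=y\}}$ and $\beta_y=\Sigma^{-1}\operatorname{Cov}(X,J_y)$. For a singular value decomposition $$\mu=(\Gamma_1\ \Gamma_0)\begin{pmatrix}D_s&0\\0&0\end{pmatrix}\begin{pmatrix}\Psi_1^T\\\Psi_0^T\end{pmatrix}$$ with $(\Gamma_1\ \Gamma_0)$ and $(\Psi_1\ \Psi_0)$ orthogonal and $D_s$ a $d\times d$ diagonal matrix of positive singular values in decreasing order, put $$\Omega_{\mathcal H|d}=E\left(\Psi_1^TD_g^{-1}\varepsilon\varepsilon^TD_g^{-1}\Psi_1\otimes\alpha^TZZ^T\alpha\right).$$ **Statistic.** For the first $n$ observations let $\bar X$ and $\hat\Sigma$ be the sample mean and the sample covariance matrix (divisor $n$), $\hat Z_i=\hat\Sigma^{-1/2}(X_i-\bar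 X)$, $\hat f_y$ the observed fraction of slice $y$, $\hat{\mathcal H}=\operatorname{Span}(\hat\Sigma^{-1/2}\alpha_x)$, and $$L_d(B,C)=\sum_{i=1}^n\|\hat Z_i-BC_{Y_i}\|^2 .$$ Let $\hat L_d$ be the minimum of $L_d(B,C)$ over $p\times d$ matrices $B$ with $B^TB=I_d$ and vectors $C_1,\dots,C_h\in\mathbb R^d$ with $\sum_y\hat f_yC_y=0$, let $\hat L_d'$ be the minimum under the additional constraint $P_{\hat{\mathcal H}}B=0$, and put $T_n(\mathcal H|d)=\hat L_d'-\hat L_d$. **Conclusion.** The matrix $\mu\mu^T$ has exactly $d$ nonzero eigenvalues, counted with multiplicity, and they are positive; denote them by $\lambda_1\ge\dots\ge\lambda_d>0$ and put $D_\lambda=\operatorname{diag}(\lambda_1,\dots,\lambda_d)$. For every such singular value decomposition of $\mu$ the expectation that defines $\Omega_{\mathcal H|d}$ exists and $$\Omega_{\mathcal H|d}=(I_d-D_\lambda)\otimes I_r ,$$ and, as $n\to\infty$, $$T_n(\mathcal H|d)\ \xrightarrow{\ \mathcal L\ }\ \sum_{j=1}^d(1-\lambda_j)\,\chi_j^2(r),$$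 where $\chi^2_1(r),\dots,\chi^2_d(r)$ are independent chi-squared random variables with $r$ degrees of freedom. -/

import Mathlib

open MeasureTheory ProbabilityTheory Filter
open scoped Topology Matrix Kronecker MatrixOrder

namespace SIR

noncomputable section

/-- The predictor space `ℝᵖ` with the standard inner product. -/
abbrev E (p : ℕ) : Type := EuclideanSpace ℝ (Fin p)

/-- `A^{-1/2}`: the positive semidefinite square root of `A⁻¹`. -/
def invSqrt {m : ℕ} (A : Matrix (Fin m) (Fin m) ℝ) : Matrix (Fin m) (Fin m) ℝ :=
  CFC.sqrt A⁻¹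

/-- The span in `ℝᵖ` of the columns of a matrix. -/
def colSpan {p r : ℕ} (A : Matrix (Fin p) (Fin r) ℝ) : Submodule ℝ (E p) :=
  Submodule.span ℝ (Set.range fun k : Fin r => WithLp.toLp 2 (A.col k))

/-- The chi-squared law with `k` degrees of freedom: the law of the sum of the squares of `k`
independent standard normal variables (the point mass at `0` if `k = 0`). -/
def chiSquared (k : ℕ) : Measure ℝ :=
  (Measure.pi fun _ : Fin k => gaussianReal 0 1).map fun x => ∑ i, x i ^ 2

instance (k : ℕ) : IsProbabilityMeasure (chiSquared k) :=
  Measure.isProbabilityMeasure_map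
    (Measurable.aemeasurable (by fun_prop))

/-! ### Population quantities

`P` is the joint law of `(X, Y)` on `ℝᵖ × {slices}`; `X` and `Y` are the two coordinate maps. -/

section Population

variable {p h : ℕ} (P : Measure (E p × Fin h))

/-- `E(X)`. -/
def meanX : E p := ∫ w, w.1 ∂P

/-- `Σ = Var(X)`. -/
def covX : Matrix (Fin p) (Fin p) ℝ :=
  Matrix.of fun i j => cov[fun w => w.1 i, fun w => w.1 j; P]

/-- The standardized predictor `Z = Σ^{-1/2}(X - E(X))`. -/
def Z (w : E p × Fin h) : E p :=
  Matrix.toEuclideanCLM (𝕜 := ℝ) (invSqrt (covX P)) (w.1 - meanX P)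

lemma measurable_Z : Measurable (Z P) := by
  unfold Z
  fun_prop

/-- The projection `P_S Z` of the standardized predictor. -/
def projZ (S : Submodule ℝ (E p)) (w : E p × Fin h) : E p := S.starProjection (Z P w)

lemma measurable_projZ (S : Submodule ℝ (E p)) : Measurable (projZ P S) :=
  S.starProjection.measurable.comp (measurable_Z P)

/-- The σ-algebra generated by `P_S Z`. -/
abbrev sigmaProjZ (S : Submodule ℝ (E p)) : MeasurableSpace (E p × Fin h) :=
  MeasurableSpace.comap (projZ P S) inferInstance

lemma sigmaProjZ_le (S : Submodule ℝ (E p)) :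
    sigmaProjZ P S ≤ (inferInstance : MeasurableSpace (E p × Fin h)) :=
  (measurable_projZ P S).comap_le

/-- `S` is a dimension reduction subspace for the regression of `Y` on `Z`: `Y` and `Z` are
conditionally independent given `P_S Z`. -/
def IsDimReduction [IsFiniteMeasure P] (S : Submodule ℝ (E p)) : Prop :=
  CondIndepFun (sigmaProjZ P S) (sigmaProjZ_le P S) (Prod.snd : E p × Fin h → Fin h) (Z P) P

/-- The intersection of all dimension reduction subspaces. -/
def centralSubspace [IsFiniteMeasure P] : Submodule ℝ (E p) :=
  sInf {S | IsDimReduction P S}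

/-- The central subspace exists: the intersection of all dimension reduction subspaces is itself
a dimension reduction subspace. -/
def CentralSubspaceExists [IsFiniteMeasure P] : Prop :=
  IsDimReduction P (centralSubspace P)

/-- `f_y = Pr(Y = y)`. -/
def f (y : Fin h) : ℝ := P.real (Prod.snd ⁻¹' {y})

/-- `g_y = √f_y`. -/
def g (y : Fin h) : ℝ := √(f P y)

/-- `E(Z | Y = y)`. -/
def condMean (y : Fin h) : E p := ∫ w, Z P w ∂(P[|Prod.snd ⁻¹' {y}])

/-- The linearity condition `E(Z | P_S Z) = P_S Z`, `S` the central subspace. -/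
def Linearity [IsFiniteMeasure P] : Prop :=
  P[Z P | sigmaProjZ P (centralSubspace P)] =ᵐ[P] projZ P (centralSubspace P)

/-- The coverage condition `Span {E(Z | Y = y)} = S`, `S` the central subspace. -/
def Coverage [IsFiniteMeasure P] : Prop :=
  Submodule.span ℝ (Set.range (condMean P)) = centralSubspace P

/-- The `(i, j)` entry of `Var(Z | P_S Z)`. -/
def condCov (S : Submodule ℝ (E p)) (i j : Fin p) : E p × Fin h → ℝ :=
  P[fun w => (Z P w i - P[Z P | sigmaProjZ P S] w i) * (Z P w j - P[Z P | sigmaProjZ P S] w j)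
    | sigmaProjZ P S]

/-- The constant covariance condition `Var(Z | P_S Z) = Q_S = I - P_S`, `S` the central
subspace, entry by entry. -/
def ConstantCovariance [IsFiniteMeasure P] : Prop :=
  ∀ i j : Fin p, condCov P (centralSubspace P) i j =ᵐ[P] fun _ =>
    (EuclideanSpace.single j (1 : ℝ) -
      (centralSubspace P).starProjection (EuclideanSpace.single j 1)) i

/-- The `p × h` matrix `μ` with columns `g_y E(Z | Y = y)`. -/
def mu : Matrix (Fin p) (Fin h) ℝ :=
  Matrix.of fun i y => g P y * condMean P y i

/-- `β_y = Σ⁻¹ Cov(X, J_y)`, with `J_y` the indicator of `Y = y`. -/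
def beta (y : Fin h) : Fin p → ℝ :=
  (covX P)⁻¹ *ᵥ fun i => cov[fun w => w.1 i, fun w => if w.2 = y then 1 else 0; P]

/-- `ε_y = J_y - f_y - β_yᵀ (X - E(X))`. -/
def eps (w : E p × Fin h) (y : Fin h) : ℝ :=
  (if w.2 = y then 1 else 0) - f P y - beta P y ⬝ᵥ (fun i => w.1 i - meanX P i)

/-- `α = Σ^{-1/2} α_x (α_xᵀ Σ⁻¹ α_x)^{-1/2}`. -/
def alpha {r : ℕ} (αx : Matrix (Fin p) (Fin r) ℝ) : Matrix (Fin p) (Fin r) ℝ :=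
  invSqrt (covX P) * αx * invSqrt (αxᵀ * (covX P)⁻¹ * αx)

/-- The hypothesis subspace in the `Z` scale, `H = Span(Σ^{-1/2} α_x)`. -/
def hypSubspace {r : ℕ} (αx : Matrix (Fin p) (Fin r) ℝ) : Submodule ℝ (E p) :=
  colSpan (invSqrt (covX P) * αx)

/-- The coordinate hypothesis `P_H S = {0}`, `S` the central subspace. -/
def CoordinateHypothesis [IsFiniteMeasure P] {r : ℕ} (αx : Matrix (Fin p) (Fin r) ℝ) : Prop :=
  (centralSubspace P).map
    ((hypSubspace P αx).starProjection : E p →ₗ[ℝ] E p) = ⊥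

/-- The random matrix `Ψ₁ᵀ D_g⁻¹ ε εᵀ D_g⁻¹ Ψ₁ ⊗ αᵀ Z Zᵀ α`. -/
def omegaIntegrand {d r : ℕ} (Ψ₁ : Matrix (Fin h) (Fin d) ℝ) (αx : Matrix (Fin p) (Fin r) ℝ)
    (w : E p × Fin h) : Matrix (Fin d × Fin r) (Fin d × Fin r) ℝ :=
  (Ψ₁ᵀ * (Matrix.diagonal (g P))⁻¹ * Matrix.vecMulVec (eps P w) (eps P w) *
      (Matrix.diagonal (g P))⁻¹ * Ψ₁) ⊗ₖ
    ((alpha P αx)ᵀ * Matrix.vecMulVec (Z P w).ofLp (Z P w).ofLp * alpha P αx)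

/-- `Ω_{H|d} = E(Ψ₁ᵀ D_g⁻¹ ε εᵀ D_g⁻¹ Ψ₁ ⊗ αᵀ Z Zᵀ α)`, entry by entry. -/
def omega {d r : ℕ} (Ψ₁ : Matrix (Fin h) (Fin d) ℝ) (αx : Matrix (Fin p) (Fin r) ℝ) :
    Matrix (Fin d × Fin r) (Fin d × Fin r) ℝ :=
  Matrix.of fun a b => ∫ w, omegaIntegrand P Ψ₁ αx w a b ∂P

end Population

/-- `A = (Γ₁ Γ₀) (D_s 0; 0 0) (Ψ₁ Ψ₀)ᵀ` is a singular value decomposition of the `p × h` matrix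
`A`, with exactly `d` positive singular values `s`, in decreasing order. -/
structure IsSVD {p h d : ℕ} (A : Matrix (Fin p) (Fin h) ℝ)
    (Γ₁ : Matrix (Fin p) (Fin d) ℝ) (Γ₀ : Matrix (Fin p) (Fin (p - d)) ℝ) (s : Fin d → ℝ)
    (Ψ₁ : Matrix (Fin h) (Fin d) ℝ) (Ψ₀ : Matrix (Fin h) (Fin (h - d)) ℝ) : Prop where
  left_orth : (Matrix.fromCols Γ₁ Γ₀)ᵀ * Matrix.fromCols Γ₁ Γ₀ = 1
  left_orth' : Matrix.fromCols Γ₁ Γ₀ * (Matrix.fromCols Γ₁ Γ₀)ᵀ = 1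
  right_orth : (Matrix.fromCols Ψ₁ Ψ₀)ᵀ * Matrix.fromCols Ψ₁ Ψ₀ = 1
  right_orth' : Matrix.fromCols Ψ₁ Ψ₀ * (Matrix.fromCols Ψ₁ Ψ₀)ᵀ = 1
  pos : ∀ j, 0 < s j
  anti : Antitone s
  eq : A = Matrix.fromCols Γ₁ Γ₀ *
    (Matrix.fromBlocks (Matrix.diagonal s) 0 0 0 :
      Matrix (Fin d ⊕ Fin (p - d)) (Fin d ⊕ Fin (h - d)) ℝ) * (Matrix.fromCols Ψ₁ Ψ₀)ᵀ

/-! ### Sample quantities, for the data `w₁, …, wₙ` with `wₖ = (Xₖ, Yₖ)` -/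

section Sample

variable {p h n : ℕ} (w : Fin n → E p × Fin h)

/-- The sample mean of the predictors. -/
def sampleMean : E p := (n : ℝ)⁻¹ • ∑ k, (w k).1

/-- The sample covariance matrix, with divisor `n`. -/
def sampleCov : Matrix (Fin p) (Fin p) ℝ :=
  Matrix.of fun i j =>
    (n : ℝ)⁻¹ * ∑ k, ((w k).1 i - sampleMean w i) * ((w k).1 j - sampleMean w j)

/-- The sample standardized predictors. -/
def Zhat (k : Fin n) : E p :=
  Matrix.toEuclideanCLM (𝕜 := ℝ) (invSqrt (sampleCov w)) ((w k).1 - sampleMean w)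

/-- The observed fraction of observations in slice `y`. -/
def fhat (y : Fin h) : ℝ := ((Finset.univ.filter fun k => (w k).2 = y).card : ℝ) / n

/-- The estimated hypothesis subspace, the span of the columns of `Σ̂^{-1/2} α_x`. -/
def hypSubspaceHat {r : ℕ} (αx : Matrix (Fin p) (Fin r) ℝ) : Submodule ℝ (E p) :=
  colSpan (invSqrt (sampleCov w) * αx)

/-- The least squares loss `L_m(B, C)`, the sum over the observations of `‖Ẑ - B C_y‖²`, where
`y` is the slice of the observation. -/
def loss {m : ℕ} (B : Matrix (Fin p) (Fin m) ℝ) (C : Fin h → Fin m → ℝ) : ℝ :=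
  ∑ k, ‖Zhat w k - WithLp.toLp 2 (B *ᵥ C (w k).2)‖ ^ 2

/-- The residual sum of squares: the minimum of `L_m(B, C)` over the semi-orthogonal `p × m`
matrices `B` with `P_K B = 0` and the vectors `C_y` with `∑ f̂_y C_y = 0`. For `K = ⊥` the
constraint `P_K B = 0` is void. -/
def residualSS (m : ℕ) (K : Submodule ℝ (E p)) : ℝ :=
  sInf {L | ∃ (B : Matrix (Fin p) (Fin m) ℝ) (C : Fin h → Fin m → ℝ),
    Bᵀ * B = 1 ∧ (∀ j, K.starProjection (WithLp.toLp 2 (B.col j)) = 0) ∧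
    ∑ y, fhat w y • C y = 0 ∧ L = loss w B C}

/-- The statistic `T_n(H|d)`: the residual sum of squares under the dimension and coordinate
constraints minus the one under the dimension constraint alone. -/
def statistic (d : ℕ) {r : ℕ} (αx : Matrix (Fin p) (Fin r) ℝ) : ℝ :=
  residualSS w d (hypSubspaceHat w αx) - residualSS w d ⊥

end Sample

end

end SIR

/-!
Why the limit law holds. Each residual sum of squares is `∑ ‖Ẑ_k‖²` minus `n` times a sum of `d`
largest eigenvalues: for a given `B` the best `C_y` are the fitted slice means, and maximizing over
the `B` with `d` orthonormal columns in a subspace `W` gives the sum of the `d` largest eigenvalues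
(`kyFan`) of the `h × h` Gram matrix of the vectors `P_W √f̂_y Z̄_y` (`residualSS_eq`, by passing
from a map to its adjoint in `exists_orthonormal_sum_le_adjoint`). Hence, for every sample,
`T_n = n (kyFan Ĝ - kyFan (Ĝ - F̂))` with `Ĝ = μ̂ᵀ μ̂` and `F̂ = μ̂ᵀ P_Ĥ μ̂`
(`statistic_eq`). In these two matrices the inverse square roots of `Σ̂` combine to `Σ̂⁻¹`, so that
they are elementary functions of sample moments.

`Ĝ` converges to `G = μᵀ μ`, which has rank `d` by coverage: `G = Ψ diag(l) Ψᵀ` with `l > 0`. Since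
the remaining eigenvalues of `G` vanish, there is an eigenvalue gap, and to first order
`kyFan Ĝ - kyFan (Ĝ - F̂)` is `tr (Ψᵀ F̂ Ψ)`, with an explicit error
(`abs_kyFan_sub_kyFan_sub_le`). No differentiability of eigenvalues or eigenvectors is needed.

Under the coordinate hypothesis the population regression coefficients `β_y` are annihilated by
`α_xᵀ`. In `n F̂` the covariances of `X` with the slice indicators can therefore be replaced by
those of `X` with the residuals `ε_y` (`sampleGramHyp_eq`), and `n F̂` is a continuous function of the
scaled sum of the vectors `((X - E X) ε_y, X - E X)` and of consistent estimators
(`hypGram_scaledSum`). By the multivariate central limit theorem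
(`exists_tendstoInDistribution_scaledSum`) and Slutsky's theorem, `T_n` tends in law to the squared
norm of a Gaussian vector with covariance matrix `Ω`.

The form of `Ω`. Let `𝒮` be the central subspace. The residuals are functions of `Y` and `P_𝒮 Z`,
while `αᵀ Z` depends on the projection of `Z` on a subspace of `𝒮ᗮ`. Given `P_𝒮 Z`, the slice is
independent of `Z`, and the conditional second moments of `αᵀ Z` are constant. Hence the expectation
of the Kronecker product factors (`integral_inner_mul_inner_mul_eps`), and
`E (Ψᵀ D_g⁻¹ ε εᵀ D_g⁻¹ Ψ) = I - diag(l)` follows from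
`D_g⁻¹ E (ε εᵀ) D_g⁻¹ = I - g gᵀ - μᵀ μ` and `μ g = 0` (`integral_score_mul_score`). Every singular
value decomposition of `μ` gives a factorization `μᵀ μ = Ψ₁ D_s² Ψ₁ᵀ` of the same kind, with the
same `l` because `l` lists the nonzero eigenvalues in decreasing order.
-/

namespace SIR

noncomputable section

/-! ### Sums of the largest eigenvalues -/

/-- The `h × d` matrices with orthonormal columns. -/
def frames (h d : ℕ) : Set (Matrix (Fin h) (Fin d) ℝ) := {D | Dᵀ * D = 1}

/-- The largest value of `tr(DᵀAD)` over the matrices `D` with `d` orthonormal columns. For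
symmetric `A` it is the sum of the `d` largest eigenvalues (Ky Fan). -/
def kyFan {h : ℕ} (d : ℕ) (A : Matrix (Fin h) (Fin h) ℝ) : ℝ :=
  sSup ((fun D : Matrix (Fin h) (Fin d) ℝ => (Dᵀ * A * D).trace) '' frames h d)

/-- The sum of the absolute values of the entries. -/
def entryNorm {h : ℕ} (A : Matrix (Fin h) (Fin h) ℝ) : ℝ := ∑ i, ∑ j, |A i j|

lemma entryNorm_nonneg {h : ℕ} (A : Matrix (Fin h) (Fin h) ℝ) : 0 ≤ entryNorm A :=
  Finset.sum_nonneg fun _ _ => Finset.sum_nonneg fun _ _ => abs_nonneg _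

lemma entryNorm_sub_le {h : ℕ} (A B : Matrix (Fin h) (Fin h) ℝ) :
    entryNorm (A - B) ≤ entryNorm A + entryNorm B := by
  simp only [entryNorm, ← Finset.sum_add_distrib, Matrix.sub_apply]
  gcongr
  exact abs_sub _ _

lemma entryNorm_smul {h : ℕ} (c : ℝ) (A : Matrix (Fin h) (Fin h) ℝ) :
    entryNorm (c • A) = |c| * entryNorm A := by
  simp [entryNorm, abs_mul, Finset.mul_sum]

lemma abs_trace_mul_le {h : ℕ} (A P : Matrix (Fin h) (Fin h) ℝ) {b : ℝ}
    (hP : ∀ i j, |P i j| ≤ b) : |(A * P).trace| ≤ entryNorm A * b := by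
  simp only [Matrix.trace, Matrix.diag, Matrix.mul_apply, entryNorm, Finset.sum_mul]
  refine (Finset.abs_sum_le_sum_abs _ _).trans (Finset.sum_le_sum fun i _ => ?_)
  refine (Finset.abs_sum_le_sum_abs _ _).trans (Finset.sum_le_sum fun j _ => ?_)
  rw [abs_mul]
  exact mul_le_mul_of_nonneg_left (hP j i) (abs_nonneg _)

lemma trace_transpose_mul_self {m n : ℕ} (A : Matrix (Fin m) (Fin n) ℝ) :
    (Aᵀ * A).trace = ∑ j, ∑ i, A i j ^ 2 := by
  simp [Matrix.trace, Matrix.mul_apply, sq]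

lemma sq_entry_le_trace {m n : ℕ} (A : Matrix (Fin m) (Fin n) ℝ) (i : Fin m) (j : Fin n) :
    A i j ^ 2 ≤ (Aᵀ * A).trace := by
  rw [trace_transpose_mul_self]
  refine le_trans ?_ (Finset.single_le_sum (f := fun j => ∑ i, A i j ^ 2)
    (fun _ _ => Finset.sum_nonneg fun _ _ => sq_nonneg _) (Finset.mem_univ j))
  exact Finset.single_le_sum (f := fun i => A i j ^ 2) (fun _ _ => sq_nonneg _) (Finset.mem_univ i)

section Frames

variable {h d : ℕ}

lemma trace_frame_mul (D : Matrix (Fin h) (Fin d) ℝ) (A : Matrix (Fin h) (Fin h) ℝ) :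
    (Dᵀ * A * D).trace = (A * (D * Dᵀ)).trace := by
  rw [Matrix.mul_assoc, Matrix.trace_mul_comm, Matrix.mul_assoc]

lemma trace_proj_mul_proj {D E : Matrix (Fin h) (Fin d) ℝ} (hD : D ∈ frames h d)
    (hE : E ∈ frames h d) :
    ((D * Dᵀ - E * Eᵀ)ᵀ * (D * Dᵀ - E * Eᵀ)).trace
      = 2 * (d - (D * Dᵀ * (E * Eᵀ)).trace) := by
  have hD' : Dᵀ * D = 1 := hD
  have hE' : Eᵀ * E = 1 := hE
  have h1 : D * Dᵀ * (D * Dᵀ) = D * Dᵀ := by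
    rw [Matrix.mul_assoc, ← Matrix.mul_assoc Dᵀ, hD', Matrix.one_mul]
  have h2 : E * Eᵀ * (E * Eᵀ) = E * Eᵀ := by
    rw [Matrix.mul_assoc, ← Matrix.mul_assoc Eᵀ, hE', Matrix.one_mul]
  have h3 : (D * Dᵀ).trace = d := by rw [Matrix.trace_mul_comm, hD']; simp
  have h4 : (E * Eᵀ).trace = d := by rw [Matrix.trace_mul_comm, hE']; simp
  have h5 : (E * Eᵀ * (D * Dᵀ)).trace = (D * Dᵀ * (E * Eᵀ)).trace := Matrix.trace_mul_comm _ _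
  simp only [Matrix.transpose_sub, Matrix.transpose_mul, Matrix.transpose_transpose,
    Matrix.sub_mul, Matrix.mul_sub, Matrix.trace_sub, h1, h2, h3, h4, h5]
  ring

lemma abs_frame_le_one {D : Matrix (Fin h) (Fin d) ℝ} (hD : D ∈ frames h d) (i : Fin h)
    (j : Fin d) : |D i j| ≤ 1 := by
  have h1 : (Dᵀ * D) j j = 1 := by rw [show Dᵀ * D = 1 from hD]; simp
  rw [Matrix.mul_apply] at h1
  rw [← sq_le_one_iff_abs_le_one, ← h1]
  simp only [Matrix.transpose_apply, ← sq]
  exact Finset.single_le_sum (f := fun i => D i j ^ 2) (fun _ _ => sq_nonneg _) (Finset.mem_univ i)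

lemma abs_proj_le {D : Matrix (Fin h) (Fin d) ℝ} (hD : D ∈ frames h d) (i j : Fin h) :
    |(D * Dᵀ) i j| ≤ d := by
  rw [Matrix.mul_apply]
  refine (Finset.abs_sum_le_sum_abs _ _).trans ?_
  calc ∑ k, |D i k * Dᵀ k j| ≤ ∑ _k : Fin d, (1 : ℝ) := by
        refine Finset.sum_le_sum fun k _ => ?_
        rw [abs_mul]
        exact mul_le_one₀ (abs_frame_le_one hD _ _) (abs_nonneg _) (abs_frame_le_one hD _ _)
    _ = d := by simp

lemma isCompact_frames : IsCompact (frames h d) := by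
  have hcl : IsClosed (frames h d) :=
    isClosed_eq (by fun_prop) continuous_const
  refine (isCompact_univ_pi fun _ : Fin h => isCompact_univ_pi fun _ : Fin d =>
    isCompact_Icc (a := (-1 : ℝ)) (b := 1)).of_isClosed_subset hcl ?_
  intro D hD i _ j _
  exact abs_le.mp (abs_frame_le_one hD i j)

lemma frames_nonempty (hdh : d ≤ h) : (frames h d).Nonempty := by
  refine ⟨Matrix.of fun i j => if i = Fin.castLE hdh j then 1 else 0, ?_⟩
  ext i j
  simp [Matrix.mul_apply, Matrix.one_apply, eq_comm]

lemma continuous_trace_frame :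
    Continuous fun q : Matrix (Fin h) (Fin h) ℝ × Matrix (Fin h) (Fin d) ℝ =>
      (q.2ᵀ * q.1 * q.2).trace := by
  fun_prop

lemma continuous_kyFan : Continuous (kyFan (h := h) d) :=
  isCompact_frames.continuous_sSup
    (f := fun (A : Matrix (Fin h) (Fin h) ℝ) (D : Matrix (Fin h) (Fin d) ℝ) => (Dᵀ * A * D).trace)
    continuous_trace_frame

lemma bddAbove_kyFan (A : Matrix (Fin h) (Fin h) ℝ) :
    BddAbove ((fun D : Matrix (Fin h) (Fin d) ℝ => (Dᵀ * A * D).trace) '' frames h d) :=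
  isCompact_frames.bddAbove_image (by fun_prop)

lemma trace_le_kyFan (A : Matrix (Fin h) (Fin h) ℝ) {D : Matrix (Fin h) (Fin d) ℝ}
    (hD : D ∈ frames h d) : (Dᵀ * A * D).trace ≤ kyFan d A :=
  le_csSup (bddAbove_kyFan A) ⟨D, hD, rfl⟩

lemma exists_kyFan_eq (hdh : d ≤ h) (A : Matrix (Fin h) (Fin h) ℝ) :
    ∃ D ∈ frames h d, kyFan d A = (Dᵀ * A * D).trace := by
  obtain ⟨D, hD, hmax⟩ := isCompact_frames.exists_sSup_image_eq (frames_nonempty hdh)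
    (f := fun D : Matrix (Fin h) (Fin d) ℝ => (Dᵀ * A * D).trace) (by fun_prop)
  exact ⟨D, hD, hmax⟩

/-- A maximizer of `tr(DᵀAD)` spans nearly the range of `Ψ diag(l) Ψᵀ` when `A` is close to the
latter matrix: the eigenvalue gap turns the loss in the trace into a distance of projections. -/
lemma trace_proj_sub_le {l : Fin d → ℝ} {c : ℝ} (hc : 0 < c) (hl : ∀ j, c ≤ l j)
    {Ψ : Matrix (Fin h) (Fin d) ℝ} (hΨ : Ψ ∈ frames h d) (A : Matrix (Fin h) (Fin h) ℝ)
    {D : Matrix (Fin h) (Fin d) ℝ} (hD : D ∈ frames h d)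
    (hmax : (Ψᵀ * A * Ψ).trace ≤ (Dᵀ * A * D).trace) :
    ((D * Dᵀ - Ψ * Ψᵀ)ᵀ * (D * Dᵀ - Ψ * Ψᵀ)).trace
      ≤ 4 * d / c * entryNorm (A - Ψ * Matrix.diagonal l * Ψᵀ) := by
  set A₀ := Ψ * Matrix.diagonal l * Ψᵀ with hA₀
  have hΨ' : Ψᵀ * Ψ = 1 := hΨ
  have hD' : Dᵀ * D = 1 := hD
  set P := D * Dᵀ with hP
  set R := Ψ * Ψᵀ with hR
  have e1 := abs_trace_mul_le (A - A₀) P (abs_proj_le hD)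
  have e2 := abs_trace_mul_le (A - A₀) R (abs_proj_le hΨ)
  rw [trace_frame_mul, trace_frame_mul, ← hP, ← hR] at hmax
  rw [Matrix.sub_mul, Matrix.trace_sub] at e1 e2
  have h1 : (A₀ * R).trace - (A₀ * P).trace ≤ 2 * d * entryNorm (A - A₀) := by
    have := (abs_le.mp e1).2
    have := (abs_le.mp e2).1
    linarith
  -- the loss in the trace, written in the coordinates of the frame `Ψ`
  set M := Ψᵀ * (1 - P) * Ψ with hM
  have hPs : Pᵀ = P := by simp [hP]
  have hPP : P * P = P := by
    rw [hP, Matrix.mul_assoc, ← Matrix.mul_assoc Dᵀ, hD', Matrix.one_mul]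
  have hMM : M = ((1 - P) * Ψ)ᵀ * ((1 - P) * Ψ) := by
    rw [Matrix.transpose_mul, Matrix.transpose_sub, hPs, Matrix.transpose_one, hM,
      Matrix.mul_assoc, Matrix.mul_assoc, ← Matrix.mul_assoc (1 - P) (1 - P)]
    congr 2
    simp [Matrix.sub_mul, Matrix.mul_sub, hPP]
  have hMnn : ∀ j, 0 ≤ M j j := by
    intro j
    rw [hMM, Matrix.mul_apply]
    exact Finset.sum_nonneg fun i _ => mul_self_nonneg _
  have h2 : (A₀ * R).trace - (A₀ * P).trace = ∑ j, l j * M j j := by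
    have hA₀R : A₀ * R = A₀ := by
      rw [hA₀, hR, Matrix.mul_assoc, ← Matrix.mul_assoc Ψᵀ, hΨ', Matrix.one_mul]
    have : (A₀ * R).trace - (A₀ * P).trace = (Matrix.diagonal l * M).trace := by
      rw [hA₀R, ← Matrix.trace_sub, hM]
      conv_lhs => rw [show A₀ - A₀ * P = A₀ * (1 - P) by simp [Matrix.mul_sub]]
      rw [hA₀, Matrix.mul_assoc, Matrix.mul_assoc, Matrix.trace_mul_comm]
      simp only [Matrix.mul_assoc]
    rw [this]
    simp [Matrix.trace, Matrix.diagonal_mul]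
  have h3 : ∑ j, M j j = d - (P * R).trace := by
    have : M.trace = d - (P * R).trace := by
      rw [hM, Matrix.mul_sub, Matrix.sub_mul, Matrix.trace_sub, Matrix.mul_one, hΨ',
        trace_frame_mul]
      simp [hR]
    exact this
  have h4 : c * ∑ j, M j j ≤ ∑ j, l j * M j j := by
    rw [Finset.mul_sum]
    exact Finset.sum_le_sum fun j _ => mul_le_mul_of_nonneg_right (hl j) (hMnn j)
  rw [trace_proj_mul_proj hD hΨ, ← hP, ← hR, ← h3]
  have h5 : c * ∑ j, M j j ≤ 2 * d * entryNorm (A - A₀) := by linarith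
  rw [div_mul_eq_mul_div, le_div_iff₀ hc]
  nlinarith

/-- First-order perturbation of the sum of the `d` largest eigenvalues near a positive
semidefinite matrix of rank `d`, with an explicit error. -/
theorem abs_kyFan_sub_kyFan_sub_le (hdh : d ≤ h) {l : Fin d → ℝ} {c : ℝ} (hc : 0 < c)
    (hl : ∀ j, c ≤ l j) {Ψ : Matrix (Fin h) (Fin d) ℝ} (hΨ : Ψ ∈ frames h d)
    (A F : Matrix (Fin h) (Fin h) ℝ) :
    |kyFan d A - kyFan d (A - F) - (Ψᵀ * F * Ψ).trace| ≤
      entryNorm F * √(4 * d / c *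
        (entryNorm (A - Ψ * Matrix.diagonal l * Ψᵀ) + entryNorm F)) := by
  set A₀ := Ψ * Matrix.diagonal l * Ψᵀ with hA₀
  have hK : 0 ≤ 4 * d / c := by positivity
  -- both maximizers give first-order expressions, and both are close to `Ψ`
  have key : ∀ (A' : Matrix (Fin h) (Fin h) ℝ) (D : Matrix (Fin h) (Fin d) ℝ), D ∈ frames h d →
      kyFan d A' = (Dᵀ * A' * D).trace → entryNorm (A' - A₀) ≤ entryNorm (A - A₀) + entryNorm F →
      |(Dᵀ * F * D).trace - (Ψᵀ * F * Ψ).trace| ≤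
        entryNorm F * √(4 * d / c * (entryNorm (A - A₀) + entryNorm F)) := by
    intro A' D hD hmax hle
    have h1 := trace_proj_sub_le hc hl hΨ A' hD (hmax ▸ trace_le_kyFan A' hΨ)
    rw [trace_frame_mul, trace_frame_mul, ← Matrix.trace_sub, ← Matrix.mul_sub]
    refine abs_trace_mul_le _ _ fun i j => ?_
    refine Real.abs_le_sqrt ((sq_entry_le_trace _ i j).trans (h1.trans ?_))
    exact mul_le_mul_of_nonneg_left hle hK
  obtain ⟨D, hD, hDmax⟩ := exists_kyFan_eq hdh A
  obtain ⟨D', hD', hDmax'⟩ := exists_kyFan_eq hdh (A - F)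
  have k1 := key A D hD hDmax (le_add_of_nonneg_right (entryNorm_nonneg F))
  have k2 := key (A - F) D' hD' hDmax' (by
    rw [sub_right_comm]; exact entryNorm_sub_le _ _)
  have u1 := trace_le_kyFan (A - F) hD
  have u2 := trace_le_kyFan A hD'
  have s : ∀ D : Matrix (Fin h) (Fin d) ℝ, (Dᵀ * (A - F) * D).trace
      = (Dᵀ * A * D).trace - (Dᵀ * F * D).trace := fun D => by
    rw [Matrix.mul_sub, Matrix.sub_mul, Matrix.trace_sub]
  rw [s] at u1 hDmax'
  rw [abs_le] at k1 k2 ⊢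
  constructor <;> linarith [k1.1, k1.2, k2.1, k2.2]

end Frames

/-! ### The constrained least squares problem -/

/-- If `T` maps into `W` and `W` has room for `d` orthonormal vectors, then the value of
`∑ ‖T Dⱼ‖²` at an orthonormal family is dominated by the value of `∑ ‖T* Bⱼ‖²` at one in `W`: take
for `B` an orthonormal family whose span contains the vectors `T Dⱼ`. -/
lemma exists_orthonormal_sum_le_adjoint {E F : Type*} [NormedAddCommGroup E]
    [InnerProductSpace ℝ E] [FiniteDimensional ℝ E] [NormedAddCommGroup F]
    [InnerProductSpace ℝ F] [FiniteDimensional ℝ F] {d : ℕ} (T : E →L[ℝ] F) (W : Submodule ℝ F)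
    (hW : d ≤ Module.finrank ℝ W) (hT : ∀ x, T x ∈ W) {D : Fin d → E} (hD : Orthonormal ℝ D) :
    ∃ B : Fin d → F, Orthonormal ℝ B ∧ (∀ j, B j ∈ W) ∧
      ∑ j, ‖T (D j)‖ ^ 2 ≤ ∑ j, ‖T.adjoint (B j)‖ ^ 2 := by
  let f : Fin (Module.finrank ℝ W) → W := fun i =>
    if hi : (i : ℕ) < d then ⟨T (D ⟨i, hi⟩), hT _⟩ else 0
  let b := InnerProductSpace.gramSchmidtOrthonormalBasis (𝕜 := ℝ) (E := W) (by simp) f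
  let B : Fin d → F := fun j => (b (Fin.castLE hW j) : F)
  have hB : Orthonormal ℝ B :=
    (b.orthonormal.comp_linearIsometry W.subtypeₗᵢ).comp _ (Fin.castLE_injective hW)
  refine ⟨B, hB, fun j => (b (Fin.castLE hW j)).2, ?_⟩
  have h1 : ∀ j, ‖T (D j)‖ ^ 2 = ∑ i, (inner ℝ (B i) (T (D j))) ^ 2 := by
    intro j
    have hf : f (Fin.castLE hW j) = ⟨T (D j), hT _⟩ := by simp [f]
    have h2 := b.sum_sq_norm_inner_right (f (Fin.castLE hW j))
    have h3 : ‖f (Fin.castLE hW j)‖ = ‖T (D j)‖ := by rw [hf]; rfl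
    rw [← h3, ← h2]
    have h4 : ∀ i, ‖inner ℝ (b i) (f (Fin.castLE hW j))‖ ^ 2
        = (inner ℝ ((b i : W) : F) (T (D j))) ^ 2 := by
      intro i
      rw [Real.norm_eq_abs, sq_abs, hf]
      rfl
    have h5 : ∑ i, (inner ℝ (B i) (T (D j))) ^ 2
        = ∑ i ∈ Finset.univ.map (Fin.castLEEmb hW),
          ‖inner ℝ (b i) (f (Fin.castLE hW j))‖ ^ 2 := by
      rw [Finset.sum_map]
      exact Finset.sum_congr rfl fun i _ => (h4 _).symm
    rw [h5]
    symm
    refine Finset.sum_subset (Finset.subset_univ _) fun i _ hi => ?_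
    have hdi : d ≤ (i : ℕ) := by
      by_contra hlt
      exact hi (Finset.mem_map.mpr ⟨⟨i, not_le.mp hlt⟩, Finset.mem_univ _, rfl⟩)
    have : Fin.castLE hW j < i := by
      rw [Fin.lt_def]
      exact lt_of_lt_of_le j.2 hdi
    rw [InnerProductSpace.gramSchmidtOrthonormalBasis_inv_triangular _ _ this]
    simp
  simp_rw [h1]
  rw [Finset.sum_comm]
  refine Finset.sum_le_sum fun i _ => ?_
  have h6 := hD.sum_inner_products_le (s := Finset.univ) (T.adjoint (B i))
  refine le_trans (le_of_eq (Finset.sum_congr rfl fun j _ => ?_)) h6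
  rw [Real.norm_eq_abs, sq_abs, ContinuousLinearMap.adjoint_inner_right, real_inner_comm]

lemma orthonormal_col {p d : ℕ} {B : Matrix (Fin p) (Fin d) ℝ} :
    Orthonormal ℝ (fun j => (WithLp.toLp 2 (B.col j) : E p)) ↔ Bᵀ * B = 1 := by
  rw [orthonormal_iff_ite, ← Matrix.ext_iff]
  refine forall₂_congr fun i j => ?_
  rw [Matrix.mul_apply, Matrix.one_apply, PiLp.inner_apply]
  simp [mul_comm]

section Gram

variable {p h d : ℕ}

/-- The Gram matrix of the projections of the vectors `v y` onto `W`. -/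
def projGram (W : Submodule ℝ (E p)) (v : Fin h → E p) : Matrix (Fin h) (Fin h) ℝ :=
  Matrix.of fun y y' => inner ℝ (W.starProjection (v y)) (v y')

/-- The linear map with matrix columns `P_W v_y`. -/
def projMap (W : Submodule ℝ (E p)) (v : Fin h → E p) : E h →L[ℝ] E p :=
  ∑ y, (EuclideanSpace.proj y : E h →L[ℝ] ℝ).smulRight (W.starProjection (v y))

lemma projMap_apply (W : Submodule ℝ (E p)) (v : Fin h → E p) (x : E h) :
    projMap W v x = ∑ y, x y • W.starProjection (v y) := by
  simp [projMap]

lemma sum_norm_projMap_sq (W : Submodule ℝ (E p)) (v : Fin h → E p)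
    (D : Matrix (Fin h) (Fin d) ℝ) :
    ∑ j, ‖projMap W v (WithLp.toLp 2 (D.col j))‖ ^ 2 = (Dᵀ * projGram W v * D).trace := by
  have key : ∀ y y', inner ℝ (W.starProjection (v y)) (W.starProjection (v y'))
      = projGram W v y y' := by
    intro y y'
    rw [projGram, Matrix.of_apply, ← Submodule.inner_starProjection_left_eq_right,
      Submodule.starProjection_eq_self_iff.mpr (Submodule.starProjection_apply_mem _ _)]
  simp only [Matrix.trace, Matrix.diag, Matrix.mul_apply, Matrix.transpose_apply]
  refine Finset.sum_congr rfl fun j _ => ?_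
  rw [← real_inner_self_eq_norm_sq, projMap_apply, sum_inner]
  simp_rw [Finset.sum_mul, inner_sum, real_inner_smul_left, real_inner_smul_right, key]
  rw [Finset.sum_comm]
  exact Finset.sum_congr rfl fun y _ => Finset.sum_congr rfl fun y' _ => by
    simp; ring

lemma norm_adjoint_projMap_sq (W : Submodule ℝ (E p)) (v : Fin h → E p) {B : E p} (hB : B ∈ W) :
    ‖(projMap W v).adjoint B‖ ^ 2 = ∑ y, (inner ℝ B (v y)) ^ 2 := by
  rw [EuclideanSpace.real_norm_sq_eq]
  refine Finset.sum_congr rfl fun y _ => ?_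
  have h1 : ((projMap W v).adjoint B) y
      = inner ℝ ((projMap W v).adjoint B) (EuclideanSpace.single y 1) := by
    simp [EuclideanSpace.inner_single_right]
  have h2 : projMap W v (EuclideanSpace.single y 1) = W.starProjection (v y) := by
    rw [projMap_apply]
    rw [Finset.sum_eq_single y] <;> simp +contextual
  rw [h1, ContinuousLinearMap.adjoint_inner_left, h2,
    ← Submodule.inner_starProjection_left_eq_right, Submodule.starProjection_eq_self_iff.mpr hB]

/-- The sum of the `d` largest eigenvalues of the Gram matrix of the vectors `P_W v_y` bounds the
part of the `v_y` that `d` orthonormal vectors of `W` capture. -/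
lemma sum_inner_sq_le_kyFan {W : Submodule ℝ (E p)} (hdh : d ≤ h) (v : Fin h → E p)
    {B : Fin d → E p} (hB : Orthonormal ℝ B) (hBW : ∀ j, B j ∈ W) :
    ∑ j, ∑ y, (inner ℝ (B j) (v y)) ^ 2 ≤ kyFan d (projGram W v) := by
  obtain ⟨D, hD, -, hle⟩ := exists_orthonormal_sum_le_adjoint (projMap W v).adjoint ⊤
    (by simpa using hdh) (fun _ => Submodule.mem_top) hB
  rw [ContinuousLinearMap.adjoint_adjoint] at hle
  set M : Matrix (Fin h) (Fin d) ℝ := Matrix.of fun i j => D j i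
  have hM : (fun j => (WithLp.toLp 2 (M.col j) : E h)) = D := by
    ext j i; rfl
  have hMf : M ∈ frames h d := orthonormal_col.mp (hM ▸ hD)
  have h1 : ∀ j, (WithLp.toLp 2 (M.col j) : E h) = D j := fun j => congrFun hM j
  calc _ = ∑ j, ‖(projMap W v).adjoint (B j)‖ ^ 2 :=
        Finset.sum_congr rfl fun j _ => (norm_adjoint_projMap_sq W v (hBW j)).symm
    _ ≤ ∑ j, ‖projMap W v (D j)‖ ^ 2 := hle
    _ = (Mᵀ * projGram W v * M).trace := by
        rw [← sum_norm_projMap_sq]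
        simp_rw [h1]
    _ ≤ _ := trace_le_kyFan _ hMf

/-- The bound of `sum_inner_sq_le_kyFan` is attained if `W` has room for `d` orthonormal vectors. -/
lemma exists_kyFan_le_sum_inner_sq {W : Submodule ℝ (E p)} (hdh : d ≤ h)
    (hdW : d ≤ Module.finrank ℝ W) (v : Fin h → E p) :
    ∃ B : Fin d → E p, Orthonormal ℝ B ∧ (∀ j, B j ∈ W) ∧
      kyFan d (projGram W v) ≤ ∑ j, ∑ y, (inner ℝ (B j) (v y)) ^ 2 := by
  obtain ⟨D, hD, hmax⟩ := exists_kyFan_eq hdh (projGram W v)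
  obtain ⟨B, hB, hBW, hle⟩ := exists_orthonormal_sum_le_adjoint (projMap W v) W hdW
    (fun x => by
      rw [projMap_apply]
      exact Submodule.sum_mem _ fun y _ =>
        Submodule.smul_mem _ _ (Submodule.starProjection_apply_mem _ _))
    (orthonormal_col.mpr hD)
  refine ⟨B, hB, hBW, ?_⟩
  rw [hmax, ← sum_norm_projMap_sq]
  refine hle.trans (le_of_eq ?_)
  exact Finset.sum_congr rfl fun j _ => norm_adjoint_projMap_sq W v (hBW j)

end Gram

section LeastSquares

variable {p h n d : ℕ} (w : Fin n → E p × Fin h)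

/-- The columns `√f̂_y Z̄_y` of the sample version of `μ`. -/
def muHatCol (y : Fin h) : E p :=
  (√(fhat w y))⁻¹ • ((n : ℝ)⁻¹ • ∑ k with (w k).2 = y, Zhat w k)

lemma card_slice (y : Fin h) :
    ((Finset.univ.filter fun k => (w k).2 = y).card : ℝ) = n * fhat w y := by
  rcases Nat.eq_zero_or_pos n with rfl | hn
  · simp
  · rw [fhat, mul_div_cancel₀]
    positivity

lemma fhat_nonneg (y : Fin h) : 0 ≤ fhat w y := by
  unfold fhat; positivity

lemma sum_slice_Zhat (y : Fin h) :
    ∑ k with (w k).2 = y, Zhat w k = ((n : ℝ) * √(fhat w y)) • muHatCol w y := by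
  rcases Nat.eq_zero_or_pos n with rfl | hn
  · simp
  rcases eq_or_ne (fhat w y) 0 with h0 | h0
  · have hc := card_slice w y
    rw [h0, mul_zero, Nat.cast_eq_zero, Finset.card_eq_zero] at hc
    simp [hc, h0]
  · have : √(fhat w y) ≠ 0 := (Real.sqrt_pos.mpr (lt_of_le_of_ne (fhat_nonneg w y) h0.symm)).ne'
    rw [muHatCol, smul_smul, smul_smul]
    rw [show (n : ℝ) * √(fhat w y) * (√(fhat w y))⁻¹ * (n : ℝ)⁻¹ = 1 by field_simp, one_smul]

lemma sum_sub_sampleMean : ∑ k, ((w k).1 - sampleMean w) = 0 := by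
  rcases Nat.eq_zero_or_pos n with rfl | hn
  · simp
  rw [Finset.sum_sub_distrib, sampleMean]
  have : (n : ℝ) ≠ 0 := by positivity
  simp only [Finset.sum_const, Finset.card_univ, Fintype.card_fin]
  rw [← Nat.cast_smul_eq_nsmul ℝ, smul_smul, mul_inv_cancel₀ this, one_smul, sub_self]

lemma sum_Zhat : ∑ k, Zhat w k = 0 := by
  unfold Zhat
  rw [← map_sum, sum_sub_sampleMean, map_zero]

/-- The loss is minimal, for a given `B`, where the `C_y` are the fitted slice means. -/
lemma loss_eq {B : Matrix (Fin p) (Fin d) ℝ} (hB : Bᵀ * B = 1) (C : Fin h → Fin d → ℝ) :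
    loss w B C = ∑ k, ‖Zhat w k‖ ^ 2
      - n * ∑ j, ∑ y, (inner ℝ (WithLp.toLp 2 (B.col j) : E p) (muHatCol w y)) ^ 2
      + n * ∑ j, ∑ y, (√(fhat w y) * C y j
          - inner ℝ (WithLp.toLp 2 (B.col j) : E p) (muHatCol w y)) ^ 2 := by
  set b : Fin d → E p := fun j => WithLp.toLp 2 (B.col j) with hb
  have hbo : Orthonormal ℝ b := orthonormal_col.mpr hB
  have hmul : ∀ c : Fin d → ℝ, (WithLp.toLp 2 (B *ᵥ c) : E p) = ∑ j, c j • b j := by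
    intro c
    ext i
    simp [hb, Matrix.mulVec, dotProduct, mul_comm]
  have hexp : ∀ (z : E p) (c : Fin d → ℝ), ‖z - WithLp.toLp 2 (B *ᵥ c)‖ ^ 2
      = ‖z‖ ^ 2 + ∑ j, (c j ^ 2 - 2 * c j * inner ℝ (b j) z) := by
    intro z c
    rw [norm_sub_sq_real, hmul, inner_sum, Finset.sum_sub_distrib,
      ← real_inner_self_eq_norm_sq (∑ j, c j • b j), hbo.inner_sum]
    simp only [real_inner_smul_right, real_inner_comm z, sq, Finset.mul_sum, conj_trivial]
    rw [show ∀ x y s : ℝ, x - y + s = x + (s - y) from fun _ _ _ => by ring]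
    congr 2
    exact Finset.sum_congr rfl fun j _ => by ring
  unfold loss
  simp_rw [hexp]
  rw [Finset.sum_add_distrib, sub_add, sub_eq_add_neg]
  congr 1
  rw [← Finset.sum_fiberwise (s := Finset.univ) (g := fun k => (w k).2), ← mul_sub,
    ← Finset.sum_sub_distrib, Finset.mul_sum, ← Finset.sum_neg_distrib]
  simp_rw [← Finset.sum_sub_distrib, Finset.mul_sum, ← Finset.sum_neg_distrib]
  rw [Finset.sum_comm (s := (Finset.univ : Finset (Fin d)))]
  refine Finset.sum_congr rfl fun y _ => ?_
  rw [Finset.sum_comm]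
  calc _ = ∑ k with (w k).2 = y, ∑ j, (C y j ^ 2 - 2 * C y j * inner ℝ (b j) (Zhat w k)) := by
        rw [Finset.sum_comm]
        refine Finset.sum_congr rfl fun k hk => ?_
        rw [(Finset.mem_filter.mp hk).2]
    _ = _ := by
        rw [Finset.sum_comm]
        refine Finset.sum_congr rfl fun j _ => ?_
        rw [Finset.sum_sub_distrib, Finset.sum_const, nsmul_eq_mul, card_slice, ← Finset.mul_sum,
          ← inner_sum, sum_slice_Zhat, real_inner_smul_right]
        have hs := Real.mul_self_sqrt (fhat_nonneg w y)
        linear_combination (-(n : ℝ) * C y j ^ 2) * hs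

/-- The minimum in the least squares problem, in terms of the Gram matrix of the `√f̂_y Z̄_y`. -/
theorem residualSS_eq (hdh : d ≤ h) (K : Submodule ℝ (E p)) (hdK : d ≤ Module.finrank ℝ Kᗮ) :
    residualSS w d K
      = ∑ k, ‖Zhat w k‖ ^ 2 - n * kyFan d (projGram Kᗮ (muHatCol w)) := by
  refine IsLeast.csInf_eq ⟨?_, ?_⟩
  · obtain ⟨b, hb, hbK, hle⟩ := exists_kyFan_le_sum_inner_sq hdh hdK (muHatCol w)
    set B : Matrix (Fin p) (Fin d) ℝ := Matrix.of fun i j => b j i with hBdef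
    have hcol : ∀ j, (WithLp.toLp 2 (B.col j) : E p) = b j := fun j => by ext i; rfl
    have hB : Bᵀ * B = 1 := orthonormal_col.mp (by simpa only [hcol] using hb)
    refine ⟨B, fun y j => (√(fhat w y))⁻¹ * inner ℝ (b j) (muHatCol w y), hB, ?_, ?_, ?_⟩
    · intro j
      rw [hcol, Submodule.starProjection_apply_eq_zero_iff]
      exact hbK j
    · ext j
      have h1 : ∀ y, fhat w y * ((√(fhat w y))⁻¹ * inner ℝ (b j) (muHatCol w y))
          = inner ℝ (b j) (√(fhat w y) • muHatCol w y) := by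
        intro y
        rw [real_inner_smul_right, ← mul_assoc]
        congr 1
        rcases eq_or_ne (√(fhat w y)) 0 with h0 | h0
        · simp [h0]
        · nth_rewrite 1 [← Real.mul_self_sqrt (fhat_nonneg w y)]
          field_simp
      rw [Finset.sum_apply]
      simp only [Pi.smul_apply, smul_eq_mul, Pi.zero_apply, h1]
      rw [← inner_sum]
      have h2 : ∑ y, √(fhat w y) • muHatCol w y = (n : ℝ)⁻¹ • ∑ k, Zhat w k := by
        rw [← Finset.sum_fiberwise (s := Finset.univ) (g := fun k => (w k).2), Finset.smul_sum]
        refine Finset.sum_congr rfl fun y _ => ?_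
        rcases Nat.eq_zero_or_pos n with rfl | hn
        · simp [fhat]
        rw [sum_slice_Zhat, smul_smul, ← mul_assoc, inv_mul_cancel₀ (by positivity), one_mul]
      rw [h2, sum_Zhat, smul_zero, inner_zero_right]
    · rw [loss_eq w hB]
      simp only [hcol]
      have h0 : ∀ j y, (√(fhat w y) * ((√(fhat w y))⁻¹ * inner ℝ (b j) (muHatCol w y))
          - inner ℝ (b j) (muHatCol w y)) ^ 2 = 0 := by
        intro j y
        rcases eq_or_ne (√(fhat w y)) 0 with h0 | h0
        · simp [muHatCol, h0]
        · rw [mul_inv_cancel_left₀ h0]; simp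
      simp only [h0, Finset.sum_const_zero, mul_zero, add_zero]
      rw [le_antisymm hle (sum_inner_sq_le_kyFan hdh (muHatCol w) hb hbK)]
  · rintro L ⟨B, C, hB, hBK, -, rfl⟩
    rw [loss_eq w hB]
    have h1 := sum_inner_sq_le_kyFan hdh (muHatCol w) (orthonormal_col.mpr hB) (W := Kᗮ)
      (fun j => (Submodule.starProjection_apply_eq_zero_iff _).mp (hBK j))
    have h2 : 0 ≤ (n : ℝ) * ∑ j, ∑ y, (√(fhat w y) * C y j
          - inner ℝ (WithLp.toLp 2 (B.col j) : E p) (muHatCol w y)) ^ 2 := by positivity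
    have h3 := mul_le_mul_of_nonneg_left h1 (Nat.cast_nonneg (α := ℝ) n)
    linarith

end LeastSquares

/-! ### Inverse square roots and projections onto column spans -/

lemma transpose_invSqrt {m : ℕ} (A : Matrix (Fin m) (Fin m) ℝ) : (invSqrt A)ᵀ = invSqrt A := by
  have h := (Matrix.nonneg_iff_posSemidef.mp (CFC.sqrt_nonneg A⁻¹)).isHermitian
  rw [Matrix.IsHermitian, Matrix.conjTranspose_eq_transpose_of_trivial] at h
  exact h

lemma invSqrt_mul_self {m : ℕ} {A : Matrix (Fin m) (Fin m) ℝ} (hA : A.PosSemidef) :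
    invSqrt A * invSqrt A = A⁻¹ :=
  CFC.sqrt_mul_sqrt_self _ (Matrix.nonneg_iff_posSemidef.mpr hA.inv)

lemma mulVec_injective_of_rank {p r : ℕ} {a : Matrix (Fin p) (Fin r) ℝ} (ha : a.rank = r) :
    Function.Injective a.mulVec := by
  have h := LinearMap.finrank_range_add_finrank_ker a.mulVecLin
  rw [← Matrix.rank, ha, Module.finrank_fin_fun, Nat.add_eq_left, Submodule.finrank_eq_zero] at h
  exact LinearMap.ker_eq_bot.mp h

lemma posDef_transpose_mul_inv_mul {p r : ℕ} {A : Matrix (Fin p) (Fin p) ℝ} (hA : A.PosDef)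
    {a : Matrix (Fin p) (Fin r) ℝ} (ha : a.rank = r) : (aᵀ * A⁻¹ * a).PosDef := by
  simpa using hA.inv.conjTranspose_mul_mul_same (mulVec_injective_of_rank ha)

lemma toLp_mulVec_mem_colSpan {p r : ℕ} (a : Matrix (Fin p) (Fin r) ℝ) (c : Fin r → ℝ) :
    (WithLp.toLp 2 (a *ᵥ c) : E p) ∈ colSpan a := by
  have : (WithLp.toLp 2 (a *ᵥ c) : E p) = ∑ k, c k • WithLp.toLp 2 (a.col k) := by
    ext i
    simp [Matrix.mulVec, dotProduct, mul_comm]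
  rw [this]
  exact Submodule.sum_mem _ fun k _ =>
    Submodule.smul_mem _ _ (Submodule.subset_span (Set.mem_range_self k))

lemma finrank_colSpan_le {p r : ℕ} (a : Matrix (Fin p) (Fin r) ℝ) :
    Module.finrank ℝ (colSpan a) ≤ r := by
  refine (finrank_range_le_card _).trans ?_
  simp

lemma inner_toLp {p : ℕ} (x y : Fin p → ℝ) :
    inner ℝ (WithLp.toLp 2 x : E p) (WithLp.toLp 2 y) = x ⬝ᵥ y := by
  simp [PiLp.inner_apply, dotProduct, mul_comm]

/-- The orthogonal projection onto the column span of a matrix `a` of full column rank is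
`a (aᵀa)⁻¹ aᵀ`. -/
lemma starProjection_colSpan {p r : ℕ} {a : Matrix (Fin p) (Fin r) ℝ} (ha : IsUnit (aᵀ * a).det)
    (x : Fin p → ℝ) :
    (colSpan a).starProjection (WithLp.toLp 2 x)
      = WithLp.toLp 2 ((a * (aᵀ * a)⁻¹ * aᵀ) *ᵥ x) := by
  refine (Submodule.eq_starProjection_of_mem_orthogonal ?_ ?_)
  · rw [Matrix.mul_assoc, ← Matrix.mulVec_mulVec]
    exact toLp_mulVec_mem_colSpan _ _
  · rw [colSpan, Submodule.mem_orthogonal]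
    intro u hu
    induction hu using Submodule.span_induction with
    | mem u hu =>
      obtain ⟨k, rfl⟩ := hu
      rw [← WithLp.toLp_sub, inner_toLp]
      have h1 : aᵀ *ᵥ (x - (a * (aᵀ * a)⁻¹ * aᵀ) *ᵥ x) = 0 := by
        rw [Matrix.mulVec_sub, Matrix.mulVec_mulVec, ← Matrix.mul_assoc, ← Matrix.mul_assoc,
          Matrix.mul_nonsing_inv _ ha, Matrix.one_mul, sub_self]
      exact congrFun h1 k
    | zero => simp
    | add u v _ _ hu hv => rw [inner_add_left, hu, hv, add_zero]
    | smul c u _ hu => rw [inner_smul_left, hu, mul_zero]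

/-! ### The statistic as a function of the sample moments -/

section Statistic

variable {p h n d r : ℕ} (w : Fin n → E p × Fin h)

/-- The sample covariances of the predictors and the slice indicators. -/
def sampleCross : Matrix (Fin p) (Fin h) ℝ :=
  Matrix.of fun i y => (n : ℝ)⁻¹ * ∑ k, ((w k).1 i - sampleMean w i) *
    (if (w k).2 = y then 1 else 0)

/-- `diag(ĝ)⁻¹`, with `ĝ_y = √f̂_y`. -/
def diagInvG : Matrix (Fin h) (Fin h) ℝ := Matrix.diagonal fun y => (√(fhat w y))⁻¹

/-- The matrix `μ̂ᵀ μ̂`. -/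
def sampleGram : Matrix (Fin h) (Fin h) ℝ :=
  (sampleCross w * diagInvG w)ᵀ * (sampleCov w)⁻¹ * (sampleCross w * diagInvG w)

/-- The matrix `μ̂ᵀ P μ̂`, with `P` the projection onto the estimated hypothesis subspace. -/
def sampleGramHyp (αx : Matrix (Fin p) (Fin r) ℝ) : Matrix (Fin h) (Fin h) ℝ :=
  (αxᵀ * (sampleCov w)⁻¹ * (sampleCross w * diagInvG w))ᵀ * (αxᵀ * (sampleCov w)⁻¹ * αx)⁻¹ *
    (αxᵀ * (sampleCov w)⁻¹ * (sampleCross w * diagInvG w))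

lemma posSemidef_sampleCov : (sampleCov w).PosSemidef := by
  set M : Matrix (Fin n) (Fin p) ℝ := Matrix.of fun k i => (w k).1 i - sampleMean w i with hM
  have h1 : sampleCov w = (n : ℝ)⁻¹ • (Mᴴ * M) := by
    ext i j
    simp [sampleCov, hM, Matrix.mul_apply]
  rw [h1]
  exact (Matrix.posSemidef_conjTranspose_mul_self M).smul (by positivity)

lemma muHatCol_eq (y : Fin h) :
    muHatCol w y = WithLp.toLp 2
      (invSqrt (sampleCov w) *ᵥ (sampleCross w * diagInvG w).col y) := by
  have h1 : (n : ℝ)⁻¹ • ∑ k with (w k).2 = y, Zhat w k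
      = Matrix.toEuclideanCLM (𝕜 := ℝ) (invSqrt (sampleCov w))
        (WithLp.toLp 2 ((sampleCross w).col y)) := by
    unfold Zhat
    rw [← map_sum, ← map_smul]
    congr 1
    ext i
    simp only [PiLp.smul_apply, smul_eq_mul, Matrix.col_apply, sampleCross, Matrix.of_apply,
      mul_ite, mul_one, mul_zero]
    rw [← Finset.sum_filter]
    simp [WithLp.ofLp_sum]
  rw [muHatCol, h1, ← map_smul]
  rw [← WithLp.toLp_smul, Matrix.toEuclideanCLM_toLp]
  congr 2
  ext i
  simp [diagInvG, Matrix.mul_diagonal, mul_comm]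

lemma inner_muHatCol (y y' : Fin h) :
    inner ℝ (muHatCol w y) (muHatCol w y') = sampleGram w y y' := by
  set U := sampleCross w * diagInvG w with hU
  have h1 : ((invSqrt (sampleCov w) * U)ᵀ * (invSqrt (sampleCov w) * U)) = sampleGram w := by
    rw [Matrix.transpose_mul, transpose_invSqrt, sampleGram, ← hU,
      ← invSqrt_mul_self (posSemidef_sampleCov w)]
    simp only [Matrix.mul_assoc]
  rw [muHatCol_eq, muHatCol_eq, inner_toLp, ← h1]
  rfl

lemma projGram_top : projGram ((⊥ : Submodule ℝ (E p))ᗮ) (muHatCol w) = sampleGram w := by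
  ext y y'
  rw [projGram, Matrix.of_apply, ← inner_muHatCol, Submodule.bot_orthogonal_eq_top]
  simp [Submodule.starProjection_top]

lemma projGram_hypSubspaceHat {αx : Matrix (Fin p) (Fin r) ℝ} (hαx : αx.rank = r) :
    projGram (hypSubspaceHat w αx)ᗮ (muHatCol w) = sampleGram w - sampleGramHyp w αx := by
  ext y y'
  rw [projGram, Matrix.of_apply, Submodule.starProjection_orthogonal_val, inner_sub_left,
    inner_muHatCol, Matrix.sub_apply]
  congr 1
  set R := invSqrt (sampleCov w) with hR
  set U := sampleCross w * diagInvG w with hU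
  have hRt : Rᵀ = R := transpose_invSqrt _
  have hRR : R * R = (sampleCov w)⁻¹ := invSqrt_mul_self (posSemidef_sampleCov w)
  by_cases hdet : (sampleCov w).det = 0
  · -- a singular covariance matrix has the inverse `0` by convention, and both sides vanish
    have h0 : (sampleCov w)⁻¹ = 0 :=
      Matrix.nonsing_inv_apply_not_isUnit _ (by simp [hdet])
    have hR0 : R = 0 := by rw [hR, invSqrt, h0, CFC.sqrt_zero]
    rw [sampleGramHyp, h0, muHatCol_eq, ← hR, hR0]
    simp
  · have hpd : (sampleCov w).PosDef :=
      (posSemidef_sampleCov w).posDef_iff_det_ne_zero.mpr hdet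
    have ha : (R * αx)ᵀ * (R * αx) = αxᵀ * (sampleCov w)⁻¹ * αx := by
      rw [Matrix.transpose_mul, hRt, ← hRR]
      simp only [Matrix.mul_assoc]
    have hau : IsUnit ((R * αx)ᵀ * (R * αx)).det := by
      rw [ha]
      exact (posDef_transpose_mul_inv_mul hpd hαx).det_pos.ne'.isUnit
    rw [muHatCol_eq, muHatCol_eq, hypSubspaceHat, ← hR, starProjection_colSpan hau, inner_toLp, ha]
    have hK : ((αxᵀ * (sampleCov w)⁻¹ * αx)⁻¹)ᵀ = (αxᵀ * (sampleCov w)⁻¹ * αx)⁻¹ := by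
      rw [← ha, Matrix.transpose_nonsing_inv, Matrix.transpose_mul, Matrix.transpose_transpose]
    rw [sampleGramHyp, ← hU]
    generalize (αxᵀ * (sampleCov w)⁻¹ * αx)⁻¹ = K at hK ⊢
    have h1 : (R * αx * K * (R * αx)ᵀ * (R * U))ᵀ * (R * U)
        = (αxᵀ * (sampleCov w)⁻¹ * U)ᵀ * K * (αxᵀ * (sampleCov w)⁻¹ * U) := by
      rw [← hRR]
      simp only [Matrix.transpose_mul, Matrix.transpose_transpose, hRt, hK, Matrix.mul_assoc]
    rw [← h1, Matrix.mul_apply, dotProduct]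
    refine Finset.sum_congr rfl fun i _ => ?_
    congr 1

/-- The statistic, for every sample, in terms of sample moments only. -/
theorem statistic_eq (hdh : d ≤ h) (hdr : d + r ≤ p) {αx : Matrix (Fin p) (Fin r) ℝ}
    (hαx : αx.rank = r) :
    statistic w d αx
      = n * (kyFan d (sampleGram w) - kyFan d (sampleGram w - sampleGramHyp w αx)) := by
  have h1 : d ≤ Module.finrank ℝ (hypSubspaceHat w αx)ᗮ := by
    have := finrank_colSpan_le (invSqrt (sampleCov w) * αx)
    have h2 := Submodule.finrank_add_finrank_orthogonal (hypSubspaceHat w αx)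
    rw [finrank_euclideanSpace_fin] at h2
    rw [← hypSubspaceHat] at this
    omega
  have h3 : d ≤ Module.finrank ℝ ((⊥ : Submodule ℝ (E p))ᗮ) := by
    rw [Submodule.bot_orthogonal_eq_top, finrank_top, finrank_euclideanSpace_fin]
    omega
  rw [statistic, residualSS_eq w hdh _ h1, residualSS_eq w hdh _ h3, projGram_top,
    projGram_hypSubspaceHat w hαx]
  ring

end Statistic

/-! ### Conditional independence -/

/-- If `Y` and `Z` are conditionally independent given `m`, a function `T` of `Z` whose conditional
expectation given `m` is the constant `c` can be replaced by `c` in the expectation of a product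
with an indicator of `Y` and an `m`-measurable factor. -/
lemma integral_indicator_mul_of_condIndepFun {Ω β γ : Type*} [MeasurableSpace β]
    [MeasurableSpace γ] {m mV mΩ : MeasurableSpace Ω} [StandardBorelSpace Ω] {P : Measure Ω}
    [IsProbabilityMeasure P] (hm : m ≤ mΩ) {Y : Ω → β} {V : Ω → γ} (hY : Measurable Y)
    (hV : Measurable V) (hYV : CondIndepFun m hm Y V P)
    (hmVdef : mV = MeasurableSpace.comap V inferInstance) (hmV : m ≤ mV)
    {s : Set β} (hs : MeasurableSet s)
    {T q : Ω → ℝ} (hT : StronglyMeasurable[mV] T)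
    (hTi : Integrable T P) {c : ℝ} (hTc : P[T | m] =ᵐ[P] fun _ => c)
    (hq : StronglyMeasurable[m] q) (hqi : Integrable q P) (hTq : Integrable (T * q) P) :
    ∫ ω, (Y ⁻¹' s).indicator 1 ω * (T ω * q ω) ∂P
      = c * ∫ ω, (Y ⁻¹' s).indicator 1 ω * q ω ∂P := by
  have hmV' : mV ≤ mΩ := hmVdef ▸ hV.comap_le
  set A := Y ⁻¹' s with hA
  have hAm : MeasurableSet A := hY hs
  set J : Ω → ℝ := A.indicator (fun _ => (1 : ℝ)) with hJ
  have hJi : Integrable J P := (integrable_const (1 : ℝ)).indicator hAm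
  set ρ : Ω → ℝ := P[J | m] with hρ
  -- conditioning on `Z` is the same as conditioning on `m`
  have h1 : ρ =ᵐ[P] P[J | mV] := by
    refine ae_eq_condExp_of_forall_setIntegral_eq hmV' hJi (fun _ _ _ => ?_) ?_ ?_
    · exact integrable_condExp.integrableOn
    · intro B₀ hB₀ _
      rw [hmVdef] at hB₀
      obtain ⟨t, ht, rfl⟩ := hB₀
      have h2 := (condIndepFun_iff_condExp_inter_preimage_eq_mul hY hV).mp hYV s t hs ht
      set B := V ⁻¹' t with hB
      have hBm : MeasurableSet B := hV ht
      set I : Ω → ℝ := B.indicator (fun _ => (1 : ℝ)) with hI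
      have hIi : Integrable I P := (integrable_const (1 : ℝ)).indicator hBm
      have hρI : Integrable (ρ * I) P := by
        have : ρ * I = B.indicator ρ := by
          ext ω; by_cases hω : ω ∈ B <;> simp [hI, hω]
        rw [this]
        exact integrable_condExp.indicator hBm
      have h3 : P[ρ * I | m] =ᵐ[P] ρ * P[I | m] :=
        condExp_mul_of_stronglyMeasurable_left stronglyMeasurable_condExp hρI hIi
      calc ∫ ω in B, ρ ω ∂P = ∫ ω, (ρ * I) ω ∂P := by
            rw [← integral_indicator hBm]
            congr 1
            ext ω; by_cases hω : ω ∈ B <;> simp [hI, hω]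
        _ = ∫ ω, P[ρ * I | m] ω ∂P := (integral_condExp hm).symm
        _ = ∫ ω, (P[(A ∩ B).indicator (fun _ => (1 : ℝ)) | m]) ω ∂P :=
            integral_congr_ae (h3.trans h2.symm)
        _ = ∫ ω, (A ∩ B).indicator (fun _ => (1 : ℝ)) ω ∂P := integral_condExp hm
        _ = ∫ ω in B, J ω ∂P := by
            rw [← integral_indicator hBm, hJ, Set.indicator_indicator, Set.inter_comm]
    · exact (stronglyMeasurable_condExp.mono hmV).aestronglyMeasurable
  have hbdd : ∀ {g : Ω → ℝ}, Integrable g P → Integrable (J * g) P := by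
    intro g hg
    have : J * g = A.indicator g := by
      ext ω; by_cases hω : ω ∈ A <;> simp [hJ, hω]
    rw [this]
    exact hg.indicator hAm
  have hTqm : StronglyMeasurable[mV] (T * q) := hT.mul (hq.mono hmV)
  have h4 : P[J * (T * q) | mV] =ᵐ[P] ρ * (T * q) :=
    (condExp_mul_of_stronglyMeasurable_right hTqm (hbdd hTq) hJi).trans
      (h1.symm.mul (ae_eq_refl _))
  have h5 : P[J * q | m] =ᵐ[P] ρ * q :=
    condExp_mul_of_stronglyMeasurable_right hq (hbdd hqi) hJi
  have hρTq : Integrable ((ρ * q) * T) P := by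
    have : Integrable (ρ * (T * q)) P := integrable_condExp.congr h4
    rwa [mul_comm T q, ← mul_assoc] at this
  have h6 : P[(ρ * q) * T | m] =ᵐ[P] (ρ * q) * P[T | m] :=
    condExp_mul_of_stronglyMeasurable_left (stronglyMeasurable_condExp.mul hq) hρTq hTi
  calc ∫ ω, A.indicator 1 ω * (T ω * q ω) ∂P = ∫ ω, P[J * (T * q) | mV] ω ∂P :=
        (integral_condExp hmV').symm
    _ = ∫ ω, ((ρ * q) * T) ω ∂P := by
        refine integral_congr_ae (h4.trans (Eq.eventuallyEq ?_))
        ring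
    _ = ∫ ω, P[(ρ * q) * T | m] ω ∂P := (integral_condExp hm).symm
    _ = ∫ ω, c * P[J * q | m] ω ∂P := by
        refine integral_congr_ae ?_
        filter_upwards [h6, hTc, h5] with ω h6 h7 h5
        rw [h6, h5, Pi.mul_apply, h7, mul_comm]
    _ = c * ∫ ω, A.indicator 1 ω * q ω ∂P := by
        rw [integral_const_mul, integral_condExp hm]
        rfl

/-! ### Moments of the standardized predictor -/

instance holderTriple_four_four_two : ENNReal.HolderTriple 4 4 2 where
  inv_add_inv_eq_inv := by
    rw [← ENNReal.toReal_eq_toReal_iff' (by simp) (by simp), ENNReal.toReal_add (by simp) (by simp)]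
    norm_num

lemma integral_sub_sub {Ω : Type*} [MeasurableSpace Ω] {P : Measure Ω} {a b c : Ω → ℝ}
    (ha : Integrable a P) (hb : Integrable b P) (hc : Integrable c P) :
    ∫ ω, (a ω - b ω - c ω) ∂P = ∫ ω, a ω ∂P - ∫ ω, b ω ∂P - ∫ ω, c ω ∂P := by
  rw [integral_sub (f := fun ω => a ω - b ω) (ha.sub hb) hc, integral_sub ha hb]

section Population

variable {p h : ℕ} {P : Measure (E p × Fin h)}

lemma memLp_coord (hmom : MemLp (Prod.fst : E p × Fin h → E p) 4 P) (i : Fin p) :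
    MemLp (fun w : E p × Fin h => w.1 i) 4 P :=
  (EuclideanSpace.proj i : E p →L[ℝ] ℝ).comp_memLp' hmom

lemma Z_eq (w : E p × Fin h) :
    Z P w = WithLp.toLp 2 (invSqrt (covX P) *ᵥ fun i => w.1 i - meanX P i) := by
  unfold Z
  ext i
  rfl

lemma inner_Z (v : E p) (w : E p × Fin h) :
    inner ℝ v (Z P w) = (invSqrt (covX P) *ᵥ v.ofLp) ⬝ᵥ fun i => w.1 i - meanX P i := by
  rw [Z_eq, ← WithLp.toLp_ofLp 2 v, inner_toLp, Matrix.dotProduct_mulVec, ← Matrix.mulVec_transpose,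
    transpose_invSqrt]

lemma f_smul_condMean (hslice : ∀ y, 0 < f P y) (y : Fin h) :
    f P y • condMean P y = ∫ w, (if w.2 = y then (1 : ℝ) else 0) • Z P w ∂P := by
  have hm : MeasurableSet (Prod.snd ⁻¹' {y} : Set (E p × Fin h)) :=
    measurable_snd (measurableSet_singleton y)
  have h1 : (fun w : E p × Fin h => (if w.2 = y then (1 : ℝ) else 0) • Z P w)
      = (Prod.snd ⁻¹' {y}).indicator (Z P) := by
    ext w; by_cases hw : w.2 = y <;> simp [hw]
  rw [h1, integral_indicator hm, condMean, ProbabilityTheory.cond, integral_smul_measure,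
    ENNReal.toReal_inv, smul_smul]
  have h2 : f P y * (P (Prod.snd ⁻¹' {y})).toReal⁻¹ = 1 := mul_inv_cancel₀ (hslice y).ne'
  rw [h2, one_smul]

lemma integral_indicator_eq_f (y : Fin h) : ∫ w, (if w.2 = y then (1 : ℝ) else 0) ∂P = f P y := by
  have : (fun w : E p × Fin h => if w.2 = y then (1 : ℝ) else 0)
      = (Prod.snd ⁻¹' {y}).indicator 1 := by
    funext w; by_cases hw : w.2 = y <;> simp [hw]
  rw [this, integral_indicator_one (measurable_snd (measurableSet_singleton y))]
  rfl

variable [IsProbabilityMeasure P]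

lemma memLp_centered (hmom : MemLp (Prod.fst : E p × Fin h → E p) 4 P) (i : Fin p) :
    MemLp (fun w : E p × Fin h => w.1 i - meanX P i) 4 P :=
  (memLp_coord hmom i).sub (memLp_const _)

lemma memLp_indicator (y : Fin h) (q : ENNReal) :
    MemLp (fun w : E p × Fin h => if w.2 = y then (1 : ℝ) else 0) q P := by
  refine MemLp.of_bound (Measurable.aestronglyMeasurable ?_) 1 (ae_of_all _ fun w => ?_)
  · exact Measurable.ite (measurable_snd (measurableSet_singleton y)) measurable_const
      measurable_const
  · split_ifs <;> simp

lemma integrable_mul_of_memLp_four {f g : E p × Fin h → ℝ} (hf : MemLp f 4 P)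
    (hg : MemLp g 4 P) : Integrable (fun w => f w * g w) P :=
  (hf.mono_exponent (by norm_num : (2 : ENNReal) ≤ 4)).integrable_mul
    (hg.mono_exponent (by norm_num : (2 : ENNReal) ≤ 4))

lemma meanX_apply (hmom : MemLp (Prod.fst : E p × Fin h → E p) 4 P) (i : Fin p) :
    meanX P i = ∫ w, w.1 i ∂P :=
  ((EuclideanSpace.proj i : E p →L[ℝ] ℝ).integral_comp_comm
    (hmom.integrable (by norm_num))).symm

lemma integral_centered (hmom : MemLp (Prod.fst : E p × Fin h → E p) 4 P) (i : Fin p) :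
    ∫ w, (w.1 i - meanX P i) ∂P = 0 := by
  rw [integral_sub ((memLp_coord hmom i).integrable (by norm_num)) (integrable_const _),
    ← meanX_apply hmom]
  simp

lemma covX_eq (hmom : MemLp (Prod.fst : E p × Fin h → E p) 4 P) (i j : Fin p) :
    covX P i j = ∫ w, (w.1 i - meanX P i) * (w.1 j - meanX P j) ∂P := by
  rw [covX, Matrix.of_apply, covariance, ← meanX_apply hmom, ← meanX_apply hmom]

lemma cov_indicator_eq (hmom : MemLp (Prod.fst : E p × Fin h → E p) 4 P) (i : Fin p) (y : Fin h) :
    cov[fun w => w.1 i, fun w => if w.2 = y then 1 else 0; P]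
      = ∫ w, (if w.2 = y then 1 else 0) * (w.1 i - meanX P i) ∂P := by
  rw [covariance, ← meanX_apply hmom]
  have h1 : ∀ c : ℝ, ∀ w : E p × Fin h, (w.1 i - meanX P i) * ((if w.2 = y then 1 else 0) - c)
      = (if w.2 = y then 1 else 0) * (w.1 i - meanX P i) - c * (w.1 i - meanX P i) := by
    intros; ring
  refine (integral_congr_ae (ae_of_all _ (h1 _))).trans ?_
  rw [integral_sub (integrable_mul_of_memLp_four (memLp_indicator y 4) (memLp_centered hmom i))
    (((memLp_centered hmom i).integrable (by norm_num)).const_mul _), integral_const_mul,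
    integral_centered hmom, mul_zero, sub_zero]

lemma memLp_Z (hmom : MemLp (Prod.fst : E p × Fin h → E p) 4 P) : MemLp (Z P) 4 P :=
  (Matrix.toEuclideanCLM (𝕜 := ℝ) (invSqrt (covX P))).comp_memLp' (hmom.sub (memLp_const _))

lemma memLp_inner_Z (hmom : MemLp (Prod.fst : E p × Fin h → E p) 4 P) (v : E p) :
    MemLp (fun w => inner ℝ v (Z P w)) 4 P :=
  (memLp_Z hmom).const_inner v

lemma integral_Z (hmom : MemLp (Prod.fst : E p × Fin h → E p) 4 P) : ∫ w, Z P w ∂P = 0 := by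
  have h1 : Integrable (fun w : E p × Fin h => w.1 - meanX P) P :=
    (hmom.sub (memLp_const _)).integrable (by norm_num)
  unfold Z
  rw [ContinuousLinearMap.integral_comp_comm _ h1,
    integral_sub (hmom.integrable (by norm_num)) (integrable_const _)]
  simp [meanX]

lemma integral_inner_Z (hmom : MemLp (Prod.fst : E p × Fin h → E p) 4 P) (v : E p) :
    ∫ w, inner ℝ v (Z P w) ∂P = 0 := by
  rw [integral_inner ((memLp_Z hmom).integrable (by norm_num)), integral_Z hmom, inner_zero_right]

lemma integral_dotProduct_mul (hmom : MemLp (Prod.fst : E p × Fin h → E p) 4 P) (a b : Fin p → ℝ) :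
    ∫ w, (a ⬝ᵥ fun i => w.1 i - meanX P i) * (b ⬝ᵥ fun i => w.1 i - meanX P i) ∂P
      = a ⬝ᵥ covX P *ᵥ b := by
  have h1 : ∀ w : E p × Fin h, (a ⬝ᵥ fun i => w.1 i - meanX P i)
      * (b ⬝ᵥ fun i => w.1 i - meanX P i)
      = ∑ i, ∑ j, a i * b j * ((w.1 i - meanX P i) * (w.1 j - meanX P j)) := by
    intro w
    rw [dotProduct, dotProduct, Finset.sum_mul_sum]
    exact Finset.sum_congr rfl fun i _ => Finset.sum_congr rfl fun j _ => by ring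
  have hint : ∀ i j, Integrable
      (fun w : E p × Fin h => a i * b j * ((w.1 i - meanX P i) * (w.1 j - meanX P j))) P :=
    fun i j => (integrable_mul_of_memLp_four (memLp_centered hmom i)
      (memLp_centered hmom j)).const_mul _
  simp_rw [h1]
  rw [integral_finsetSum _ fun i _ => integrable_finsetSum _ fun j _ => hint i j]
  rw [dotProduct]
  refine Finset.sum_congr rfl fun i _ => ?_
  rw [integral_finsetSum _ fun j _ => hint i j, Matrix.mulVec, dotProduct, Finset.mul_sum]
  refine Finset.sum_congr rfl fun j _ => ?_
  rw [integral_const_mul, covX_eq hmom]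
  ring

lemma invSqrt_mul_mul_invSqrt {m : ℕ} {A : Matrix (Fin m) (Fin m) ℝ} (hA : A.PosDef) :
    invSqrt A * A * invSqrt A = 1 := by
  have h1 : invSqrt A * (invSqrt A * A) = 1 := by
    rw [← Matrix.mul_assoc, invSqrt_mul_self hA.posSemidef,
      Matrix.nonsing_inv_mul _ hA.det_pos.ne'.isUnit]
  exact mul_eq_one_comm.mp h1

lemma integral_inner_Z_mul (hmom : MemLp (Prod.fst : E p × Fin h → E p) 4 P)
    (hcov : (covX P).PosDef) (u v : E p) :
    ∫ w, inner ℝ u (Z P w) * inner ℝ v (Z P w) ∂P = inner ℝ u v := by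
  simp_rw [inner_Z]
  rw [integral_dotProduct_mul hmom, Matrix.mulVec_mulVec, ← Matrix.vecMul_transpose,
    ← Matrix.dotProduct_mulVec, Matrix.mulVec_mulVec, transpose_invSqrt,
    ← Matrix.mul_assoc, invSqrt_mul_mul_invSqrt hcov, Matrix.one_mulVec, ← inner_toLp]

lemma integral_indicator_mul_inner_Z (hmom : MemLp (Prod.fst : E p × Fin h → E p) 4 P)
    (hslice : ∀ y, 0 < f P y) (v : E p) (y : Fin h) :
    ∫ w, (if w.2 = y then (1 : ℝ) else 0) * inner ℝ v (Z P w) ∂P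
      = f P y * inner ℝ v (condMean P y) := by
  have h1 : Integrable (fun w => (if w.2 = y then (1 : ℝ) else 0) • Z P w) P := by
    refine ((memLp_Z hmom).integrable (by norm_num)).bdd_smul 1
      (memLp_indicator y 4).aestronglyMeasurable (ae_of_all _ fun w => ?_)
    split_ifs <;> simp
  rw [← real_inner_smul_right, f_smul_condMean hslice, ← integral_inner h1]
  simp_rw [real_inner_smul_right]

lemma beta_eq (hmom : MemLp (Prod.fst : E p × Fin h → E p) 4 P)
    (hcov : (covX P).PosDef) (hslice : ∀ y, 0 < f P y) (y : Fin h) :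
    beta P y = f P y • (invSqrt (covX P) *ᵥ (condMean P y).ofLp) := by
  rw [beta, ← invSqrt_mul_self hcov.posSemidef, ← Matrix.mulVec_mulVec, ← Matrix.mulVec_smul]
  congr 1
  ext i
  have h1 := integral_indicator_mul_inner_Z hmom hslice (EuclideanSpace.single i (1 : ℝ)) y
  rw [EuclideanSpace.inner_single_left] at h1
  simp only [map_one, one_mul] at h1
  rw [Pi.smul_apply, smul_eq_mul, ← h1]
  simp_rw [inner_Z, cov_indicator_eq hmom]
  rw [Matrix.mulVec, dotProduct]
  have hint : ∀ j, Integrable (fun w : E p × Fin h =>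
      invSqrt (covX P) i j * ((if w.2 = y then (1 : ℝ) else 0) * (w.1 j - meanX P j))) P :=
    fun j => (integrable_mul_of_memLp_four (memLp_indicator y 4)
      (memLp_centered hmom j)).const_mul _
  simp_rw [← integral_const_mul]
  rw [← integral_finsetSum _ fun j _ => hint j]
  congr 1
  ext w
  rw [dotProduct, Finset.mul_sum]
  refine Finset.sum_congr rfl fun j _ => ?_
  have : (invSqrt (covX P) *ᵥ (EuclideanSpace.single i (1 : ℝ) : E p).ofLp) j
      = invSqrt (covX P) i j := by
    have h2 : invSqrt (covX P) i j = invSqrt (covX P) j i :=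
      congrFun (congrFun (transpose_invSqrt (covX P)) j) i
    simp [h2]
  rw [this]
  ring

/-- The residual `ε_y` as a function of the slice and of the projection of `Z` on `E(Z | Y = y)`. -/
lemma eps_eq (hmom : MemLp (Prod.fst : E p × Fin h → E p) 4 P)
    (hcov : (covX P).PosDef) (hslice : ∀ y, 0 < f P y) (w : E p × Fin h) (y : Fin h) :
    eps P w y = (if w.2 = y then 1 else 0) - f P y - f P y * inner ℝ (condMean P y) (Z P w) := by
  rw [eps, beta_eq hmom hcov hslice, inner_Z, smul_dotProduct, smul_eq_mul]

lemma memLp_eps (hmom : MemLp (Prod.fst : E p × Fin h → E p) 4 P)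
    (hcov : (covX P).PosDef) (hslice : ∀ y, 0 < f P y) (y : Fin h) :
    MemLp (fun w => eps P w y) 4 P := by
  simp_rw [eps_eq hmom hcov hslice]
  exact ((memLp_indicator y 4).sub (memLp_const _)).sub ((memLp_inner_Z hmom _).const_mul _)

lemma integral_eps (hmom : MemLp (Prod.fst : E p × Fin h → E p) 4 P)
    (hcov : (covX P).PosDef) (hslice : ∀ y, 0 < f P y) (y : Fin h) :
    ∫ w, eps P w y ∂P = 0 := by
  simp_rw [eps_eq hmom hcov hslice]
  have h1 : Integrable (fun w : E p × Fin h => if w.2 = y then (1 : ℝ) else 0) P :=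
    (memLp_indicator y 1).integrable le_rfl
  rw [integral_sub_sub h1 (integrable_const _)
    (((memLp_inner_Z hmom _).integrable (by norm_num)).const_mul _), integral_indicator_eq_f,
    integral_const_mul, integral_inner_Z hmom]
  simp

lemma integral_eps_mul_inner_Z (hmom : MemLp (Prod.fst : E p × Fin h → E p) 4 P)
    (hcov : (covX P).PosDef) (hslice : ∀ y, 0 < f P y) (y : Fin h) (v : E p) :
    ∫ w, eps P w y * inner ℝ v (Z P w) ∂P = 0 := by
  simp_rw [eps_eq hmom hcov hslice, sub_mul, mul_assoc]
  have hv := memLp_inner_Z hmom v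
  have h1 := integrable_mul_of_memLp_four (memLp_indicator y 4) hv
  have h2 : Integrable (fun w => f P y * inner ℝ v (Z P w)) P :=
    (hv.integrable (by norm_num)).const_mul _
  have h3 : Integrable (fun w => f P y * (inner ℝ (condMean P y) (Z P w)
      * inner ℝ v (Z P w))) P :=
    (integrable_mul_of_memLp_four (memLp_inner_Z hmom _) hv).const_mul _
  rw [integral_sub_sub h1 h2 h3, integral_const_mul, integral_const_mul,
    integral_inner_Z hmom, integral_inner_Z_mul hmom hcov,
    integral_indicator_mul_inner_Z hmom hslice, real_inner_comm]
  ring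

lemma integral_eps_mul_eps (hmom : MemLp (Prod.fst : E p × Fin h → E p) 4 P)
    (hcov : (covX P).PosDef) (hslice : ∀ y, 0 < f P y) (y y' : Fin h) :
    ∫ w, eps P w y * eps P w y' ∂P = (if y = y' then f P y else 0) - f P y * f P y'
      - f P y * f P y' * inner ℝ (condMean P y) (condMean P y') := by
  have he := memLp_eps hmom hcov hslice y
  have h1 : ∀ w, eps P w y * eps P w y' = eps P w y * (if w.2 = y' then 1 else 0)
      - f P y' * eps P w y - f P y' * (eps P w y * inner ℝ (condMean P y') (Z P w)) := by
    intro w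
    rw [eps_eq hmom hcov hslice w y']
    ring
  have i1 := integrable_mul_of_memLp_four he (memLp_indicator (P := P) y' 4)
  have i2 : Integrable (fun w => f P y' * eps P w y) P :=
    (he.integrable (by norm_num)).const_mul _
  have i3 : Integrable (fun w => f P y' * (eps P w y * inner ℝ (condMean P y') (Z P w))) P :=
    (integrable_mul_of_memLp_four he (memLp_inner_Z hmom _)).const_mul _
  simp_rw [h1]
  rw [integral_sub_sub i1 i2 i3, integral_const_mul, integral_const_mul,
    integral_eps hmom hcov hslice, integral_eps_mul_inner_Z hmom hcov hslice]
  have h2 : ∀ w : E p × Fin h, eps P w y * (if w.2 = y' then 1 else 0)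
      = (if y = y' then 1 else 0) * (if w.2 = y then 1 else 0)
        - f P y * (if w.2 = y' then 1 else 0)
        - f P y * ((if w.2 = y' then 1 else 0) * inner ℝ (condMean P y) (Z P w)) := by
    intro w
    rw [eps_eq hmom hcov hslice w y]
    by_cases hw : w.2 = y'
    · by_cases hy : y = y'
      · simp [hw, hy]
      · simp [hw, hy, Ne.symm hy]
    · by_cases hy : y = y'
      · simp [hw, hy]
      · simp [hw, hy]
  have j1 : Integrable (fun w : E p × Fin h =>
      (if y = y' then (1 : ℝ) else 0) * (if w.2 = y then 1 else 0)) P :=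
    ((memLp_indicator y 1).integrable le_rfl).const_mul _
  have j2 : Integrable (fun w : E p × Fin h => f P y * (if w.2 = y' then 1 else 0)) P :=
    ((memLp_indicator y' 1).integrable le_rfl).const_mul _
  have j3 : Integrable (fun w : E p × Fin h =>
      f P y * ((if w.2 = y' then 1 else 0) * inner ℝ (condMean P y) (Z P w))) P :=
    (integrable_mul_of_memLp_four (memLp_indicator y' 4) (memLp_inner_Z hmom _)).const_mul _
  simp_rw [h2]
  rw [integral_sub_sub j1 j2 j3, integral_const_mul, integral_const_mul,
    integral_const_mul, integral_indicator_eq_f, integral_indicator_eq_f,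
    integral_indicator_mul_inner_Z hmom hslice]
  split_ifs <;> ring

end Population

/-! ### Nonzero eigenvalues -/

/-- `AB` and `BA` have the same nonzero eigenvalues, with multiplicity. -/
lemma filter_roots_charpoly_mul_comm {m n : ℕ} (A : Matrix (Fin m) (Fin n) ℝ)
    (B : Matrix (Fin n) (Fin m) ℝ) :
    (A * B).charpoly.roots.filter (fun x => x ≠ 0)
      = (B * A).charpoly.roots.filter (fun x => x ≠ 0) := by
  have key : ∀ (k : ℕ) (q : Polynomial ℝ), q.Monic →
      (Polynomial.X ^ k * q).roots.filter (fun x => x ≠ 0) = q.roots.filter (fun x => x ≠ 0) := by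
    intro k q hq
    rw [Polynomial.roots_mul (mul_ne_zero (pow_ne_zero _ Polynomial.X_ne_zero) hq.ne_zero),
      Polynomial.roots_X_pow, Multiset.filter_add, Multiset.filter_nsmul]
    simp
  rw [← key n _ (Matrix.charpoly_monic _), ← key m (B * A).charpoly (Matrix.charpoly_monic _)]
  have := Matrix.charpoly_mul_comm' A B
  rw [Fintype.card_fin, Fintype.card_fin] at this
  rw [this]

lemma filter_roots_charpoly_frame {h d : ℕ} {l : Fin d → ℝ} (hl : ∀ j, 0 < l j)
    {Ψ : Matrix (Fin h) (Fin d) ℝ} (hΨ : Ψ ∈ frames h d) :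
    (Ψ * Matrix.diagonal l * Ψᵀ).charpoly.roots.filter (fun x => x ≠ 0)
      = Finset.univ.val.map l := by
  have hΨ' : Ψᵀ * Ψ = 1 := hΨ
  rw [Matrix.mul_assoc, filter_roots_charpoly_mul_comm, Matrix.mul_assoc, hΨ', Matrix.mul_one,
    Matrix.charpoly_diagonal]
  have h1 : (∏ i, (Polynomial.X - Polynomial.C (l i)))
      = ((Finset.univ.val.map l).map fun a => Polynomial.X - Polynomial.C a).prod := by
    rw [Multiset.map_map]; rfl
  rw [h1, Polynomial.roots_multiset_prod_X_sub_C, Multiset.filter_eq_self]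
  intro a ha
  obtain ⟨j, -, rfl⟩ := Multiset.mem_map.mp ha
  exact (hl j).ne'

lemma antitone_eq_of_map_eq {d : ℕ} {l l' : Fin d → ℝ} (hl : Antitone l) (hl' : Antitone l')
    (heq : Finset.univ.val.map l = Finset.univ.val.map l') : l = l' := by
  rw [Fin.univ_val_map, Fin.univ_val_map, Multiset.coe_eq_coe] at heq
  exact List.ofFn_injective (heq.eq_of_sortedGE hl.sortedGE_ofFn hl'.sortedGE_ofFn)

/-- The spectral theorem for a positive semidefinite matrix of rank `d`, reduced to the `d`
positive eigenvalues. -/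
lemma exists_frame_diagonal {h d : ℕ} {A : Matrix (Fin h) (Fin h) ℝ} (hA : A.PosSemidef)
    (hd : A.rank = d) :
    ∃ (l : Fin d → ℝ) (Ψ : Matrix (Fin h) (Fin d) ℝ), Antitone l ∧ (∀ j, 0 < l j) ∧
      Ψ ∈ frames h d ∧ A = Ψ * Matrix.diagonal l * Ψᵀ := by
  have hH := hA.isHermitian
  have hcard : Fintype.card {i // hH.eigenvalues i ≠ 0} = d := by
    rw [← hH.rank_eq_card_non_zero_eigs, hd]
  let e : Fin d ≃ {i // hH.eigenvalues i ≠ 0} := (Fintype.equivFinOfCardEq hcard).symm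
  let σ := Tuple.sort (fun j => -hH.eigenvalues (e j))
  have hmono := Tuple.monotone_sort (fun j => -hH.eigenvalues (e j))
  let e' : Fin d ≃ {i // hH.eigenvalues i ≠ 0} := σ.trans e
  let U : Matrix (Fin h) (Fin h) ℝ := hH.eigenvectorUnitary
  have hU1 : Uᵀ * U = 1 := by
    have := Unitary.coe_star_mul_self hH.eigenvectorUnitary
    rwa [Matrix.star_eq_conjTranspose, Matrix.conjTranspose_eq_transpose_of_trivial] at this
  have hspec : A = U * Matrix.diagonal hH.eigenvalues * Uᵀ := by
    have := hH.spectral_theorem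
    rw [Unitary.conjStarAlgAut_apply, Matrix.star_eq_conjTranspose,
      Matrix.conjTranspose_eq_transpose_of_trivial] at this
    exact this
  refine ⟨fun j => hH.eigenvalues (e' j), Matrix.of fun y j => U y (e' j), ?_, ?_, ?_, ?_⟩
  · intro i j hij
    exact neg_le_neg_iff.mp (hmono hij)
  · exact fun j => lt_of_le_of_ne (hA.eigenvalues_nonneg _) (e' j).2.symm
  · ext i j
    have h1 : (Uᵀ * U) (e' i) (e' j) = (1 : Matrix (Fin h) (Fin h) ℝ) (e' i) (e' j) := by rw [hU1]
    have h2 : ((e' i : {i // hH.eigenvalues i ≠ 0}) : Fin h) = e' j ↔ i = j := by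
      rw [Subtype.coe_inj, e'.apply_eq_iff_eq]
    rw [Matrix.one_apply, Matrix.mul_apply] at h1
    rw [Matrix.one_apply, Matrix.mul_apply]
    simp only [h2] at h1
    exact h1
  · ext y y'
    have h1 : A y y' = (U * Matrix.diagonal hH.eigenvalues * Uᵀ) y y' := by rw [← hspec]
    rw [h1, Matrix.mul_apply, Matrix.mul_apply]
    simp only [Matrix.mul_diagonal, Matrix.transpose_apply, Matrix.of_apply]
    rw [e'.sum_comp (fun i : {i // hH.eigenvalues i ≠ 0} =>
      U y i * hH.eigenvalues i * U y' i)]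
    rw [← Finset.sum_subtype (Finset.univ.filter fun i => hH.eigenvalues i ≠ 0) (by simp)
      (fun i => U y i * hH.eigenvalues i * U y' i)]
    symm
    refine Finset.sum_subset (Finset.subset_univ _) fun i _ hi => ?_
    have : hH.eigenvalues i = 0 := by simpa using hi
    simp [this]

section Population

variable {p h d : ℕ} {P : Measure (E p × Fin h)}

lemma muT_mul_mu_apply (y y' : Fin h) :
    ((mu P)ᵀ * mu P) y y' = g P y * g P y' * inner ℝ (condMean P y) (condMean P y') := by
  rw [Matrix.mul_apply, PiLp.inner_apply, Finset.mul_sum]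
  refine Finset.sum_congr rfl fun i _ => ?_
  simp [mu]
  ring

lemma g_pos (hslice : ∀ y, 0 < f P y) (y : Fin h) : 0 < g P y := Real.sqrt_pos.mpr (hslice y)

lemma g_mul_self (hslice : ∀ y, 0 < f P y) (y : Fin h) : g P y * g P y = f P y :=
  Real.mul_self_sqrt (hslice y).le

lemma rank_mu (hslice : ∀ y, 0 < f P y) :
    (mu P).rank = Module.finrank ℝ (Submodule.span ℝ (Set.range (condMean P))) := by
  have hcol : ∀ y, (mu P).col y = g P y • (condMean P y).ofLp := fun y => by ext i; simp [mu]
  have hspan : Submodule.span ℝ (Set.range (mu P).col)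
      = (Submodule.span ℝ (Set.range (condMean P))).map
        (WithLp.linearEquiv 2 ℝ (Fin p → ℝ) : E p →ₗ[ℝ] Fin p → ℝ) := by
    rw [Submodule.map_span]
    refine le_antisymm ?_ ?_
    · refine Submodule.span_le.mpr ?_
      rintro _ ⟨y, rfl⟩
      rw [hcol]
      exact Submodule.smul_mem _ _ (Submodule.subset_span ⟨_, ⟨y, rfl⟩, rfl⟩)
    · refine Submodule.span_le.mpr ?_
      rintro _ ⟨_, ⟨y, rfl⟩, rfl⟩
      have : (condMean P y).ofLp = (g P y)⁻¹ • (mu P).col y := by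
        rw [hcol, smul_smul, inv_mul_cancel₀ (g_pos hslice y).ne', one_smul]
      change (condMean P y).ofLp ∈ _
      rw [this]
      exact Submodule.smul_mem _ _ (Submodule.subset_span ⟨y, rfl⟩)
  rw [Matrix.rank_eq_finrank_span_cols, hspan]
  exact LinearEquiv.finrank_map_eq (WithLp.linearEquiv 2 ℝ (Fin p → ℝ)) _

lemma condMean_mem_centralSubspace [IsFiniteMeasure P] (hC2 : Coverage P) (y : Fin h) :
    condMean P y ∈ centralSubspace P := by
  have h1 : Submodule.span ℝ (Set.range (condMean P)) = centralSubspace P := hC2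
  rw [← h1]
  exact Submodule.subset_span ⟨y, rfl⟩

end Population

/-! ### The covariance matrix `Ω` -/

section Omega

variable {p h d r : ℕ} {P : Measure (E p × Fin h)} [IsProbabilityMeasure P]

/-- The conditional second moments of the components of `Z` orthogonal to the central subspace
are constant, by the linearity and constant covariance conditions. -/
lemma condExp_inner_mul_inner (hmom : MemLp (Prod.fst : E p × Fin h → E p) 4 P)
    (hC1 : Linearity P) (hC3 : ConstantCovariance P) {u v : E p}
    (hu : u ∈ (centralSubspace P)ᗮ) (hv : v ∈ (centralSubspace P)ᗮ) :
    P[fun w => inner ℝ u (Z P w) * inner ℝ v (Z P w) | sigmaProjZ P (centralSubspace P)]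
      =ᵐ[P] fun _ => inner ℝ u v := by
  set S := centralSubspace P with hS
  set D : Fin p → E p × Fin h → ℝ := fun i w => Z P w i - P[Z P | sigmaProjZ P S] w i with hD
  have hlin : P[Z P | sigmaProjZ P S] =ᵐ[P] projZ P S := hC1
  have horth : ∀ {x : E p}, x ∈ Sᗮ → ∀ z : E p, inner ℝ x (S.starProjection z) = 0 :=
    fun hx z => Submodule.inner_left_of_mem_orthogonal (Submodule.starProjection_apply_mem S z) hx
  have hexp : ∀ {x : E p}, x ∈ Sᗮ → ∀ᵐ w ∂P, inner ℝ x (Z P w) = ∑ i, x i * D i w := by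
    intro x hx
    filter_upwards [hlin] with w hw
    have h1 : inner ℝ x (Z P w) = inner ℝ x (Z P w - projZ P S w) := by
      rw [inner_sub_right, projZ, horth hx, sub_zero]
    rw [h1, PiLp.inner_apply]
    refine Finset.sum_congr rfl fun i _ => ?_
    simp [hD, hw, mul_comm]
  have hDm : ∀ i, MemLp (D i) 4 P := by
    intro i
    have h1 : MemLp (fun w => Z P w - projZ P S w) 4 P :=
      (memLp_Z hmom).sub (S.starProjection.comp_memLp' (memLp_Z hmom))
    have h2 : MemLp (fun w => (Z P w - projZ P S w) i) 4 P :=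
      (EuclideanSpace.proj i : E p →L[ℝ] ℝ).comp_memLp' h1
    refine h2.ae_eq ?_
    filter_upwards [hlin] with w hw
    simp [hD, hw]
  have hDD : ∀ i j, Integrable (fun w => D i w * D j w) P :=
    fun i j => integrable_mul_of_memLp_four (hDm i) (hDm j)
  have h1 : (fun w => inner ℝ u (Z P w) * inner ℝ v (Z P w))
      =ᵐ[P] ∑ i, ∑ j, (u i * v j) • fun w => D i w * D j w := by
    filter_upwards [hexp hu, hexp hv] with w h1 h2
    rw [h1, h2, Finset.sum_mul_sum, Finset.sum_apply]
    refine Finset.sum_congr rfl fun i _ => ?_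
    rw [Finset.sum_apply]
    refine Finset.sum_congr rfl fun j _ => ?_
    simp only [Pi.smul_apply, smul_eq_mul]
    ring
  have h2 : P[∑ i, ∑ j, (u i * v j) • fun w => D i w * D j w | sigmaProjZ P S]
      =ᵐ[P] ∑ i, P[∑ j, (u i * v j) • fun w => D i w * D j w | sigmaProjZ P S] :=
    condExp_finsetSum (fun i _ => integrable_finsetSum' _ fun j _ => (hDD i j).smul _) _
  have h3 : ∀ i, P[∑ j, (u i * v j) • fun w => D i w * D j w | sigmaProjZ P S]
      =ᵐ[P] ∑ j, P[(u i * v j) • fun w => D i w * D j w | sigmaProjZ P S] :=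
    fun i => condExp_finsetSum (fun j _ => (hDD i j).smul _) _
  have h4 : ∀ i j, P[(u i * v j) • fun w => D i w * D j w | sigmaProjZ P S]
      =ᵐ[P] fun _ => (u i * v j) * (EuclideanSpace.single j (1 : ℝ) -
        S.starProjection (EuclideanSpace.single j 1)) i := by
    intro i j
    have h5 : P[fun w => D i w * D j w | sigmaProjZ P S] =ᵐ[P] _ := hC3 i j
    filter_upwards [condExp_smul (u i * v j) (fun w => D i w * D j w) (sigmaProjZ P S), h5]
      with w h6 h7
    rw [h6, Pi.smul_apply, h7, smul_eq_mul]
  refine (condExp_congr_ae h1).trans (h2.trans ?_)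
  filter_upwards [ae_all_iff.mpr h3, ae_all_iff.mpr fun i => ae_all_iff.mpr (h4 i)] with w h3 h4
  rw [Finset.sum_apply]
  simp only [h3, Finset.sum_apply, h4]
  rw [Finset.sum_comm]
  have h8 : ∀ j, ∑ i, u i * v j * (EuclideanSpace.single j (1 : ℝ) -
      S.starProjection (EuclideanSpace.single j 1) : E p) i = u j * v j := by
    intro j
    have h9 : inner ℝ u (EuclideanSpace.single j (1 : ℝ) -
        S.starProjection (EuclideanSpace.single j 1) : E p) = u j := by
      rw [inner_sub_right, horth hu, sub_zero]
      simp [EuclideanSpace.inner_single_right]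
    rw [PiLp.inner_apply] at h9
    rw [← h9, Finset.sum_mul]
    refine Finset.sum_congr rfl fun i _ => ?_
    simp
    ring
  simp only [h8]
  rw [PiLp.inner_apply]
  exact Finset.sum_congr rfl fun j _ => by simp [mul_comm]

/-- Outside the central subspace, `Z` behaves in second moments like a standardized vector that is
independent of the residuals `ε`. -/
lemma integral_inner_mul_inner_mul_eps (hmom : MemLp (Prod.fst : E p × Fin h → E p) 4 P)
    (hcov : (covX P).PosDef) (hslice : ∀ y, 0 < f P y) (hCS : CentralSubspaceExists P)
    (hC1 : Linearity P) (hC2 : Coverage P) (hC3 : ConstantCovariance P) {u v : E p}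
    (hu : u ∈ (centralSubspace P)ᗮ) (hv : v ∈ (centralSubspace P)ᗮ) (y y' : Fin h) :
    ∫ w, inner ℝ u (Z P w) * inner ℝ v (Z P w) * (eps P w y * eps P w y') ∂P
      = inner ℝ u v * ∫ w, eps P w y * eps P w y' ∂P := by
  set S := centralSubspace P with hS
  set T : E p × Fin h → ℝ := fun w => inner ℝ u (Z P w) * inner ℝ v (Z P w) with hT
  have hT2 : MemLp T 2 P := (memLp_inner_Z hmom v).mul (memLp_inner_Z hmom u)
  -- the residual on the event `Y = k`
  set e : Fin h → Fin h → E p × Fin h → ℝ := fun k y w =>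
    (if k = y then 1 else 0) - f P y - f P y * inner ℝ (condMean P y) (Z P w) with he
  have he4 : ∀ k y, MemLp (e k y) 4 P := fun k y =>
    (memLp_const _).sub ((memLp_inner_Z hmom _).const_mul _)
  have hem : ∀ k y, Measurable[sigmaProjZ P S] (e k y) := by
    intro k y
    have h1 : e k y = (fun x : E p => (if k = y then (1 : ℝ) else 0) - f P y
        - f P y * inner ℝ (condMean P y) x) ∘ projZ P S := by
      funext w
      simp only [he, Function.comp, projZ]
      rw [← Submodule.inner_starProjection_left_eq_right,
        Submodule.starProjection_eq_self_iff.mpr (condMean_mem_centralSubspace hC2 y)]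
    rw [h1]
    exact Measurable.comp (by fun_prop) (comap_measurable _)
  set q : Fin h → E p × Fin h → ℝ := fun k w => e k y w * e k y' w with hq
  have hq2 : ∀ k, MemLp (q k) 2 P := fun k => (he4 k y').mul (he4 k y)
  have hqm : ∀ k, StronglyMeasurable[sigmaProjZ P S] (q k) := fun k =>
    ((hem k y).mul (hem k y')).stronglyMeasurable
  have hqi : ∀ k, Integrable (q k) P := fun k => (hq2 k).integrable (by norm_num)
  have hTq : ∀ k, Integrable (T * q k) P := fun k => hT2.integrable_mul (hq2 k)
  have hcomap : sigmaProjZ P S ≤ MeasurableSpace.comap (Z P) inferInstance := by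
    have : projZ P S = S.starProjection ∘ Z P := rfl
    rw [sigmaProjZ, this, ← MeasurableSpace.comap_comp]
    exact MeasurableSpace.comap_mono (S.starProjection.measurable.comap_le)
  have hTm : StronglyMeasurable[MeasurableSpace.comap (Z P) inferInstance] T := by
    have h1 : T = (fun x : E p => inner ℝ u x * inner ℝ v x) ∘ Z P := rfl
    rw [h1]
    exact (Measurable.comp (by fun_prop) (comap_measurable _)).stronglyMeasurable
  have key : ∀ k, ∫ w, (Prod.snd ⁻¹' {k} : Set (E p × Fin h)).indicator 1 w * (T w * q k w) ∂P
      = inner ℝ u v * ∫ w, (Prod.snd ⁻¹' {k} : Set (E p × Fin h)).indicator 1 w * q k w ∂P :=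
    fun k => integral_indicator_mul_of_condIndepFun (sigmaProjZ_le P S) measurable_snd
      (measurable_Z P) hCS rfl hcomap (measurableSet_singleton k) hTm
      (hT2.integrable (by norm_num)) (condExp_inner_mul_inner hmom hC1 hC3 hu hv) (hqm k) (hqi k)
      (hTq k)
  have hind : ∀ {F : E p × Fin h → ℝ} (k : Fin h), Integrable F P → Integrable (fun w =>
      (Prod.snd ⁻¹' {k} : Set (E p × Fin h)).indicator 1 w * F w) P := by
    intro F k hF
    refine (hF.indicator (measurable_snd (measurableSet_singleton k))).congr
      (Eq.eventuallyEq ?_)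
    funext w
    by_cases hw : w.2 = k <;> simp [hw]
  have hsplit : ∀ w, eps P w y * eps P w y'
      = ∑ k, (Prod.snd ⁻¹' {k} : Set (E p × Fin h)).indicator 1 w * q k w := by
    intro w
    rw [Finset.sum_eq_single w.2]
    · simp only [hq, he, eps_eq hmom hcov hslice]
      simp
    · intro k _ hk
      simp [hk.symm]
    · simp
  have hsplit' : ∀ w, T w * (eps P w y * eps P w y')
      = ∑ k, (Prod.snd ⁻¹' {k} : Set (E p × Fin h)).indicator 1 w * (T w * q k w) := by
    intro w
    rw [hsplit, Finset.mul_sum]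
    exact Finset.sum_congr rfl fun k _ => by ring
  calc ∫ w, T w * (eps P w y * eps P w y') ∂P
      = ∑ k, ∫ w, (Prod.snd ⁻¹' {k} : Set (E p × Fin h)).indicator 1 w * (T w * q k w) ∂P := by
        simp_rw [hsplit']
        exact integral_finsetSum _ fun k _ => hind k (hTq k)
    _ = inner ℝ u v * ∫ w, eps P w y * eps P w y' ∂P := by
        simp_rw [key, ← Finset.mul_sum, hsplit]
        rw [integral_finsetSum _ fun k _ => hind k (hqi k)]

end Omega

section Omega

variable {p h d r : ℕ} {P : Measure (E p × Fin h)}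

lemma inv_diagonal_g (hslice : ∀ y, 0 < f P y) :
    (Matrix.diagonal (g P))⁻¹ = Matrix.diagonal fun y => (g P y)⁻¹ := by
  refine Matrix.inv_eq_right_inv ?_
  rw [Matrix.diagonal_mul_diagonal, ← Matrix.diagonal_one]
  congr 1
  funext y
  exact mul_inv_cancel₀ (g_pos hslice y).ne'

variable (P) in
/-- The vector `Ψᵀ D_g⁻¹ ε`. -/
def score (Ψ : Matrix (Fin h) (Fin d) ℝ) (w : E p × Fin h) (j : Fin d) : ℝ :=
  ∑ y, Ψ y j * (g P y)⁻¹ * eps P w y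

variable (P) in
/-- The columns of `α`. -/
def alphaCol (αx : Matrix (Fin p) (Fin r) ℝ) (a : Fin r) : E p :=
  WithLp.toLp 2 ((alpha P αx).col a)

lemma omegaIntegrand_apply (hslice : ∀ y, 0 < f P y) (Ψ : Matrix (Fin h) (Fin d) ℝ)
    (αx : Matrix (Fin p) (Fin r) ℝ) (w : E p × Fin h) (j j' : Fin d) (a a' : Fin r) :
    omegaIntegrand P Ψ αx w (j, a) (j', a')
      = inner ℝ (alphaCol P αx a) (Z P w) * inner ℝ (alphaCol P αx a') (Z P w)
        * (score P Ψ w j * score P Ψ w j') := by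
  have h1 : ∀ b, ((alpha P αx)ᵀ *ᵥ (Z P w).ofLp) b = inner ℝ (alphaCol P αx b) (Z P w) := by
    intro b
    rw [alphaCol, ← WithLp.toLp_ofLp 2 (Z P w), inner_toLp]
    rfl
  have h2 : ∀ b, ((Z P w).ofLp ᵥ* alpha P αx) b = inner ℝ (alphaCol P αx b) (Z P w) := by
    intro b
    rw [← h1, Matrix.mulVec_transpose]
  have h3 : ∀ i, ((Ψᵀ * (Matrix.diagonal (g P))⁻¹) *ᵥ eps P w) i = score P Ψ w i := by
    intro i
    rw [inv_diagonal_g hslice, Matrix.mulVec, dotProduct]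
    simp [Matrix.mul_diagonal, score]
  have h4 : ∀ i, (eps P w ᵥ* (Matrix.diagonal (g P))⁻¹ ᵥ* Ψ) i = score P Ψ w i := by
    intro i
    rw [← h3, Matrix.vecMul_vecMul, ← Matrix.mulVec_transpose, Matrix.transpose_mul,
      inv_diagonal_g hslice, Matrix.diagonal_transpose]
  rw [omegaIntegrand, Matrix.kroneckerMap_apply, Matrix.mul_vecMulVec, Matrix.vecMulVec_mul,
    Matrix.vecMulVec_mul, Matrix.vecMulVec_apply, Matrix.mul_vecMulVec, Matrix.vecMulVec_mul,
    Matrix.vecMulVec_apply, h1, h2, h3, h4, mul_comm]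

lemma alphaT_mul_alpha (hcov : (covX P).PosDef) {αx : Matrix (Fin p) (Fin r) ℝ}
    (hαx : αx.rank = r) : (alpha P αx)ᵀ * alpha P αx = 1 := by
  have hB := posDef_transpose_mul_inv_mul hcov hαx
  calc (alpha P αx)ᵀ * alpha P αx
      = invSqrt (αxᵀ * (covX P)⁻¹ * αx) * (αxᵀ * (invSqrt (covX P) * invSqrt (covX P)) * αx)
        * invSqrt (αxᵀ * (covX P)⁻¹ * αx) := by
        rw [alpha, Matrix.transpose_mul, Matrix.transpose_mul, transpose_invSqrt,
          transpose_invSqrt]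
        simp only [Matrix.mul_assoc]
    _ = 1 := by rw [invSqrt_mul_self hcov.posSemidef, invSqrt_mul_mul_invSqrt hB]

lemma orthonormal_alphaCol (hcov : (covX P).PosDef) {αx : Matrix (Fin p) (Fin r) ℝ}
    (hαx : αx.rank = r) : Orthonormal ℝ (alphaCol P αx) :=
  orthonormal_col.mpr (alphaT_mul_alpha hcov hαx)

lemma alphaCol_mem_hypSubspace (αx : Matrix (Fin p) (Fin r) ℝ) (a : Fin r) :
    alphaCol P αx a ∈ hypSubspace P αx := by
  have : (alpha P αx).col a = (invSqrt (covX P) * αx)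
      *ᵥ (invSqrt (αxᵀ * (covX P)⁻¹ * αx)).col a := rfl
  rw [alphaCol, this]
  exact toLp_mulVec_mem_colSpan _ _

variable [IsProbabilityMeasure P]

lemma hypSubspace_le {αx : Matrix (Fin p) (Fin r) ℝ} (hH : CoordinateHypothesis P αx) :
    hypSubspace P αx ≤ (centralSubspace P)ᗮ := by
  intro x hx
  rw [Submodule.mem_orthogonal]
  intro s hs
  have h1 : (hypSubspace P αx).starProjection s ∈ (⊥ : Submodule ℝ (E p)) := by
    rw [← show _ = (⊥ : Submodule ℝ (E p)) from hH]
    exact ⟨s, hs, rfl⟩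
  rw [Submodule.mem_bot, Submodule.starProjection_apply_eq_zero_iff] at h1
  exact Submodule.inner_left_of_mem_orthogonal hx h1

/-- The central subspace and the hypothesis subspace are orthogonal, so there is room for both. -/
lemma add_le_of_coordinateHypothesis (hcov : (covX P).PosDef)
    (hd : Module.finrank ℝ (centralSubspace P) = d) {αx : Matrix (Fin p) (Fin r) ℝ}
    (hαx : αx.rank = r) (hH : CoordinateHypothesis P αx) : d + r ≤ p := by
  have h1 := Submodule.finrank_add_finrank_orthogonal (centralSubspace P)
  rw [finrank_euclideanSpace_fin, hd] at h1
  let b : Fin r → (centralSubspace P)ᗮ := fun a =>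
    ⟨alphaCol P αx a, hypSubspace_le hH (alphaCol_mem_hypSubspace αx a)⟩
  have hb : LinearIndependent ℝ b :=
    LinearIndependent.of_comp (centralSubspace P)ᗮ.subtype
      (orthonormal_alphaCol hcov hαx).linearIndependent
  have h2 := hb.fintype_card_le_finrank
  rw [Fintype.card_fin] at h2
  omega

lemma memLp_score (hmom : MemLp (Prod.fst : E p × Fin h → E p) 4 P)
    (hcov : (covX P).PosDef) (hslice : ∀ y, 0 < f P y) (Ψ : Matrix (Fin h) (Fin d) ℝ)
    (j : Fin d) : MemLp (fun w => score P Ψ w j) 4 P :=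
  memLp_finsetSum _ fun y _ => (memLp_eps hmom hcov hslice y).const_mul _

/-- The covariance matrix of `Ψᵀ D_g⁻¹ ε` is `I - diag(l)`: the covariance matrix of `D_g⁻¹ ε` is
`I - g gᵀ - μᵀ μ`, and `Ψᵀ g = 0` because the columns of `Ψ` are in the range of `μᵀ` and
`μ g = 0`. -/
lemma integral_score_mul_score (hmom : MemLp (Prod.fst : E p × Fin h → E p) 4 P)
    (hcov : (covX P).PosDef) (hslice : ∀ y, 0 < f P y) {l : Fin d → ℝ} (hl : ∀ j, 0 < l j)
    {Ψ : Matrix (Fin h) (Fin d) ℝ} (hΨ : Ψ ∈ frames h d)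
    (hμ : (mu P)ᵀ * mu P = Ψ * Matrix.diagonal l * Ψᵀ) (j j' : Fin d) :
    ∫ w, score P Ψ w j * score P Ψ w j' ∂P = (1 - Matrix.diagonal l : Matrix _ _ ℝ) j j' := by
  have hΨ' : Ψᵀ * Ψ = 1 := hΨ
  -- `μ g = E(Z) = 0`
  have hμg : mu P *ᵥ g P = 0 := by
    have h1 : ∑ y, f P y • condMean P y = 0 := by
      simp_rw [f_smul_condMean hslice]
      rw [← integral_finsetSum]
      · rw [← integral_Z hmom]
        congr 1
        funext w
        rw [← Finset.sum_smul]
        simp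
      · intro y _
        refine ((memLp_Z hmom).integrable (by norm_num)).bdd_smul 1
          (memLp_indicator y 4).aestronglyMeasurable (ae_of_all _ fun w => ?_)
        split_ifs <;> simp
    ext i
    have h2 := congrArg (fun x : E p => x i) h1
    simp only [WithLp.ofLp_sum, Finset.sum_apply, PiLp.smul_apply, PiLp.zero_apply,
      smul_eq_mul] at h2
    rw [Pi.zero_apply, ← h2, Matrix.mulVec, dotProduct]
    refine Finset.sum_congr rfl fun y _ => ?_
    rw [mu, Matrix.of_apply, ← g_mul_self hslice]
    ring
  have hΨμ : Ψᵀ * ((mu P)ᵀ * mu P) = Matrix.diagonal l * Ψᵀ := by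
    rw [hμ, ← Matrix.mul_assoc, ← Matrix.mul_assoc, hΨ', Matrix.one_mul]
  have hΨg : ∀ i, ∑ y, Ψ y i * g P y = 0 := by
    intro i
    have h1 : (Matrix.diagonal l * Ψᵀ) *ᵥ g P = 0 := by
      rw [← hΨμ, ← Matrix.mul_assoc, ← Matrix.mulVec_mulVec, hμg, Matrix.mulVec_zero]
    have h2 := congrFun h1 i
    rw [← Matrix.mulVec_mulVec, Matrix.mulVec_diagonal, Pi.zero_apply] at h2
    exact (mul_eq_zero.mp h2).resolve_left (hl i).ne'
  have hΨΨ : (Ψᵀ * ((mu P)ᵀ * mu P) * Ψ) = Matrix.diagonal l := by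
    rw [hΨμ, Matrix.mul_assoc, hΨ', Matrix.mul_one]
  have hcoef : ∀ y y', (g P y)⁻¹ * (g P y')⁻¹ * ∫ w, eps P w y * eps P w y' ∂P
      = (1 : Matrix (Fin h) (Fin h) ℝ) y y' - g P y * g P y' - ((mu P)ᵀ * mu P) y y' := by
    intro y y'
    have hy := (g_pos hslice y).ne'
    have hy' := (g_pos hslice y').ne'
    rw [integral_eps_mul_eps hmom hcov hslice, muT_mul_mu_apply, Matrix.one_apply,
      ← g_mul_self hslice y, ← g_mul_self hslice y']
    by_cases hyy : y = y'
    · subst hyy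
      simp only [if_true]
      field_simp
    · simp only [hyy, if_false]
      field_simp
      ring
  have hint : ∀ y y', Integrable (fun w => Ψ y j * (g P y)⁻¹ * (Ψ y' j' * (g P y')⁻¹)
      * (eps P w y * eps P w y')) P := fun y y' =>
    (integrable_mul_of_memLp_four (memLp_eps hmom hcov hslice y)
      (memLp_eps hmom hcov hslice y')).const_mul _
  have hexp : ∀ w, score P Ψ w j * score P Ψ w j' = ∑ y, ∑ y', Ψ y j * (g P y)⁻¹ *
      (Ψ y' j' * (g P y')⁻¹) * (eps P w y * eps P w y') := by
    intro w
    rw [score, score, Finset.sum_mul_sum]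
    exact Finset.sum_congr rfl fun y _ => Finset.sum_congr rfl fun y' _ => by ring
  simp_rw [hexp]
  rw [integral_finsetSum _ fun y _ => integrable_finsetSum _ fun y' _ => hint y y']
  have h5 : ∀ y, ∫ w, ∑ y', Ψ y j * (g P y)⁻¹ * (Ψ y' j' * (g P y')⁻¹)
      * (eps P w y * eps P w y') ∂P = ∑ y', (Ψ y j * (1 : Matrix (Fin h) (Fin h) ℝ) y y' * Ψ y' j'
        - (Ψ y j * g P y) * (Ψ y' j' * g P y') - Ψ y j * ((mu P)ᵀ * mu P) y y' * Ψ y' j') := by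
    intro y
    rw [integral_finsetSum _ fun y' _ => hint y y']
    refine Finset.sum_congr rfl fun y' _ => ?_
    rw [integral_const_mul]
    linear_combination (Ψ y j * Ψ y' j') * hcoef y y'
  have hbil : ∀ M : Matrix (Fin h) (Fin h) ℝ, ∑ y, ∑ y', Ψ y j * M y y' * Ψ y' j'
      = (Ψᵀ * M * Ψ) j j' := by
    intro M
    rw [Matrix.mul_apply, Finset.sum_comm]
    simp only [Matrix.mul_apply, Finset.sum_mul, Matrix.transpose_apply]
  simp_rw [h5, Finset.sum_sub_distrib, ← Finset.mul_sum, hΨg, mul_zero]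
  have h6 : ∑ y, ∑ y', Ψ y j * (1 : Matrix (Fin h) (Fin h) ℝ) y y' * Ψ y' j'
      = (1 : Matrix (Fin d) (Fin d) ℝ) j j' := by
    rw [hbil, Matrix.mul_one, hΨ']
  rw [h6, hbil, hΨΨ]
  simp

/-- The second moments of the products of the coordinates of `αᵀ Z` and of `Ψᵀ D_g⁻¹ ε` factor. -/
lemma integral_alpha_mul_score (hmom : MemLp (Prod.fst : E p × Fin h → E p) 4 P)
    (hcov : (covX P).PosDef) (hslice : ∀ y, 0 < f P y) (hCS : CentralSubspaceExists P)
    (hC1 : Linearity P) (hC2 : Coverage P) (hC3 : ConstantCovariance P)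
    {αx : Matrix (Fin p) (Fin r) ℝ} (hαx : αx.rank = r) (hH : CoordinateHypothesis P αx)
    {l : Fin d → ℝ} (hl : ∀ j, 0 < l j) {Ψ : Matrix (Fin h) (Fin d) ℝ} (hΨ : Ψ ∈ frames h d)
    (hμ : (mu P)ᵀ * mu P = Ψ * Matrix.diagonal l * Ψᵀ) (j j' : Fin d) (a a' : Fin r) :
    ∫ w, inner ℝ (alphaCol P αx a) (Z P w) * inner ℝ (alphaCol P αx a') (Z P w)
        * (score P Ψ w j * score P Ψ w j') ∂P
      = (1 - Matrix.diagonal l : Matrix _ _ ℝ) j j' * (1 : Matrix (Fin r) (Fin r) ℝ) a a' := by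
  have hmem : ∀ b, alphaCol P αx b ∈ (centralSubspace P)ᗮ := fun b =>
    hypSubspace_le hH (alphaCol_mem_hypSubspace αx b)
  set T : E p × Fin h → ℝ := fun w =>
    inner ℝ (alphaCol P αx a) (Z P w) * inner ℝ (alphaCol P αx a') (Z P w) with hT
  have hT2 : MemLp T 2 P := (memLp_inner_Z hmom _).mul (memLp_inner_Z hmom _)
  have hee : ∀ y y', MemLp (fun w => eps P w y * eps P w y') 2 P := fun y y' =>
    (memLp_eps hmom hcov hslice y').mul (memLp_eps hmom hcov hslice y)
  have hin : inner ℝ (alphaCol P αx a) (alphaCol P αx a')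
      = (1 : Matrix (Fin r) (Fin r) ℝ) a a' := by
    rw [Matrix.one_apply]
    exact orthonormal_iff_ite.mp (orthonormal_alphaCol hcov hαx) a a'
  have hexp : ∀ w, score P Ψ w j * score P Ψ w j' = ∑ y, ∑ y', Ψ y j * (g P y)⁻¹ *
      (Ψ y' j' * (g P y')⁻¹) * (eps P w y * eps P w y') := by
    intro w
    rw [score, score, Finset.sum_mul_sum]
    exact Finset.sum_congr rfl fun y _ => Finset.sum_congr rfl fun y' _ => by ring
  have hexp' : ∀ w, T w * (score P Ψ w j * score P Ψ w j') = ∑ y, ∑ y', Ψ y j * (g P y)⁻¹ *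
      (Ψ y' j' * (g P y')⁻¹) * (T w * (eps P w y * eps P w y')) := by
    intro w
    rw [hexp, Finset.mul_sum]
    refine Finset.sum_congr rfl fun y _ => ?_
    rw [Finset.mul_sum]
    exact Finset.sum_congr rfl fun y' _ => by ring
  have hint : ∀ y y', Integrable (fun w => Ψ y j * (g P y)⁻¹ * (Ψ y' j' * (g P y')⁻¹)
      * (eps P w y * eps P w y')) P := fun y y' =>
    ((hee y y').integrable (by norm_num)).const_mul _
  have hint' : ∀ y y', Integrable (fun w => Ψ y j * (g P y)⁻¹ * (Ψ y' j' * (g P y')⁻¹)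
      * (T w * (eps P w y * eps P w y'))) P := fun y y' =>
    (hT2.integrable_mul (hee y y')).const_mul _
  rw [← integral_score_mul_score hmom hcov hslice hl hΨ hμ j j', ← hin]
  simp_rw [← show ∀ w, T w = inner ℝ (alphaCol P αx a) (Z P w)
    * inner ℝ (alphaCol P αx a') (Z P w) from fun _ => rfl, hexp', hexp]
  rw [integral_finsetSum _ fun y _ => integrable_finsetSum _ fun y' _ => hint y y',
    integral_finsetSum _ fun y _ => integrable_finsetSum _ fun y' _ => hint' y y',
    Finset.sum_mul]
  refine Finset.sum_congr rfl fun y _ => ?_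
  rw [integral_finsetSum _ fun y' _ => hint y y', integral_finsetSum _ fun y' _ => hint' y y',
    Finset.sum_mul]
  refine Finset.sum_congr rfl fun y' _ => ?_
  rw [integral_const_mul, integral_const_mul, hT,
    integral_inner_mul_inner_mul_eps hmom hcov hslice hCS hC1 hC2 hC3 (hmem a) (hmem a')]
  ring

/-- The form of `Ω`, for every diagonalization of `μᵀμ` on its range. -/
theorem omega_eq (hmom : MemLp (Prod.fst : E p × Fin h → E p) 4 P)
    (hcov : (covX P).PosDef) (hslice : ∀ y, 0 < f P y) (hCS : CentralSubspaceExists P)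
    (hC1 : Linearity P) (hC2 : Coverage P) (hC3 : ConstantCovariance P)
    {αx : Matrix (Fin p) (Fin r) ℝ} (hαx : αx.rank = r) (hH : CoordinateHypothesis P αx)
    {l : Fin d → ℝ} (hl : ∀ j, 0 < l j) {Ψ : Matrix (Fin h) (Fin d) ℝ} (hΨ : Ψ ∈ frames h d)
    (hμ : (mu P)ᵀ * mu P = Ψ * Matrix.diagonal l * Ψᵀ) :
    (∀ a b, Integrable (fun w => omegaIntegrand P Ψ αx w a b) P) ∧
      omega P Ψ αx = (1 - Matrix.diagonal l) ⊗ₖ (1 : Matrix (Fin r) (Fin r) ℝ) := by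
  constructor
  · rintro ⟨j, a⟩ ⟨j', a'⟩
    simp_rw [omegaIntegrand_apply hslice]
    have h1 : MemLp (fun w => inner ℝ (alphaCol P αx a) (Z P w)
        * inner ℝ (alphaCol P αx a') (Z P w)) 2 P :=
      (memLp_inner_Z hmom _).mul (memLp_inner_Z hmom _)
    have h2 : MemLp (fun w => score P Ψ w j * score P Ψ w j') 2 P :=
      (memLp_score hmom hcov hslice Ψ j').mul (memLp_score hmom hcov hslice Ψ j)
    exact h1.integrable_mul h2
  · ext ⟨j, a⟩ ⟨j', a'⟩
    rw [omega, Matrix.of_apply, Matrix.kroneckerMap_apply]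
    simp_rw [omegaIntegrand_apply hslice]
    exact integral_alpha_mul_score hmom hcov hslice hCS hC1 hC2 hC3 hαx hH hl hΨ hμ j j' a a'

/-- A singular value decomposition of `μ` diagonalizes `μᵀμ` on its range. -/
lemma IsSVD.transpose_mul_self {A : Matrix (Fin p) (Fin h) ℝ} {Γ₁ : Matrix (Fin p) (Fin d) ℝ}
    {Γ₀ : Matrix (Fin p) (Fin (p - d)) ℝ} {s : Fin d → ℝ} {Ψ₁ : Matrix (Fin h) (Fin d) ℝ}
    {Ψ₀ : Matrix (Fin h) (Fin (h - d)) ℝ} (hA : IsSVD A Γ₁ Γ₀ s Ψ₁ Ψ₀) :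
    Ψ₁ ∈ frames h d ∧ Aᵀ * A = Ψ₁ * Matrix.diagonal (fun j => s j ^ 2) * Ψ₁ᵀ := by
  have hΓ : Γ₁ᵀ * Γ₁ = 1 := by
    have := hA.left_orth
    rw [Matrix.transpose_fromCols, Matrix.fromRows_mul_fromCols, ← Matrix.fromBlocks_one] at this
    exact (Matrix.fromBlocks_inj.mp this).1
  have hΨ : Ψ₁ᵀ * Ψ₁ = 1 := by
    have := hA.right_orth
    rw [Matrix.transpose_fromCols, Matrix.fromRows_mul_fromCols, ← Matrix.fromBlocks_one] at this
    exact (Matrix.fromBlocks_inj.mp this).1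
  have hA1 : A = Γ₁ * Matrix.diagonal s * Ψ₁ᵀ := by
    have := hA.eq
    rw [Matrix.fromCols_mul_fromBlocks, Matrix.transpose_fromCols,
      Matrix.fromCols_mul_fromRows] at this
    simpa using this
  refine ⟨hΨ, ?_⟩
  rw [hA1, Matrix.transpose_mul, Matrix.transpose_mul, Matrix.transpose_transpose,
    Matrix.diagonal_transpose]
  have h1 : Matrix.diagonal (fun j => s j ^ 2) = Matrix.diagonal s * Matrix.diagonal s := by
    rw [Matrix.diagonal_mul_diagonal]
    congr 1
    funext j
    exact sq _
  calc _ = Ψ₁ * Matrix.diagonal s * (Γ₁ᵀ * Γ₁) * Matrix.diagonal s * Ψ₁ᵀ := by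
        simp only [Matrix.mul_assoc]
    _ = _ := by rw [hΓ, h1, Matrix.mul_one]; simp only [Matrix.mul_assoc]

end Omega

/-! ### Measurability of the statistic -/

section Measurability

variable {X : Type*} [MeasurableSpace X] {l m n : ℕ}

/-- A matrix-valued function with measurable entries. -/
def MeasurableEntries (A : X → Matrix (Fin m) (Fin n) ℝ) : Prop :=
  ∀ i j, Measurable fun x => A x i j

lemma MeasurableEntries.comp_continuous {A : X → Matrix (Fin m) (Fin n) ℝ}
    (hA : MeasurableEntries A) {g : Matrix (Fin m) (Fin n) ℝ → ℝ} (hg : Continuous g) :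
    Measurable fun x => g (A x) := by
  have h1 : Continuous (fun a : Fin m → Fin n → ℝ => g (Matrix.of a)) := hg.comp continuous_id
  exact h1.measurable.comp (measurable_pi_lambda _ fun i => measurable_pi_lambda _ fun j => hA i j)

lemma measurableEntries_const (A : Matrix (Fin m) (Fin n) ℝ) :
    MeasurableEntries fun _ : X => A := fun _ _ => measurable_const

lemma MeasurableEntries.mul {A : X → Matrix (Fin l) (Fin m) ℝ} {B : X → Matrix (Fin m) (Fin n) ℝ}
    (hA : MeasurableEntries A) (hB : MeasurableEntries B) :
    MeasurableEntries fun x => A x * B x := by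
  intro i j
  simp only [Matrix.mul_apply]
  exact Finset.measurable_sum _ fun k _ => (hA i k).mul (hB k j)

lemma MeasurableEntries.sub {A B : X → Matrix (Fin m) (Fin n) ℝ}
    (hA : MeasurableEntries A) (hB : MeasurableEntries B) :
    MeasurableEntries fun x => A x - B x := fun i j => (hA i j).sub (hB i j)

lemma MeasurableEntries.transpose {A : X → Matrix (Fin m) (Fin n) ℝ}
    (hA : MeasurableEntries A) : MeasurableEntries fun x => (A x)ᵀ := fun i j => hA j i

lemma MeasurableEntries.inv {A : X → Matrix (Fin m) (Fin m) ℝ}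
    (hA : MeasurableEntries A) : MeasurableEntries fun x => (A x)⁻¹ := by
  intro i j
  simp only [Matrix.inv_def, Matrix.smul_apply, Ring.inverse_eq_inv', smul_eq_mul]
  refine (hA.comp_continuous (g := fun M => M.det) (by fun_prop)).inv.mul
    (hA.comp_continuous (g := fun M => M.adjugate i j) ?_)
  exact (Continuous.matrix_adjugate continuous_id).matrix_elem i j

end Measurability

section Sample

variable {p h n d r : ℕ}

lemma measurable_sampleMean (i : Fin p) :
    Measurable fun w : Fin n → E p × Fin h => sampleMean w i := by
  have : (fun w : Fin n → E p × Fin h => sampleMean w i)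
      = fun w => (n : ℝ)⁻¹ * ∑ k, (w k).1 i := by
    funext w
    simp [sampleMean]
  rw [this]
  fun_prop

lemma measurableEntries_sampleCov :
    MeasurableEntries fun w : Fin n → E p × Fin h => sampleCov w := by
  intro i j
  simp only [sampleCov, Matrix.of_apply]
  refine Measurable.const_mul (Finset.measurable_sum _ fun k _ => ?_) _
  have h1 := measurable_sampleMean (p := p) (h := h) (n := n) i
  have h2 := measurable_sampleMean (p := p) (h := h) (n := n) j
  fun_prop

lemma measurable_slice_indicator (y : Fin h) :
    Measurable fun v : E p × Fin h => if v.2 = y then (1 : ℝ) else 0 :=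
  Measurable.ite (measurable_snd (measurableSet_singleton y)) measurable_const measurable_const

lemma measurable_slice_indicator_comp (y : Fin h) (k : Fin n) :
    Measurable fun w : Fin n → E p × Fin h => if (w k).2 = y then (1 : ℝ) else 0 :=
  (measurable_slice_indicator y).comp (measurable_pi_apply k)

lemma measurableEntries_sampleCross :
    MeasurableEntries fun w : Fin n → E p × Fin h => sampleCross w := by
  intro i y
  simp only [sampleCross, Matrix.of_apply]
  refine Measurable.const_mul (Finset.measurable_sum _ fun k _ => ?_) _
  have h1 := measurable_sampleMean (p := p) (h := h) (n := n) i
  exact Measurable.mul (by fun_prop) (measurable_slice_indicator_comp y k)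

lemma fhat_eq (w : Fin n → E p × Fin h) (y : Fin h) :
    fhat w y = (n : ℝ)⁻¹ * ∑ k, if (w k).2 = y then (1 : ℝ) else 0 := by
  simp [fhat, div_eq_inv_mul]

lemma measurable_fhat (y : Fin h) : Measurable fun w : Fin n → E p × Fin h => fhat w y := by
  simp only [fhat_eq]
  exact Measurable.const_mul
    (Finset.measurable_sum _ fun k _ => measurable_slice_indicator_comp y k) _

lemma measurableEntries_diagInvG :
    MeasurableEntries fun w : Fin n → E p × Fin h => diagInvG w := by
  intro y y'
  simp only [diagInvG, Matrix.diagonal_apply]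
  by_cases hy : y = y'
  · simp only [hy, if_true]
    exact (measurable_fhat y').sqrt.inv
  · simp only [hy, if_false]
    exact measurable_const

lemma measurableEntries_sampleGram :
    MeasurableEntries fun w : Fin n → E p × Fin h => sampleGram w := by
  have h1 := measurableEntries_sampleCross.mul
    (measurableEntries_diagInvG (p := p) (h := h) (n := n))
  exact (h1.transpose.mul measurableEntries_sampleCov.inv).mul h1

lemma measurableEntries_sampleGramHyp (αx : Matrix (Fin p) (Fin r) ℝ) :
    MeasurableEntries fun w : Fin n → E p × Fin h => sampleGramHyp w αx := by
  have h1 := measurableEntries_sampleCross.mul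
    (measurableEntries_diagInvG (p := p) (h := h) (n := n))
  have h2 := (measurableEntries_const αxᵀ).mul
    (measurableEntries_sampleCov (p := p) (h := h) (n := n)).inv
  exact ((h2.mul h1).transpose.mul (h2.mul (measurableEntries_const αx)).inv).mul (h2.mul h1)

lemma measurable_statistic (hdh : d ≤ h) (hdr : d + r ≤ p) {αx : Matrix (Fin p) (Fin r) ℝ}
    (hαx : αx.rank = r) : Measurable fun w : Fin n → E p × Fin h => statistic w d αx := by
  simp_rw [statistic_eq _ hdh hdr hαx]
  have h1 := measurableEntries_sampleGram (p := p) (h := h) (n := n)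
  exact ((h1.comp_continuous continuous_kyFan).sub
    ((h1.sub (measurableEntries_sampleGramHyp αx)).comp_continuous continuous_kyFan)).const_mul _

/-! ### Sample moments as averages -/

/-- The average of `n` numbers. -/
def avg (u : Fin n → ℝ) : ℝ := (n : ℝ)⁻¹ * ∑ k, u k

lemma avg_add (u v : Fin n → ℝ) : avg (fun k => u k + v k) = avg u + avg v := by
  simp only [avg, Finset.sum_add_distrib, mul_add]

lemma avg_sub (u v : Fin n → ℝ) : avg (fun k => u k - v k) = avg u - avg v := by
  simp only [avg, Finset.sum_sub_distrib, mul_sub]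

lemma avg_const_mul (c : ℝ) (u : Fin n → ℝ) : avg (fun k => c * u k) = c * avg u := by
  simp only [avg, ← Finset.mul_sum]
  ring

lemma avg_sum {ι : Type*} (s : Finset ι) (u : ι → Fin n → ℝ) :
    avg (fun k => ∑ i ∈ s, u i k) = ∑ i ∈ s, avg (u i) := by
  simp only [avg]
  rw [Finset.sum_comm, Finset.mul_sum]

lemma avg_const [NeZero n] (c : ℝ) : avg (fun _ : Fin n => c) = c := by
  have : (n : ℝ) ≠ 0 := NeZero.ne _
  simp [avg, this]

/-- The sample covariance of `n` pairs of numbers. -/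
def avgCov (u v : Fin n → ℝ) : ℝ := avg (fun k => u k * v k) - avg u * avg v

lemma avg_centered_mul [NeZero n] (u v : Fin n → ℝ) (c : ℝ) :
    avg (fun k => (u k - (c + avg fun k => u k - c)) * v k) = avgCov (fun k => u k - c) v := by
  have h1 : ∀ k, (u k - (c + avg fun k => u k - c)) * v k
      = (u k - c) * v k - (avg fun k => u k - c) * v k := fun k => by ring
  rw [funext h1, avg_sub, avg_const_mul]
  rfl

lemma avgCov_const_add [NeZero n] (u v : Fin n → ℝ) (c : ℝ) :
    avgCov u (fun k => v k + c) = avgCov u v := by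
  have h1 : ∀ k, u k * (v k + c) = u k * v k + c * u k := fun k => by ring
  simp only [avgCov, h1, avg_add, avg_const_mul, avg_const]
  ring

lemma avgCov_sub (u v v' : Fin n → ℝ) :
    avgCov u (fun k => v k - v' k) = avgCov u v - avgCov u v' := by
  simp only [avgCov, mul_sub, avg_sub]
  ring

lemma avgCov_sum_mul {ι : Type*} (s : Finset ι) (u : Fin n → ℝ) (b : ι → ℝ) (v : ι → Fin n → ℝ) :
    avgCov u (fun k => ∑ i ∈ s, b i * v i k) = ∑ i ∈ s, b i * avgCov u (v i) := by
  have h1 : ∀ k, u k * ∑ i ∈ s, b i * v i k = ∑ i ∈ s, b i * (u k * v i k) := by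
    intro k
    rw [Finset.mul_sum]
    exact Finset.sum_congr rfl fun i _ => by ring
  simp only [avgCov, h1, avg_sum, avg_const_mul, Finset.mul_sum, ← Finset.sum_sub_distrib]
  exact Finset.sum_congr rfl fun i _ => by ring

variable (P : Measure (E p × Fin h)) [NeZero n] (w : Fin n → E p × Fin h)

lemma sampleMean_eq (i : Fin p) :
    sampleMean w i = meanX P i + avg fun k => (w k).1 i - meanX P i := by
  rw [avg_sub, avg_const]
  simp [sampleMean, avg]

lemma sampleCross_eq (i : Fin p) (y : Fin h) :
    sampleCross w i y = avgCov (fun k => (w k).1 i - meanX P i)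
      (fun k => if (w k).2 = y then 1 else 0) := by
  rw [← avg_centered_mul, ← sampleMean_eq P w]
  rfl

lemma sampleCov_eq (i j : Fin p) :
    sampleCov w i j = avgCov (fun k => (w k).1 i - meanX P i)
      (fun k => (w k).1 j - meanX P j) := by
  have h1 : sampleCov w i j = avg fun k => ((w k).1 i - sampleMean w i)
      * ((w k).1 j - sampleMean w j) := rfl
  have h2 := avg_centered_mul (fun k => (w k).1 i) (fun k => (w k).1 j - sampleMean w j)
    (meanX P i)
  rw [← sampleMean_eq P w] at h2
  rw [h1, h2]
  have h3 : ∀ k, (w k).1 j - sampleMean w j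
      = ((w k).1 j - meanX P j) + (meanX P j - sampleMean w j) := fun k => by ring
  simp only [h3, avgCov_const_add]

/-- The matrix with columns `β_y`. -/
def betaMatrix : Matrix (Fin p) (Fin h) ℝ := Matrix.of fun i y => beta P y i

/-- The normal equations: the errors of the least squares coefficients are driven by the sample
covariances of the predictors with the residuals `ε`. -/
lemma sampleCross_sub (i : Fin p) (y : Fin h) :
    (sampleCross w - sampleCov w * betaMatrix P) i y
      = avgCov (fun k => (w k).1 i - meanX P i) (fun k => eps P (w k) y) := by
  have h1 : ∀ k, eps P (w k) y = ((if (w k).2 = y then (1 : ℝ) else 0)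
      - ∑ j, beta P y j * ((w k).1 j - meanX P j)) + (-f P y) := by
    intro k
    rw [eps, dotProduct]
    ring
  simp only [h1]
  rw [avgCov_const_add, avgCov_sub, avgCov_sum_mul, Matrix.sub_apply, ← sampleCross_eq P w,
    Matrix.mul_apply]
  congr 1
  refine Finset.sum_congr rfl fun j _ => ?_
  rw [← sampleCov_eq P w, betaMatrix, Matrix.of_apply, mul_comm]

end Sample

section HypothesisGram

variable {p h n r : ℕ} {P : Measure (E p × Fin h)} [IsProbabilityMeasure P]

/-- Under the coordinate hypothesis the regression coefficients have no component along `αx`. -/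
lemma alphaxT_mul_betaMatrix (hmom : MemLp (Prod.fst : E p × Fin h → E p) 4 P)
    (hcov : (covX P).PosDef) (hslice : ∀ y, 0 < f P y) (hC2 : Coverage P)
    {αx : Matrix (Fin p) (Fin r) ℝ} (hH : CoordinateHypothesis P αx) :
    αxᵀ * betaMatrix P = 0 := by
  ext a y
  have h1 : (WithLp.toLp 2 ((invSqrt (covX P) * αx).col a) : E p) ∈ hypSubspace P αx :=
    Submodule.subset_span ⟨a, rfl⟩
  have h2 := Submodule.inner_left_of_mem_orthogonal (condMean_mem_centralSubspace hC2 y)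
    (hypSubspace_le hH h1)
  rw [← WithLp.toLp_ofLp 2 (condMean P y), inner_toLp] at h2
  have h3 : (αxᵀ * betaMatrix P) a y
      = f P y * ((invSqrt (covX P) * αx).col a ⬝ᵥ (condMean P y).ofLp) := by
    have h4 : (αxᵀ * betaMatrix P) a y = (αxᵀ *ᵥ beta P y) a := rfl
    have h5 : ((invSqrt (covX P) * αx)ᵀ *ᵥ (condMean P y).ofLp) a
      = (invSqrt (covX P) * αx).col a ⬝ᵥ (condMean P y).ofLp := rfl
    rw [h4, beta_eq hmom hcov hslice, Matrix.mulVec_smul, Pi.smul_apply, smul_eq_mul,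
      Matrix.mulVec_mulVec, ← h5, Matrix.transpose_mul, transpose_invSqrt]
  rw [h3, h2, mul_zero]
  rfl

/-- Under the coordinate hypothesis the covariances of the predictors with the slice indicators can
be replaced by those with the residuals `ε`. A singular `Σ̂` does no harm: its inverse is `0` by
convention. -/
lemma sampleGramHyp_eq (hmom : MemLp (Prod.fst : E p × Fin h → E p) 4 P)
    (hcov : (covX P).PosDef) (hslice : ∀ y, 0 < f P y) (hC2 : Coverage P)
    {αx : Matrix (Fin p) (Fin r) ℝ} (hH : CoordinateHypothesis P αx)
    (w : Fin n → E p × Fin h) :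
    sampleGramHyp w αx
      = (αxᵀ * (sampleCov w)⁻¹ * ((sampleCross w - sampleCov w * betaMatrix P) * diagInvG w))ᵀ
        * (αxᵀ * (sampleCov w)⁻¹ * αx)⁻¹ *
        (αxᵀ * (sampleCov w)⁻¹ * ((sampleCross w - sampleCov w * betaMatrix P) * diagInvG w)) := by
  have h1 : αxᵀ * (sampleCov w)⁻¹ * (sampleCov w * betaMatrix P) = 0 := by
    by_cases hdet : IsUnit (sampleCov w).det
    · rw [← Matrix.mul_assoc, Matrix.nonsing_inv_mul_cancel_right _ _ hdet,
        alphaxT_mul_betaMatrix hmom hcov hslice hC2 hH]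
    · rw [Matrix.nonsing_inv_apply_not_isUnit _ hdet]
      simp
  have h2 : αxᵀ * (sampleCov w)⁻¹ * ((sampleCross w - sampleCov w * betaMatrix P) * diagInvG w)
      = αxᵀ * (sampleCov w)⁻¹ * (sampleCross w * diagInvG w) := by
    rw [Matrix.sub_mul, Matrix.mul_sub, ← Matrix.mul_assoc _ (sampleCov w * betaMatrix P), h1,
      Matrix.zero_mul, sub_zero]
  rw [h2, sampleGramHyp]

end HypothesisGram

/-! ### Limit theorems for independent copies -/

section Limits

variable {𝓧 Ω : Type*} {m𝓧 : MeasurableSpace 𝓧} {mΩ : MeasurableSpace Ω} {P : Measure 𝓧}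
  {Q : Measure Ω} {W : ℕ → Ω → 𝓧}

lemma identDistrib_comp (hlaw : ∀ i, HasLaw (W i) P Q) {F : Type*} [MeasurableSpace F]
    {φ : 𝓧 → F} (hφ : Measurable φ) (i : ℕ) :
    IdentDistrib (fun ω => φ (W i ω)) (fun ω => φ (W 0 ω)) Q Q :=
  IdentDistrib.comp ⟨(hlaw i).aemeasurable, (hlaw 0).aemeasurable,
    (hlaw i).map_eq.trans (hlaw 0).map_eq.symm⟩ hφ

lemma memLp_comp (hlaw : ∀ i, HasLaw (W i) P Q) {φ : 𝓧 → ℝ} {q : ENNReal} (hφ : MemLp φ q P)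
    (i : ℕ) : MemLp (fun ω => φ (W i ω)) q Q := by
  rw [← (hlaw i).map_eq] at hφ
  exact hφ.comp_of_map (hlaw i).aemeasurable

/-- The strong law of large numbers for a function of independent copies. -/
lemma ae_tendsto_avg [IsProbabilityMeasure Q] (hlaw : ∀ i, HasLaw (W i) P Q)
    (hindep : iIndepFun W Q) {φ : 𝓧 → ℝ} (hφ : Measurable φ) (hint : Integrable φ P) :
    ∀ᵐ ω ∂Q, Tendsto (fun n : ℕ => avg fun k : Fin n => φ (W k ω)) atTop (𝓝 (∫ x, φ x ∂P)) := by
  have h1 := strong_law_ae_real (μ := Q) (fun i ω => φ (W i ω))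
    (memLp_one_iff_integrable.1 (memLp_comp hlaw (memLp_one_iff_integrable.2 hint) 0))
    (fun i j hij => (hindep.indepFun hij).comp hφ hφ) (identDistrib_comp hlaw hφ)
  filter_upwards [h1] with ω hω
  have h2 : ∫ ω, φ (W 0 ω) ∂Q = ∫ x, φ x ∂P :=
    (hlaw 0).integral_comp hφ.aestronglyMeasurable
  rw [h2] at hω
  refine hω.congr fun n => ?_
  rw [avg, Finset.sum_range, div_eq_inv_mul]

variable {ι : Type*} [Fintype ι]

/-- The sum of `n` values of a random vector, divided by `√n`. -/
def scaledSum (φ : 𝓧 → EuclideanSpace ℝ ι) {n : ℕ} (w : Fin n → 𝓧) : EuclideanSpace ℝ ι :=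
  (√(n : ℝ))⁻¹ • ∑ k, φ (w k)

lemma charFun_map_eq_charFun_map_inner {X : Ω → EuclideanSpace ℝ ι} (hX : AEMeasurable X Q)
    (t : EuclideanSpace ℝ ι) :
    charFun (Q.map X) t = charFun (Q.map fun ω => inner ℝ t (X ω)) 1 := by
  rw [charFun_apply, charFun_apply, integral_map hX (by fun_prop),
    integral_map (by fun_prop) (by fun_prop)]
  simp [real_inner_comm]

lemma inner_scaledSum (φ : 𝓧 → EuclideanSpace ℝ ι) {n : ℕ} (w : Fin n → 𝓧)
    (t : EuclideanSpace ℝ ι) :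
    inner ℝ t (scaledSum φ w) = (√(n : ℝ))⁻¹ * ∑ k, inner ℝ t (φ (w k)) := by
  rw [scaledSum, inner_smul_right, inner_sum]

/-- The multivariate central limit theorem, by the Cramér–Wold device. The Gaussian limit is
described by its characteristic function. -/
lemma exists_tendstoInDistribution_scaledSum [IsProbabilityMeasure Q]
    (hlaw : ∀ i, HasLaw (W i) P Q) (hindep : iIndepFun W Q) {φ : 𝓧 → EuclideanSpace ℝ ι}
    (hφ : Measurable φ) (hL2 : ∀ i, MemLp (fun x => φ x i) 2 P)
    (h0 : ∀ i, ∫ x, φ x i ∂P = 0) :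
    ∃ (ν : Measure (EuclideanSpace ℝ ι)) (_ : IsProbabilityMeasure ν),
      (∀ t, charFun ν t = Complex.exp (-((∫ x, inner ℝ t (φ x) ^ 2 ∂P : ℝ) : ℂ) / 2)) ∧
      TendstoInDistribution (fun (n : ℕ) ω => scaledSum φ fun k : Fin n => W k ω) atTop
        (id : EuclideanSpace ℝ ι → EuclideanSpace ℝ ι) (fun _ => Q) ν := by
  classical
  have : IsProbabilityMeasure P := (hlaw 0).isProbabilityMeasure_iff.1 inferInstance
  have hinner : ∀ (t : EuclideanSpace ℝ ι) x, inner ℝ t (φ x) = ∑ i, t i * φ x i := by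
    intro t x
    simp [PiLp.inner_apply, mul_comm]
  have hinnerL2 : ∀ t, MemLp (fun x => inner ℝ t (φ x)) 2 P := by
    intro t
    simp only [hinner]
    exact memLp_finsetSum _ fun i _ => (hL2 i).const_mul _
  let S : Matrix ι ι ℝ := Matrix.of fun i j => ∫ x, φ x i * φ x j ∂P
  have hquad : ∀ t : EuclideanSpace ℝ ι, t.ofLp ⬝ᵥ S *ᵥ t.ofLp = ∫ x, inner ℝ t (φ x) ^ 2 ∂P := by
    intro t
    have h1 : ∀ x, inner ℝ t (φ x) ^ 2 = ∑ i, ∑ j, t i * t j * (φ x i * φ x j) := by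
      intro x
      rw [hinner, sq, Finset.sum_mul_sum]
      exact Finset.sum_congr rfl fun i _ => Finset.sum_congr rfl fun j _ => by ring
    have h2 : ∀ i j, Integrable (fun x => t i * t j * (φ x i * φ x j)) P := fun i j =>
      ((hL2 i).integrable_mul (hL2 j)).const_mul _
    simp only [h1]
    rw [integral_finsetSum _ fun i _ => integrable_finsetSum _ fun j _ => h2 i j]
    simp only [dotProduct, Matrix.mulVec, Finset.mul_sum]
    refine Finset.sum_congr rfl fun i _ => ?_
    rw [integral_finsetSum _ fun j _ => h2 i j]
    refine Finset.sum_congr rfl fun j _ => ?_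
    rw [integral_const_mul]
    simp only [S, Matrix.of_apply]
    ring
  have hS : S.PosSemidef := by
    refine Matrix.PosSemidef.of_dotProduct_mulVec_nonneg ?_ fun t => ?_
    · ext i j
      simp only [S, Matrix.conjTranspose_apply, Matrix.of_apply, star_trivial]
      exact integral_congr_ae (.of_forall fun x => mul_comm _ _)
    · rw [star_trivial]
      exact (hquad (WithLp.toLp 2 t)).symm ▸ integral_nonneg fun x => sq_nonneg _
  have hchar : ∀ t, charFun (multivariateGaussian 0 S) t
      = Complex.exp (-((∫ x, inner ℝ t (φ x) ^ 2 ∂P : ℝ) : ℂ) / 2) := by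
    intro t
    rw [charFun_multivariateGaussian hS, hquad, inner_zero_right]
    congr 1
    push_cast
    ring
  have hmeas : ∀ n : ℕ, AEMeasurable (fun ω => scaledSum φ fun k : Fin n => W k ω) Q := by
    intro n
    have h1 : ∀ k : Fin n, AEMeasurable (fun ω => φ (W k ω)) Q := fun k =>
      hφ.comp_aemeasurable (hlaw k).aemeasurable
    exact (Finset.aemeasurable_fun_sum _ fun k _ => h1 k).const_smul (√(n : ℝ))⁻¹
  refine ⟨multivariateGaussian 0 S, inferInstance, hchar, hmeas, aemeasurable_id, ?_⟩
  refine ProbabilityMeasure.tendsto_iff_tendsto_charFun.2 fun t => ?_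
  have hmt : Measurable fun x => inner ℝ t (φ x) := by fun_prop
  have hX0 : ∫ ω, inner ℝ t (φ (W 0 ω)) ∂Q = 0 := by
    have h1 : ∫ ω, inner ℝ t (φ (W 0 ω)) ∂Q = ∫ x, inner ℝ t (φ x) ∂P :=
      (hlaw 0).integral_comp hmt.aestronglyMeasurable
    rw [h1]
    simp only [hinner]
    rw [integral_finsetSum _ fun i _ => ((hL2 i).integrable (by norm_num)).const_mul _]
    simp [integral_const_mul, h0]
  have hvar : Var[fun ω => inner ℝ t (φ (W 0 ω)); Q] = ∫ x, inner ℝ t (φ x) ^ 2 ∂P := by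
    have h1 : AEMeasurable (fun ω => inner ℝ t (φ (W 0 ω))) Q :=
      hmt.comp_aemeasurable (hlaw 0).aemeasurable
    rw [variance_of_integral_eq_zero h1 hX0]
    exact (hlaw 0).integral_comp (hmt.pow_const 2).aestronglyMeasurable
  have h1 := tendstoInDistribution_inv_sqrt_mul_sum_sub (P := Q)
    (X := fun k ω => inner ℝ t (φ (W k ω))) (HasLaw.id (μ := gaussianReal 0 _))
    (memLp_comp hlaw (hinnerL2 t) 0) (hindep.comp (fun _ x => inner ℝ t (φ x)) fun _ => hmt)
    (identDistrib_comp hlaw hmt)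
  have h2 := ProbabilityMeasure.tendsto_iff_tendsto_charFun.1 h1.tendsto 1
  have h3 : charFun ((gaussianReal 0 Var[fun ω => inner ℝ t (φ (W 0 ω)); Q].toNNReal).map id) 1
      = charFun ((multivariateGaussian 0 S).map id) t := by
    rw [Measure.map_id, Measure.map_id, hchar, charFun_gaussianReal, hvar,
      Real.coe_toNNReal _ (integral_nonneg fun x => sq_nonneg _)]
    congr 1
    push_cast
    ring
  simp only [ProbabilityMeasure.coe_mk] at h2 ⊢
  rw [h3] at h2
  refine h2.congr fun n => ?_
  rw [charFun_map_eq_charFun_map_inner (hmeas n) t]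
  simp only [inner_scaledSum, hX0, mul_zero, sub_zero, Finset.sum_range]

/-- Convergence in distribution to the constant `0` is convergence to `0` in measure. -/
lemma tendstoInMeasure_zero_of_tendstoInDistribution_zero [IsProbabilityMeasure Q]
    {Ω' : Type*} {mΩ' : MeasurableSpace Ω'} {ν : Measure Ω'} [IsProbabilityMeasure ν]
    {X : ℕ → Ω → ℝ} (h : TendstoInDistribution X atTop (fun _ => (0 : ℝ)) (fun _ => Q) ν) :
    TendstoInMeasure Q X atTop 0 := by
  rw [tendstoInMeasure_iff_norm]
  intro ε hε
  have hF : IsClosed {x : ℝ | ε ≤ ‖x‖} := isClosed_le continuous_const continuous_norm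
  have h1 := ProbabilityMeasure.limsup_measure_closed_le_of_tendsto h.tendsto hF
  simp only [ProbabilityMeasure.coe_mk] at h1
  rw [Measure.map_apply measurable_const hF.measurableSet] at h1
  have h2 : (fun _ : Ω' => (0 : ℝ)) ⁻¹' {x : ℝ | ε ≤ ‖x‖} = ∅ := by
    ext; simp [hε]
  rw [h2, measure_empty] at h1
  have h3 : ∀ n, (Q.map (X n)) {x : ℝ | ε ≤ ‖x‖} = Q {ω | ε ≤ ‖X n ω - (0 : Ω → ℝ) ω‖} := by
    intro n
    rw [Measure.map_apply_of_aemeasurable (h.forall_aemeasurable n) hF.measurableSet]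
    simp
  simp only [h3] at h1
  exact tendsto_of_le_liminf_of_limsup_le zero_le h1

end Limits

/-! ### Gaussian quadratic forms -/

section Gaussian

variable {d r : ℕ} {ι : Type*} [Fintype ι]

/-- The sums of squares of the rows of a matrix of independent standard normal variables are
independent chi-squared variables. -/
lemma map_rowSumSq_pi : (Measure.pi fun _ : Fin d × Fin r => gaussianReal 0 1).map
      (fun c j => ∑ a, c (j, a) ^ 2) = Measure.pi fun _ : Fin d => chiSquared r := by
  have h1 := Measure.infinitePi_map_curry (ι := Fin d) (κ := Fin r) fun _ _ => gaussianReal 0 1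
  simp only [Measure.infinitePi_eq_pi] at h1
  have h2 : Measure.pi (fun _ : Fin d => chiSquared r)
      = (Measure.pi fun _ : Fin d => Measure.pi fun _ : Fin r => gaussianReal 0 1).map
        (fun c j => ∑ a, c j a ^ 2) :=
    (Measure.pi_map_pi (X := fun _ : Fin d => Fin r → ℝ)
      (f := fun _ c => ∑ a, c a ^ 2) fun _ => Measurable.aemeasurable (by fun_prop)).symm
  rw [h2, ← h1, Measure.map_map (by fun_prop) (by fun_prop)]
  rfl

/-- A weighted sum of squares of jointly Gaussian variables that are uncorrelated with variance
`v j` is a weighted sum of independent chi-squared variables. -/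
lemma map_sum_sq_inner {ν : Measure (EuclideanSpace ℝ ι)} [IsProbabilityMeasure ν]
    {v : Fin d → ℝ} (hv : ∀ j, 0 ≤ v j) (t : Fin d × Fin r → EuclideanSpace ℝ ι)
    (hν : ∀ s : Fin d × Fin r → ℝ, charFun ν (∑ q, s q • t q)
      = Complex.exp (-((∑ q, s q ^ 2 * v q.1 : ℝ) : ℂ) / 2)) :
    ν.map (fun x => ∑ q, inner ℝ (t q) x ^ 2)
      = (Measure.pi fun _ : Fin d => chiSquared r).map fun c => ∑ j, v j * c j := by
  have h1 : ν.map (fun x => WithLp.toLp 2 fun q => inner ℝ (t q) x)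
      = (Measure.pi fun _ : Fin d × Fin r => gaussianReal 0 1).map
        fun c => WithLp.toLp 2 fun q => √(v q.1) * c q := by
    have hm1 : Measurable fun x => WithLp.toLp 2 fun q => inner ℝ (t q) x := by fun_prop
    have hm2 : Measurable fun c : Fin d × Fin r → ℝ => WithLp.toLp 2 fun q => √(v q.1) * c q := by
      fun_prop
    have := Measure.isProbabilityMeasure_map hm1.aemeasurable (μ := ν)
    have := Measure.isProbabilityMeasure_map hm2.aemeasurable
      (μ := Measure.pi fun _ : Fin d × Fin r => gaussianReal 0 1)
    refine Measure.ext_of_charFun (funext fun s => ?_)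
    have h2 : charFun (ν.map fun x => WithLp.toLp 2 fun q => inner ℝ (t q) x) s
        = charFun ν (∑ q, s q • t q) := by
      rw [charFun_apply, charFun_apply, integral_map hm1.aemeasurable (by fun_prop)]
      congr 1
      ext x
      congr 3
      simp [PiLp.inner_apply, inner_sum, inner_smul_right, mul_comm]
    have h3 : charFun ((Measure.pi fun _ : Fin d × Fin r => gaussianReal 0 1).map
          fun c => WithLp.toLp 2 fun q => √(v q.1) * c q) s
        = charFun ((Measure.pi fun _ : Fin d × Fin r => gaussianReal 0 1).map (WithLp.toLp 2))
          (WithLp.toLp 2 fun q => √(v q.1) * s q) := by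
      rw [charFun_apply, charFun_apply, integral_map hm2.aemeasurable (by fun_prop),
        integral_map (by fun_prop) (by fun_prop)]
      congr 1
      ext c
      congr 3
      simp only [PiLp.inner_apply]
      refine Finset.sum_congr rfl fun q _ => ?_
      simp only [RCLike.inner_apply, conj_trivial]
      ring
    rw [h2, h3, hν, map_pi_eq_stdGaussian, charFun_stdGaussian, ← Complex.ofReal_pow,
      EuclideanSpace.norm_sq_eq]
    simp only [Real.norm_eq_abs, sq_abs, mul_pow, Real.sq_sqrt (hv _), mul_comm]
  have h4 : ν.map (fun x => ∑ q, inner ℝ (t q) x ^ 2)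
      = (ν.map fun x => WithLp.toLp 2 fun q => inner ℝ (t q) x).map
        fun z : EuclideanSpace ℝ (Fin d × Fin r) => ∑ q, z q ^ 2 := by
    rw [Measure.map_map (by fun_prop) (by fun_prop)]
    rfl
  rw [h4, h1, ← map_rowSumSq_pi, Measure.map_map (by fun_prop) (by fun_prop),
    Measure.map_map (by fun_prop) (by fun_prop)]
  congr 1
  funext c
  simp only [Function.comp_apply, Fintype.sum_prod_type, mul_pow, Real.sq_sqrt (hv _),
    Finset.mul_sum]

end Gaussian

/-! ### Consistency of the sample moments -/

lemma tendsto_matrix {X : Type*} {m n : ℕ} {F : Filter X} {A : X → Matrix (Fin m) (Fin n) ℝ}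
    {B : Matrix (Fin m) (Fin n) ℝ} (hA : ∀ i j, Tendsto (fun x => A x i j) F (𝓝 (B i j))) :
    Tendsto A F (𝓝 B) :=
  tendsto_pi_nhds.mpr fun i => tendsto_pi_nhds.mpr (hA i)

lemma tendsto_matrix_mul {X : Type*} {l m n : ℕ} {F : Filter X}
    {A : X → Matrix (Fin l) (Fin m) ℝ} {B : X → Matrix (Fin m) (Fin n) ℝ}
    {A₀ : Matrix (Fin l) (Fin m) ℝ} {B₀ : Matrix (Fin m) (Fin n) ℝ}
    (hA : Tendsto A F (𝓝 A₀)) (hB : Tendsto B F (𝓝 B₀)) :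
    Tendsto (fun x => A x * B x) F (𝓝 (A₀ * B₀)) := by
  have h1 : Continuous fun q : Matrix (Fin l) (Fin m) ℝ × Matrix (Fin m) (Fin n) ℝ =>
    q.1 * q.2 := by fun_prop
  exact (h1.tendsto (A₀, B₀)).comp (hA.prodMk_nhds hB)

lemma tendsto_matrix_transpose {X : Type*} {m n : ℕ} {F : Filter X}
    {A : X → Matrix (Fin m) (Fin n) ℝ} {A₀ : Matrix (Fin m) (Fin n) ℝ}
    (hA : Tendsto A F (𝓝 A₀)) : Tendsto (fun x => (A x)ᵀ) F (𝓝 A₀ᵀ) := by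
  have h1 : Continuous fun q : Matrix (Fin m) (Fin n) ℝ => qᵀ := by fun_prop
  exact (h1.tendsto A₀).comp hA

lemma tendsto_matrix_inv {X : Type*} {m : ℕ} {F : Filter X} {A : X → Matrix (Fin m) (Fin m) ℝ}
    {A₀ : Matrix (Fin m) (Fin m) ℝ} (hA : Tendsto A F (𝓝 A₀)) (hdet : A₀.det ≠ 0) :
    Tendsto (fun x => (A x)⁻¹) F (𝓝 A₀⁻¹) := by
  have h1 : Continuous fun q : Matrix (Fin m) (Fin m) ℝ => q.det := by fun_prop
  have h2 : Continuous fun q : Matrix (Fin m) (Fin m) ℝ => q.adjugate :=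
    Continuous.matrix_adjugate continuous_id
  simp only [Matrix.inv_def, Ring.inverse_eq_inv']
  exact (((h1.tendsto A₀).comp hA).inv₀ hdet).smul ((h2.tendsto A₀).comp hA)

section Consistency

variable {p h : ℕ} {P : Measure (E p × Fin h)} {Ω : Type*} {mΩ : MeasurableSpace Ω}
  {Q : Measure Ω} {W : ℕ → Ω → E p × Fin h}

lemma ae_tendsto_avgCov [IsProbabilityMeasure P] [IsProbabilityMeasure Q]
    (hlaw : ∀ i, HasLaw (W i) P Q) (hindep : iIndepFun W Q) {φ ψ : E p × Fin h → ℝ}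
    (hφ : Measurable φ) (hψ : Measurable ψ) (hφ4 : MemLp φ 4 P) (hψ4 : MemLp ψ 4 P) :
    ∀ᵐ ω ∂Q, Tendsto (fun n : ℕ => avgCov (fun k : Fin n => φ (W k ω)) fun k => ψ (W k ω)) atTop
      (𝓝 (∫ x, φ x * ψ x ∂P - (∫ x, φ x ∂P) * ∫ x, ψ x ∂P)) := by
  filter_upwards [ae_tendsto_avg hlaw hindep (hφ.mul hψ) (integrable_mul_of_memLp_four hφ4 hψ4),
    ae_tendsto_avg hlaw hindep hφ (hφ4.integrable (by norm_num)),
    ae_tendsto_avg hlaw hindep hψ (hψ4.integrable (by norm_num))] with ω h1 h2 h3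
  exact h1.sub (h2.mul h3)

lemma measurable_centered (i : Fin p) :
    Measurable fun w : E p × Fin h => w.1 i - meanX P i := by fun_prop

lemma measurable_eps (y : Fin h) : Measurable fun w => eps P w y := by
  simp only [eps, dotProduct]
  have h1 := measurable_slice_indicator (p := p) y
  fun_prop

/-- The centered predictors as linear functions of `Z`. -/
lemma centered_eq_inner_Z (hcov : (covX P).PosDef) (i : Fin p) (w : E p × Fin h) :
    w.1 i - meanX P i = inner ℝ (WithLp.toLp 2 ((covX P * invSqrt (covX P)) i) : E p) (Z P w) := by
  have h1 : invSqrt (covX P) *ᵥ (covX P * invSqrt (covX P)) i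
      = (1 : Matrix (Fin p) (Fin p) ℝ) i := by
    rw [← Matrix.vecMul_transpose, transpose_invSqrt]
    have h2 : (covX P * invSqrt (covX P)) i ᵥ* invSqrt (covX P)
        = (covX P * invSqrt (covX P) * invSqrt (covX P)) i := rfl
    rw [h2, Matrix.mul_assoc, invSqrt_mul_self hcov.posSemidef,
      Matrix.mul_nonsing_inv _ hcov.det_pos.ne'.isUnit]
  rw [inner_Z]
  change _ = (invSqrt (covX P) *ᵥ (covX P * invSqrt (covX P)) i) ⬝ᵥ _
  rw [h1]
  simp [dotProduct, Matrix.one_apply]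

variable [IsProbabilityMeasure P]

lemma integral_centered_mul_eps (hmom : MemLp (Prod.fst : E p × Fin h → E p) 4 P)
    (hcov : (covX P).PosDef) (hslice : ∀ y, 0 < f P y) (i : Fin p) (y : Fin h) :
    ∫ w, (w.1 i - meanX P i) * eps P w y ∂P = 0 := by
  simp_rw [centered_eq_inner_Z hcov, mul_comm _ (eps P _ y)]
  exact integral_eps_mul_inner_Z hmom hcov hslice y _

variable [IsProbabilityMeasure Q]

lemma ae_tendsto_sampleCov (hmom : MemLp (Prod.fst : E p × Fin h → E p) 4 P)
    (hlaw : ∀ i, HasLaw (W i) P Q) (hindep : iIndepFun W Q) :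
    ∀ᵐ ω ∂Q, Tendsto (fun n : ℕ => sampleCov fun k : Fin n => W k ω) atTop (𝓝 (covX P)) := by
  have h1 : ∀ᵐ ω ∂Q, ∀ i j, Tendsto (fun n : ℕ => avgCov
      (fun k : Fin n => (W k ω).1 i - meanX P i) fun k => (W k ω).1 j - meanX P j) atTop
      (𝓝 (covX P i j)) := by
    refine ae_all_iff.2 fun i => ae_all_iff.2 fun j => ?_
    have h2 := ae_tendsto_avgCov hlaw hindep (measurable_centered i) (measurable_centered j)
      (memLp_centered hmom i) (memLp_centered hmom j)
    rwa [← covX_eq hmom, integral_centered hmom, zero_mul, sub_zero] at h2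
  filter_upwards [h1] with ω hω
  refine tendsto_matrix fun i j => (hω i j).congr' ?_
  filter_upwards [eventually_gt_atTop 0] with n hn
  have : NeZero n := ⟨hn.ne'⟩
  exact (sampleCov_eq P _ i j).symm

lemma ae_tendsto_sampleCross (hmom : MemLp (Prod.fst : E p × Fin h → E p) 4 P)
    (hlaw : ∀ i, HasLaw (W i) P Q) (hindep : iIndepFun W Q) :
    ∀ᵐ ω ∂Q, Tendsto (fun n : ℕ => sampleCross fun k : Fin n => W k ω) atTop
      (𝓝 (Matrix.of fun i y => ∫ w, (w.1 i - meanX P i) * (if w.2 = y then 1 else 0) ∂P)) := by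
  have h1 : ∀ᵐ ω ∂Q, ∀ i y, Tendsto (fun n : ℕ => avgCov
      (fun k : Fin n => (W k ω).1 i - meanX P i) fun k => if (W k ω).2 = y then 1 else 0) atTop
      (𝓝 (∫ w, (w.1 i - meanX P i) * (if w.2 = y then 1 else 0) ∂P)) := by
    refine ae_all_iff.2 fun i => ae_all_iff.2 fun y => ?_
    have h2 := ae_tendsto_avgCov hlaw hindep (measurable_centered i)
      (measurable_slice_indicator y) (memLp_centered hmom i) (memLp_indicator y 4)
    rwa [integral_centered hmom, zero_mul, sub_zero] at h2
  filter_upwards [h1] with ω hω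
  refine tendsto_matrix fun i y => (hω i y).congr' ?_
  filter_upwards [eventually_gt_atTop 0] with n hn
  have : NeZero n := ⟨hn.ne'⟩
  exact (sampleCross_eq P _ i y).symm

lemma ae_tendsto_diagInvG (hslice : ∀ y, 0 < f P y)
    (hlaw : ∀ i, HasLaw (W i) P Q) (hindep : iIndepFun W Q) :
    ∀ᵐ ω ∂Q, Tendsto (fun n : ℕ => diagInvG fun k : Fin n => W k ω) atTop
      (𝓝 (Matrix.diagonal fun y => (g P y)⁻¹)) := by
  have h1 : ∀ᵐ ω ∂Q, ∀ y, Tendsto (fun n : ℕ => avg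
      fun k : Fin n => if (W k ω).2 = y then (1 : ℝ) else 0) atTop (𝓝 (f P y)) := by
    refine ae_all_iff.2 fun y => ?_
    rw [← integral_indicator_eq_f]
    exact ae_tendsto_avg hlaw hindep (measurable_slice_indicator y)
      ((memLp_indicator y 1).integrable le_rfl)
  filter_upwards [h1] with ω hω
  refine tendsto_matrix fun y y' => ?_
  simp only [diagInvG, Matrix.diagonal_apply]
  by_cases hy : y = y'
  · simp only [hy, if_true, fhat_eq]
    exact ((Real.continuous_sqrt.tendsto _).comp (hω y')).inv₀ (g_pos hslice y').ne'
  · simp only [hy, if_false]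
    exact tendsto_const_nhds

lemma ae_tendsto_avg_eps (hmom : MemLp (Prod.fst : E p × Fin h → E p) 4 P)
    (hcov : (covX P).PosDef) (hslice : ∀ y, 0 < f P y)
    (hlaw : ∀ i, HasLaw (W i) P Q) (hindep : iIndepFun W Q) :
    ∀ᵐ ω ∂Q, Tendsto (fun (n : ℕ) y => avg fun k : Fin n => eps P (W k ω) y) atTop (𝓝 0) := by
  have h1 : ∀ᵐ ω ∂Q, ∀ y, Tendsto (fun n : ℕ => avg fun k : Fin n => eps P (W k ω) y) atTop
      (𝓝 0) := by
    refine ae_all_iff.2 fun y => ?_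
    rw [← integral_eps hmom hcov hslice y]
    exact ae_tendsto_avg hlaw hindep (measurable_eps y)
      ((memLp_eps hmom hcov hslice y).integrable (by norm_num))
  filter_upwards [h1] with ω hω
  exact tendsto_pi_nhds.mpr hω

lemma invSqrt_mul_cross_mul (hmom : MemLp (Prod.fst : E p × Fin h → E p) 4 P)
    (hslice : ∀ y, 0 < f P y) :
    invSqrt (covX P) *
      ((Matrix.of fun i y => ∫ w, (w.1 i - meanX P i) * (if w.2 = y then 1 else 0) ∂P) *
        Matrix.diagonal fun y => (g P y)⁻¹) = mu P := by
  ext i y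
  have h1 := integral_indicator_mul_inner_Z hmom hslice (EuclideanSpace.single i (1 : ℝ)) y
  have h2 : (invSqrt (covX P) *ᵥ (EuclideanSpace.single i (1 : ℝ) : E p).ofLp)
      = invSqrt (covX P) i := by
    ext j
    have h3 : invSqrt (covX P) i j = invSqrt (covX P) j i :=
      congrFun (congrFun (transpose_invSqrt (covX P)) j) i
    simp [h3]
  simp only [inner_Z, h2] at h1
  rw [EuclideanSpace.inner_single_left] at h1
  have h4 : ∫ w, (if w.2 = y then (1 : ℝ) else 0)
        * (invSqrt (covX P) i ⬝ᵥ fun j => w.1 j - meanX P j) ∂P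
      = ∑ j, invSqrt (covX P) i j
        * ∫ w, (w.1 j - meanX P j) * (if w.2 = y then 1 else 0) ∂P := by
    simp_rw [← integral_const_mul]
    rw [← integral_finsetSum _ fun j _ => (integrable_mul_of_memLp_four (memLp_centered hmom j)
      (memLp_indicator y 4)).const_mul _]
    congr 1
    funext w
    rw [dotProduct, Finset.mul_sum]
    exact Finset.sum_congr rfl fun j _ => by ring
  rw [h4] at h1
  rw [← Matrix.mul_assoc, Matrix.mul_diagonal, Matrix.mul_apply, mu, Matrix.of_apply]
  simp only [Matrix.of_apply]
  rw [h1, ← g_mul_self hslice]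
  have := (g_pos hslice y).ne'
  simp only [map_one, one_mul]
  field_simp

lemma ae_tendsto_sampleGram (hmom : MemLp (Prod.fst : E p × Fin h → E p) 4 P)
    (hcov : (covX P).PosDef) (hslice : ∀ y, 0 < f P y)
    (hlaw : ∀ i, HasLaw (W i) P Q) (hindep : iIndepFun W Q) :
    ∀ᵐ ω ∂Q, Tendsto (fun n : ℕ => sampleGram fun k : Fin n => W k ω) atTop
      (𝓝 ((mu P)ᵀ * mu P)) := by
  filter_upwards [ae_tendsto_sampleCov hmom hlaw hindep, ae_tendsto_sampleCross hmom hlaw hindep,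
    ae_tendsto_diagInvG hslice hlaw hindep] with ω h1 h2 h3
  have h4 := tendsto_matrix_mul h2 h3
  have h5 := tendsto_matrix_mul (tendsto_matrix_mul (tendsto_matrix_transpose h4)
    (tendsto_matrix_inv h1 hcov.det_pos.ne')) h4
  have h6 := invSqrt_mul_cross_mul hmom hslice
  rw [← invSqrt_mul_self hcov.posSemidef] at h5
  rw [← h6, Matrix.transpose_mul, transpose_invSqrt]
  simpa only [Matrix.mul_assoc, sampleGram] using h5

end Consistency

/-! ### The statistic as a perturbed quadratic form of a scaled sum -/

section Linearization

variable {p h d r n : ℕ}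

/-- The products `(X - E X) ε_y` and the centered predictors `X - E X`. -/
def influence (P : Measure (E p × Fin h)) (w : E p × Fin h) :
    EuclideanSpace ℝ ((Fin p × Fin h) ⊕ Fin p) :=
  WithLp.toLp 2 (Sum.elim (fun q => (w.1 q.1 - meanX P q.1) * eps P w q.2)
    fun i => w.1 i - meanX P i)

variable (p h r) in
/-- The space of the values of `nuisance`: matrices are represented by functions of two indices,
which carry the supremum norm. -/
abbrev Nuisance : Type := (Fin p → Fin p → ℝ) × (Fin r → Fin r → ℝ) × (Fin h → Fin h → ℝ) ×
  (Fin h → Fin h → ℝ) × (Fin h → ℝ) × ℝ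

/-- The consistent sample quantities on which the statistic depends besides the scaled sum of
`influence`: the matrices `Σ̂⁻¹`, `(α_xᵀ Σ̂⁻¹ α_x)⁻¹`, `diag(ĝ)⁻¹` and `μ̂ᵀ μ̂`, the averages of
the `ε_y`, and `1 / n`. -/
def nuisance (P : Measure (E p × Fin h)) (αx : Matrix (Fin p) (Fin r) ℝ)
    (w : Fin n → E p × Fin h) : Nuisance p h r :=
  (Matrix.of.symm (sampleCov w)⁻¹, Matrix.of.symm (αxᵀ * (sampleCov w)⁻¹ * αx)⁻¹,
    Matrix.of.symm (diagInvG w), Matrix.of.symm (sampleGram w),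
    fun y => avg fun k => eps P (w k) y, (n : ℝ)⁻¹)

/-- The limit of `nuisance`. -/
def nuisanceLim (P : Measure (E p × Fin h)) (αx : Matrix (Fin p) (Fin r) ℝ) : Nuisance p h r :=
  (Matrix.of.symm (covX P)⁻¹, Matrix.of.symm (αxᵀ * (covX P)⁻¹ * αx)⁻¹,
    Matrix.of.symm (Matrix.diagonal fun y => (g P y)⁻¹), Matrix.of.symm ((mu P)ᵀ * mu P), 0, 0)

/-- The factor `√n α_xᵀ Σ̂⁻¹ (Ĉ - Σ̂ β) diag(ĝ)⁻¹` of `n μ̂ᵀ P μ̂`, as a function of the scaled sum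
of `influence` and of `nuisance`. -/
def hypFactor (αx : Matrix (Fin p) (Fin r) ℝ) (x : EuclideanSpace ℝ ((Fin p × Fin h) ⊕ Fin p))
    (c : Nuisance p h r) : Matrix (Fin r) (Fin h) ℝ :=
  αxᵀ * Matrix.of c.1 *
    ((Matrix.of fun i y => x (.inl (i, y)) - x (.inr i) * c.2.2.2.2.1 y) * Matrix.of c.2.2.1)

/-- The matrix `n μ̂ᵀ P μ̂` as a function of the scaled sum of `influence` and of `nuisance`. -/
def hypGram (αx : Matrix (Fin p) (Fin r) ℝ) (x : EuclideanSpace ℝ ((Fin p × Fin h) ⊕ Fin p))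
    (c : Nuisance p h r) : Matrix (Fin h) (Fin h) ℝ :=
  (hypFactor αx x c)ᵀ * Matrix.of c.2.1 * hypFactor αx x c

/-- The first-order term of the statistic. -/
def mainTerm (Ψ : Matrix (Fin h) (Fin d) ℝ) (αx : Matrix (Fin p) (Fin r) ℝ)
    (q : EuclideanSpace ℝ ((Fin p × Fin h) ⊕ Fin p) × Nuisance p h r) : ℝ :=
  (Ψᵀ * hypGram αx q.1 q.2 * Ψ).trace

/-- A bound for the error of the first-order approximation of the statistic. -/
def errorBound (d : ℕ) (b : ℝ) (G : Matrix (Fin h) (Fin h) ℝ) (αx : Matrix (Fin p) (Fin r) ℝ)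
    (q : EuclideanSpace ℝ ((Fin p × Fin h) ⊕ Fin p) × Nuisance p h r) : ℝ :=
  entryNorm (hypGram αx q.1 q.2) * √(4 * d / b * (entryNorm (Matrix.of q.2.2.2.2.1 - G)
    + q.2.2.2.2.2.2 * entryNorm (hypGram αx q.1 q.2)))

lemma continuous_hypGram (αx : Matrix (Fin p) (Fin r) ℝ) :
    Continuous fun q : EuclideanSpace ℝ ((Fin p × Fin h) ⊕ Fin p) × Nuisance p h r =>
      hypGram αx q.1 q.2 := by
  have h1 : Continuous fun q : EuclideanSpace ℝ ((Fin p × Fin h) ⊕ Fin p) × Nuisance p h r =>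
      (Matrix.of q.2.1 : Matrix (Fin p) (Fin p) ℝ) := continuous_matrix fun i j => by
    simp only [Matrix.of_apply]; fun_prop
  have h2 : Continuous fun q : EuclideanSpace ℝ ((Fin p × Fin h) ⊕ Fin p) × Nuisance p h r =>
      (Matrix.of q.2.2.1 : Matrix (Fin r) (Fin r) ℝ) := continuous_matrix fun i j => by
    simp only [Matrix.of_apply]; fun_prop
  have h3 : Continuous fun q : EuclideanSpace ℝ ((Fin p × Fin h) ⊕ Fin p) × Nuisance p h r =>
      (Matrix.of q.2.2.2.1 : Matrix (Fin h) (Fin h) ℝ) := continuous_matrix fun i j => by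
    simp only [Matrix.of_apply]; fun_prop
  have h4 : Continuous fun q : EuclideanSpace ℝ ((Fin p × Fin h) ⊕ Fin p) × Nuisance p h r =>
      (Matrix.of fun i y => q.1 (.inl (i, y)) - q.1 (.inr i) * q.2.2.2.2.2.1 y :
        Matrix (Fin p) (Fin h) ℝ) := continuous_matrix fun i j => by
    simp only [Matrix.of_apply]; fun_prop
  unfold hypGram hypFactor
  fun_prop

lemma continuous_mainTerm (Ψ : Matrix (Fin h) (Fin d) ℝ) (αx : Matrix (Fin p) (Fin r) ℝ) :
    Continuous (mainTerm (p := p) Ψ αx) := by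
  have h1 := continuous_hypGram (h := h) αx
  unfold mainTerm
  fun_prop

lemma continuous_entryNorm : Continuous (entryNorm (h := h)) := by
  unfold entryNorm
  exact continuous_finsetSum _ fun i _ => continuous_finsetSum _ fun j _ =>
    (Continuous.matrix_elem continuous_id i j).abs

lemma continuous_errorBound (b : ℝ) (G : Matrix (Fin h) (Fin h) ℝ)
    (αx : Matrix (Fin p) (Fin r) ℝ) : Continuous (errorBound (p := p) d b G αx) := by
  have h1 := continuous_entryNorm.comp (continuous_hypGram (h := h) αx)
  have h2 : Continuous fun q : EuclideanSpace ℝ ((Fin p × Fin h) ⊕ Fin p) × Nuisance p h r =>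
      (Matrix.of q.2.2.2.2.1 - G : Matrix (Fin h) (Fin h) ℝ) := continuous_matrix fun i j => by
    simp only [Matrix.of_apply, Matrix.sub_apply]; fun_prop
  have h3 := continuous_entryNorm.comp h2
  simp only [Function.comp_def] at h1 h3
  unfold errorBound
  fun_prop

variable {P : Measure (E p × Fin h)}

lemma scaledSum_influence_inl (w : Fin n → E p × Fin h) (i : Fin p) (y : Fin h) :
    scaledSum (influence P) w (.inl (i, y))
      = √n * avg fun k => ((w k).1 i - meanX P i) * eps P (w k) y := by
  have h1 : (√(n : ℝ))⁻¹ = √n * (n : ℝ)⁻¹ := by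
    rw [← div_eq_mul_inv, Real.sqrt_div_self', one_div]
  simp [scaledSum, influence, avg, h1, WithLp.ofLp_sum, mul_assoc]

lemma scaledSum_influence_inr (w : Fin n → E p × Fin h) (i : Fin p) :
    scaledSum (influence P) w (.inr i) = √n * avg fun k => (w k).1 i - meanX P i := by
  have h1 : (√(n : ℝ))⁻¹ = √n * (n : ℝ)⁻¹ := by
    rw [← div_eq_mul_inv, Real.sqrt_div_self', one_div]
  simp only [scaledSum, influence, avg, h1, WithLp.ofLp_sum, mul_assoc, PiLp.smul_apply,
    smul_eq_mul, Finset.sum_apply, Sum.elim_inr]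

/-- By the normal equations, `n μ̂ᵀ P μ̂` is a function of the scaled sum of `influence`. -/
lemma hypGram_scaledSum [IsProbabilityMeasure P] [NeZero n]
    (hmom : MemLp (Prod.fst : E p × Fin h → E p) 4 P)
    (hcov : (covX P).PosDef) (hslice : ∀ y, 0 < f P y) (hC2 : Coverage P)
    {αx : Matrix (Fin p) (Fin r) ℝ} (hH : CoordinateHypothesis P αx)
    (w : Fin n → E p × Fin h) :
    hypGram αx (scaledSum (influence P) w) (nuisance P αx w) = (n : ℝ) • sampleGramHyp w αx := by
  have h1 : (Matrix.of fun i y => scaledSum (influence P) w (.inl (i, y))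
      - scaledSum (influence P) w (.inr i) * (nuisance P αx w).2.2.2.2.1 y)
      = √(n : ℝ) • (sampleCross w - sampleCov w * betaMatrix P) := by
    ext i y
    rw [Matrix.smul_apply, sampleCross_sub, Matrix.of_apply, scaledSum_influence_inl,
      scaledSum_influence_inr, smul_eq_mul, avgCov, nuisance]
    ring
  have h2 : hypFactor αx (scaledSum (influence P) w) (nuisance P αx w)
      = √(n : ℝ) • (αxᵀ * (sampleCov w)⁻¹ *
        ((sampleCross w - sampleCov w * betaMatrix P) * diagInvG w)) := by
    rw [hypFactor, h1, Matrix.smul_mul, Matrix.mul_smul]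
    rfl
  rw [hypGram, h2, sampleGramHyp_eq hmom hcov hslice hC2 hH, Matrix.transpose_smul,
    Matrix.smul_mul, Matrix.smul_mul, Matrix.mul_smul, smul_smul,
    Real.mul_self_sqrt (Nat.cast_nonneg n)]
  rfl

/-- The first-order expansion of the statistic. -/
lemma abs_statistic_sub_mainTerm_le [IsProbabilityMeasure P] [NeZero n]
    (hmom : MemLp (Prod.fst : E p × Fin h → E p) 4 P)
    (hcov : (covX P).PosDef) (hslice : ∀ y, 0 < f P y) (hC2 : Coverage P)
    {αx : Matrix (Fin p) (Fin r) ℝ} (hαx : αx.rank = r) (hH : CoordinateHypothesis P αx)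
    (hdh : d ≤ h) (hdr : d + r ≤ p) {l : Fin d → ℝ} {b : ℝ} (hb : 0 < b) (hl : ∀ j, b ≤ l j)
    {Ψ : Matrix (Fin h) (Fin d) ℝ} (hΨ : Ψ ∈ frames h d) (w : Fin n → E p × Fin h) :
    |statistic w d αx - mainTerm Ψ αx (scaledSum (influence P) w, nuisance P αx w)|
      ≤ errorBound d b (Ψ * Matrix.diagonal l * Ψᵀ) αx
        (scaledSum (influence P) w, nuisance P αx w) := by
  have hn : (0 : ℝ) < n := Nat.cast_pos.mpr (NeZero.pos n)
  have h1 := abs_kyFan_sub_kyFan_sub_le hdh hb hl hΨ (sampleGram w) (sampleGramHyp w αx)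
  have h2 := mul_le_mul_of_nonneg_left h1 hn.le
  rw [← abs_of_pos hn, ← abs_mul, abs_of_pos hn] at h2
  rw [statistic_eq w hdh hdr hαx, mainTerm, errorBound, hypGram_scaledSum hmom hcov hslice hC2 hH,
    entryNorm_smul, abs_of_pos hn, Matrix.mul_smul, Matrix.smul_mul, Matrix.trace_smul,
    smul_eq_mul, ← mul_sub]
  have h3 : (nuisance P αx w).2.2.2.2.2 * (n * entryNorm (sampleGramHyp w αx))
      = entryNorm (sampleGramHyp w αx) := by
    rw [← mul_assoc]
    change (n : ℝ)⁻¹ * n * _ = _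
    rw [inv_mul_cancel₀ hn.ne', one_mul]
  rw [h3, mul_assoc]
  exact h2

end Linearization

/-! ### The limit law of the statistic -/

section LimitLaw

variable {p h d r : ℕ} {P : Measure (E p × Fin h)}

lemma measurable_influence : Measurable (influence P) := by
  refine (WithLp.measurable_toLp 2 _).comp (measurable_pi_lambda _ ?_)
  rintro (⟨i, y⟩ | i)
  · exact (measurable_centered i).mul (measurable_eps y)
  · exact measurable_centered i

lemma measurable_nuisance (αx : Matrix (Fin p) (Fin r) ℝ) {n : ℕ} :
    Measurable fun w : Fin n → E p × Fin h => nuisance P αx w := by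
  have hpi : ∀ {k : ℕ} {A : (Fin n → E p × Fin h) → Matrix (Fin k) (Fin k) ℝ},
      MeasurableEntries A → Measurable fun w => Matrix.of.symm (A w) := fun hA =>
    measurable_pi_lambda _ fun i => measurable_pi_lambda _ fun j => hA i j
  have hA := (measurableEntries_sampleCov (p := p) (h := h) (n := n)).inv
  refine (hpi hA).prodMk <| (hpi (((measurableEntries_const αxᵀ).mul hA).mul
    (measurableEntries_const αx)).inv).prodMk <| (hpi measurableEntries_diagInvG).prodMk <|
    (hpi measurableEntries_sampleGram).prodMk <| Measurable.prodMk ?_ measurable_const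
  refine measurable_pi_lambda _ fun y => Measurable.const_mul
    (Finset.measurable_sum _ fun k _ => ?_) _
  exact (measurable_eps y).comp (measurable_pi_apply k)

/-- The vector whose inner product with `influence` is the product of a coordinate of `αᵀ Z` and
a coordinate of `Ψᵀ D_g⁻¹ ε`. -/
def testVector (P : Measure (E p × Fin h)) (Ψ : Matrix (Fin h) (Fin d) ℝ)
    (αx : Matrix (Fin p) (Fin r) ℝ) (q : Fin d × Fin r) :
    EuclideanSpace ℝ ((Fin p × Fin h) ⊕ Fin p) :=
  WithLp.toLp 2 (Sum.elim
    (fun e => (invSqrt (covX P) * alpha P αx) e.1 q.2 * (Ψ e.2 q.1 * (g P e.2)⁻¹)) 0)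

lemma inner_testVector (Ψ : Matrix (Fin h) (Fin d) ℝ) (αx : Matrix (Fin p) (Fin r) ℝ)
    (q : Fin d × Fin r) (x : EuclideanSpace ℝ ((Fin p × Fin h) ⊕ Fin p)) :
    inner ℝ (testVector P Ψ αx q) x = ∑ i, ∑ y,
      (invSqrt (covX P) * alpha P αx) i q.2 * (Ψ y q.1 * (g P y)⁻¹) * x (.inl (i, y)) := by
  simp [PiLp.inner_apply, testVector, Fintype.sum_prod_type, mul_comm]

lemma inner_testVector_influence (Ψ : Matrix (Fin h) (Fin d) ℝ) (αx : Matrix (Fin p) (Fin r) ℝ)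
    (q : Fin d × Fin r) (w : E p × Fin h) :
    inner ℝ (testVector P Ψ αx q) (influence P w)
      = inner ℝ (alphaCol P αx q.2) (Z P w) * score P Ψ w q.1 := by
  have h1 : inner ℝ (alphaCol P αx q.2) (Z P w)
      = ∑ i, (invSqrt (covX P) * alpha P αx) i q.2 * (w.1 i - meanX P i) := inner_Z _ _
  rw [inner_testVector, h1, score, Finset.sum_mul_sum]
  refine Finset.sum_congr rfl fun i _ => Finset.sum_congr rfl fun y _ => ?_
  simp only [influence, Sum.elim_inl]
  ring

/-- In the limit, the first-order term is the squared norm of the vector of the products that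
`testVector` describes: the factor `(α_xᵀ Σ⁻¹ α_x)⁻¹` is what turns `α_x` into `α`. -/
lemma mainTerm_nuisanceLim (hcov : (covX P).PosDef) {αx : Matrix (Fin p) (Fin r) ℝ}
    (hαx : αx.rank = r) (Ψ : Matrix (Fin h) (Fin d) ℝ)
    (x : EuclideanSpace ℝ ((Fin p × Fin h) ⊕ Fin p)) :
    mainTerm Ψ αx (x, nuisanceLim P αx) = ∑ q, inner ℝ (testVector P Ψ αx q) x ^ 2 := by
  set K := αxᵀ * (covX P)⁻¹ * αx with hK
  have hKpd : K.PosDef := posDef_transpose_mul_inv_mul hcov hαx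
  set V := hypFactor αx x (nuisanceLim P αx) with hV
  have h1 : mainTerm Ψ αx (x, nuisanceLim P αx)
      = ((invSqrt K * V * Ψ)ᵀ * (invSqrt K * V * Ψ)).trace := by
    have h2 : hypGram αx x (nuisanceLim P αx) = Vᵀ * K⁻¹ * V := rfl
    rw [mainTerm, h2, ← invSqrt_mul_self hKpd.posSemidef, Matrix.transpose_mul,
      Matrix.transpose_mul, transpose_invSqrt]
    simp only [Matrix.mul_assoc]
  have h3 : invSqrt K * V * Ψ = (invSqrt (covX P) * alpha P αx)ᵀ *
      ((Matrix.of fun i y => x (.inl (i, y))) *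
        ((Matrix.diagonal fun y => (g P y)⁻¹) * Ψ)) := by
    have h4 : V = αxᵀ * (covX P)⁻¹ * ((Matrix.of fun i y => x (.inl (i, y))) *
        Matrix.diagonal fun y => (g P y)⁻¹) := by
      have h5 : (Matrix.of fun i y => x (.inl (i, y))
          - x (.inr i) * (nuisanceLim P αx).2.2.2.2.1 y)
          = Matrix.of fun i y => x (.inl (i, y)) := by
        ext i y
        simp [nuisanceLim]
      rw [hV, hypFactor, h5]
      rfl
    rw [h4, alpha, ← hK, ← invSqrt_mul_self hcov.posSemidef]
    simp only [Matrix.transpose_mul, transpose_invSqrt, Matrix.mul_assoc]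
  rw [h1, trace_transpose_mul_self, Fintype.sum_prod_type]
  refine Finset.sum_congr rfl fun j _ => Finset.sum_congr rfl fun a _ => ?_
  rw [h3, inner_testVector, Matrix.mul_apply]
  congr 1
  refine Finset.sum_congr rfl fun i _ => ?_
  rw [Matrix.mul_apply, Finset.mul_sum]
  refine Finset.sum_congr rfl fun y _ => ?_
  rw [Matrix.diagonal_mul, Matrix.transpose_apply, Matrix.of_apply]
  ring

lemma tendstoInDistribution_of_map_eq {Ω Ω₁ Ω₂ F : Type*} [MeasurableSpace F] [TopologicalSpace F]
    [OpensMeasurableSpace F] {m : MeasurableSpace Ω} {m₁ : MeasurableSpace Ω₁}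
    {m₂ : MeasurableSpace Ω₂} {Q : Measure Ω} [IsProbabilityMeasure Q] {ν₁ : Measure Ω₁}
    [IsProbabilityMeasure ν₁] {ν₂ : Measure Ω₂} [IsProbabilityMeasure ν₂] {X : ℕ → Ω → F}
    {Y₁ : Ω₁ → F} {Y₂ : Ω₂ → F} (hX : TendstoInDistribution X atTop Y₁ (fun _ => Q) ν₁)
    (hY : AEMeasurable Y₂ ν₂) (heq : ν₁.map Y₁ = ν₂.map Y₂) :
    TendstoInDistribution X atTop Y₂ (fun _ => Q) ν₂ := by
  refine ⟨hX.forall_aemeasurable, hY, ?_⟩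
  convert! hX.tendsto using 2
  exact congrArg 𝓝 (Subtype.ext heq.symm)

variable {Ω : Type*} {mΩ : MeasurableSpace Ω} {Q : Measure Ω} {W : ℕ → Ω → E p × Fin h}

lemma aemeasurable_sample (hlaw : ∀ i, HasLaw (W i) P Q) (n : ℕ) :
    AEMeasurable (fun ω => fun k : Fin n => W k ω) Q :=
  aemeasurable_pi_lambda _ fun k => (hlaw k).aemeasurable

variable [IsProbabilityMeasure P]

/-- The asymptotic covariance matrix of the products of the coordinates of `αᵀ Z` and of
`Ψᵀ D_g⁻¹ ε` is `Ω`, hence diagonal. -/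
lemma integral_inner_sum_testVector_sq (hmom : MemLp (Prod.fst : E p × Fin h → E p) 4 P)
    (hcov : (covX P).PosDef) (hslice : ∀ y, 0 < f P y) (hCS : CentralSubspaceExists P)
    (hC1 : Linearity P) (hC2 : Coverage P) (hC3 : ConstantCovariance P)
    {αx : Matrix (Fin p) (Fin r) ℝ} (hαx : αx.rank = r) (hH : CoordinateHypothesis P αx)
    {l : Fin d → ℝ} (hl : ∀ j, 0 < l j) {Ψ : Matrix (Fin h) (Fin d) ℝ} (hΨ : Ψ ∈ frames h d)
    (hμ : (mu P)ᵀ * mu P = Ψ * Matrix.diagonal l * Ψᵀ) (s : Fin d × Fin r → ℝ) :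
    ∫ w, inner ℝ (∑ q, s q • testVector P Ψ αx q) (influence P w) ^ 2 ∂P
      = ∑ q, s q ^ 2 * (1 - l q.1) := by
  have h1 : ∀ w, inner ℝ (∑ q, s q • testVector P Ψ αx q) (influence P w) ^ 2
      = ∑ q, ∑ q', s q * s q' * (inner ℝ (alphaCol P αx q.2) (Z P w)
        * inner ℝ (alphaCol P αx q'.2) (Z P w) * (score P Ψ w q.1 * score P Ψ w q'.1)) := by
    intro w
    simp only [sum_inner, inner_smul_left, conj_trivial, inner_testVector_influence]
    rw [sq, Finset.sum_mul_sum]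
    exact Finset.sum_congr rfl fun q _ => Finset.sum_congr rfl fun q' _ => by ring
  have h2 : ∀ q q' : Fin d × Fin r, Integrable (fun w => s q * s q' *
      (inner ℝ (alphaCol P αx q.2) (Z P w) * inner ℝ (alphaCol P αx q'.2) (Z P w)
        * (score P Ψ w q.1 * score P Ψ w q'.1))) P := by
    intro q q'
    have h3 : MemLp (fun w => inner ℝ (alphaCol P αx q.2) (Z P w)
        * inner ℝ (alphaCol P αx q'.2) (Z P w)) 2 P :=
      (memLp_inner_Z hmom _).mul (memLp_inner_Z hmom _)
    have h4 : MemLp (fun w => score P Ψ w q.1 * score P Ψ w q'.1) 2 P :=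
      (memLp_score hmom hcov hslice Ψ q'.1).mul (memLp_score hmom hcov hslice Ψ q.1)
    exact (h3.integrable_mul h4).const_mul _
  simp only [h1]
  rw [integral_finsetSum _ fun q _ => integrable_finsetSum _ fun q' _ => h2 q q']
  refine Finset.sum_congr rfl fun q _ => ?_
  rw [integral_finsetSum _ fun q' _ => h2 q q', Finset.sum_eq_single q]
  · rw [integral_const_mul,
      integral_alpha_mul_score hmom hcov hslice hCS hC1 hC2 hC3 hαx hH hl hΨ hμ]
    rw [Matrix.sub_apply, Matrix.one_apply_eq, Matrix.one_apply_eq, Matrix.diagonal_apply_eq]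
    ring
  · intro q' _ hq
    rw [integral_const_mul,
      integral_alpha_mul_score hmom hcov hslice hCS hC1 hC2 hC3 hαx hH hl hΨ hμ]
    by_cases hj : q.1 = q'.1
    · have ha : q.2 ≠ q'.2 := fun ha => hq (Prod.ext hj.symm ha.symm)
      rw [Matrix.one_apply_ne ha, mul_zero, mul_zero]
    · rw [Matrix.sub_apply, Matrix.one_apply_ne hj, Matrix.diagonal_apply_ne _ hj, sub_zero,
        zero_mul, mul_zero]
  · simp

variable [IsProbabilityMeasure Q]

lemma tendstoInMeasure_nuisance (hmom : MemLp (Prod.fst : E p × Fin h → E p) 4 P)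
    (hcov : (covX P).PosDef) (hslice : ∀ y, 0 < f P y)
    {αx : Matrix (Fin p) (Fin r) ℝ} (hαx : αx.rank = r)
    (hlaw : ∀ i, HasLaw (W i) P Q) (hindep : iIndepFun W Q) :
    TendstoInMeasure Q (fun (n : ℕ) ω => nuisance P αx fun k : Fin n => W k ω) atTop
      fun _ => nuisanceLim P αx := by
  refine tendstoInMeasure_of_tendsto_ae (fun n => ((measurable_nuisance αx).comp_aemeasurable
    (aemeasurable_sample hlaw n)).aestronglyMeasurable) ?_
  filter_upwards [ae_tendsto_sampleCov hmom hlaw hindep, ae_tendsto_diagInvG hslice hlaw hindep,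
    ae_tendsto_sampleGram hmom hcov hslice hlaw hindep,
    ae_tendsto_avg_eps hmom hcov hslice hlaw hindep] with ω h1 h2 h3 h4
  have h5 := tendsto_matrix_inv h1 hcov.det_pos.ne'
  have h6 := tendsto_matrix_inv (tendsto_matrix_mul (tendsto_matrix_mul
    (tendsto_const_nhds (x := αxᵀ)) h5) (tendsto_const_nhds (x := αx)))
    (posDef_transpose_mul_inv_mul hcov hαx).det_pos.ne'
  exact h5.prodMk_nhds <| h6.prodMk_nhds <| h2.prodMk_nhds <| h3.prodMk_nhds <|
    h4.prodMk_nhds tendsto_inv_atTop_nhds_zero_nat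

/-- The limit law of the statistic, for a diagonalization of `μᵀμ` on its range. -/
theorem tendstoInDistribution_statistic (hmom : MemLp (Prod.fst : E p × Fin h → E p) 4 P)
    (hcov : (covX P).PosDef) (hslice : ∀ y, 0 < f P y) (hCS : CentralSubspaceExists P)
    (hC1 : Linearity P) (hC2 : Coverage P) (hC3 : ConstantCovariance P)
    {αx : Matrix (Fin p) (Fin r) ℝ} (hαx : αx.rank = r) (hH : CoordinateHypothesis P αx)
    (hdh : d ≤ h) (hdr : d + r ≤ p)
    {l : Fin d → ℝ} (hl : ∀ j, 0 < l j) {Ψ : Matrix (Fin h) (Fin d) ℝ} (hΨ : Ψ ∈ frames h d)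
    (hμ : (mu P)ᵀ * mu P = Ψ * Matrix.diagonal l * Ψᵀ)
    (hlaw : ∀ i, HasLaw (W i) P Q) (hindep : iIndepFun W Q) :
    TendstoInDistribution (fun (n : ℕ) ω => statistic (fun k : Fin n => W k ω) d αx) atTop
      (fun c : Fin d → ℝ => ∑ j, (1 - l j) * c j) (fun _ => Q)
      (Measure.pi fun _ : Fin d => chiSquared r) := by
  have hl1 : ∀ j, 0 ≤ 1 - l j := by
    intro j
    have h1 := integral_score_mul_score hmom hcov hslice hl hΨ hμ j j
    rw [Matrix.sub_apply, Matrix.one_apply_eq, Matrix.diagonal_apply_eq] at h1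
    rw [← h1]
    exact integral_nonneg fun w => mul_self_nonneg _
  obtain ⟨b, hb, hbl⟩ : ∃ b : ℝ, 0 < b ∧ ∀ j, b ≤ l j := by
    rcases isEmpty_or_nonempty (Fin d) with hd | hd
    · exact ⟨1, one_pos, fun j => hd.elim j⟩
    · obtain ⟨j, hj⟩ := Finite.exists_min l
      exact ⟨l j, hl j, hj⟩
  have hL2 : ∀ i, MemLp (fun w => influence P w i) 2 P := by
    rintro (⟨i, y⟩ | i)
    · exact (memLp_eps hmom hcov hslice y).mul (memLp_centered hmom i)
    · exact (memLp_centered hmom i).mono_exponent (by norm_num)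
  have hmean : ∀ i, ∫ w, influence P w i ∂P = 0 := by
    rintro (⟨i, y⟩ | i)
    · exact integral_centered_mul_eps hmom hcov hslice i y
    · exact integral_centered hmom i
  obtain ⟨ν, hν, hchar, hclt⟩ := exists_tendstoInDistribution_scaledSum hlaw hindep
    measurable_influence hL2 hmean
  have hnuis := tendstoInMeasure_nuisance hmom hcov hslice hαx hlaw hindep
  have hnuism : ∀ n : ℕ, AEMeasurable (fun ω => nuisance P αx fun k : Fin n => W k ω) Q :=
    fun n => (measurable_nuisance αx).comp_aemeasurable (aemeasurable_sample hlaw n)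
  have hmain := hclt.continuous_comp_prodMk_of_tendstoInMeasure_const
    (continuous_mainTerm Ψ αx) hnuis hnuism
  have herr := hclt.continuous_comp_prodMk_of_tendstoInMeasure_const
    (continuous_errorBound (d := d) b (Ψ * Matrix.diagonal l * Ψᵀ) αx) hnuis hnuism
  have hstat : ∀ n : ℕ, AEMeasurable (fun ω => statistic (fun k : Fin n => W k ω) d αx) Q :=
    fun n => (measurable_statistic hdh hdr hαx).comp_aemeasurable (aemeasurable_sample hlaw n)
  have hzero : (fun x : EuclideanSpace ℝ ((Fin p × Fin h) ⊕ Fin p) => errorBound d b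
      (Ψ * Matrix.diagonal l * Ψᵀ) αx (id x, nuisanceLim P αx)) = fun _ => 0 := by
    funext x
    have h1 : (Matrix.of (nuisanceLim P αx).2.2.2.1 : Matrix (Fin h) (Fin h) ℝ)
        = Ψ * Matrix.diagonal l * Ψᵀ := hμ
    have h2 : (nuisanceLim P αx).2.2.2.2.2 = 0 := rfl
    simp only [errorBound, h1, h2, sub_self, zero_mul, add_zero]
    simp [entryNorm]
  rw [hzero] at herr
  have herr0 := tendstoInMeasure_zero_of_tendstoInDistribution_zero herr
  have hlim := tendstoInDistribution_of_tendstoInMeasure_sub _ _ hmain (?_) hstat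
  · refine tendstoInDistribution_of_map_eq hlim (Measurable.aemeasurable (by fun_prop)) ?_
    simp only [id, mainTerm_nuisanceLim hcov hαx]
    refine map_sum_sq_inner hl1 _ fun s => ?_
    rw [hchar, integral_inner_sum_testVector_sq hmom hcov hslice hCS hC1 hC2 hC3 hαx hH hl hΨ hμ]
  · rw [tendstoInMeasure_iff_norm] at herr0 ⊢
    intro ε hε
    refine tendsto_of_tendsto_of_tendsto_of_le_of_le' tendsto_const_nhds (herr0 ε hε)
      (.of_forall fun n => zero_le) ?_
    filter_upwards [eventually_gt_atTop 0] with n hn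
    have : NeZero n := ⟨hn.ne'⟩
    refine measure_mono fun ω hω => ?_
    have h1 := abs_statistic_sub_mainTerm_le hmom hcov hslice hC2 hαx hH hdh hdr hb hbl hΨ
      fun k : Fin n => W k ω
    simp only [Set.mem_ofPred_eq, Pi.sub_apply, Pi.zero_apply, sub_zero, Real.norm_eq_abs] at hω ⊢
    exact hω.trans (h1.trans (le_abs_self _))

end LimitLaw

end

end SIR

theorem corollary4 {p h d r : ℕ}
    -- the joint law of `(X, Y)`
    (P : Measure (SIR.E p × Fin h)) [IsProbabilityMeasure P]
    (hmom : MemLp (Prod.fst : SIR.E p × Fin h → SIR.E p) 4 P)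
    (hcov : (SIR.covX P).PosDef)
    (hslice : ∀ y, 0 < SIR.f P y)
    (hCS : SIR.CentralSubspaceExists P)
    (hd : Module.finrank ℝ (SIR.centralSubspace P) = d)
    -- the three conditions
    (hC1 : SIR.Linearity P) (hC2 : SIR.Coverage P) (hC3 : SIR.ConstantCovariance P)
    -- the coordinate hypothesis
    (αx : Matrix (Fin p) (Fin r) ℝ) (hαx : αx.rank = r)
    (hH : SIR.CoordinateHypothesis P αx)
    -- the i.i.d. observations
    {Ω : Type*} [MeasurableSpace Ω] (Q : Measure Ω) [IsProbabilityMeasure Q]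
    (W : ℕ → Ω → SIR.E p × Fin h)
    (hlaw : ∀ i, HasLaw (W i) P Q) (hindep : iIndepFun W Q) :
    ∃ l : Fin d → ℝ,
      -- `l` lists the nonzero eigenvalues of `μ μᵀ` with multiplicity, in decreasing order
      Antitone l ∧ (∀ j, 0 < l j) ∧
      (SIR.mu P * (SIR.mu P)ᵀ).charpoly.roots.filter (fun x => x ≠ 0) =
        Finset.univ.val.map l ∧
      -- the form of `Ω_{H|d}`, for every singular value decomposition of `μ`
      (∀ (Γ₁ : Matrix (Fin p) (Fin d) ℝ) (Γ₀ : Matrix (Fin p) (Fin (p - d)) ℝ) (s : Fin d → ℝ)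
          (Ψ₁ : Matrix (Fin h) (Fin d) ℝ) (Ψ₀ : Matrix (Fin h) (Fin (h - d)) ℝ),
        SIR.IsSVD (SIR.mu P) Γ₁ Γ₀ s Ψ₁ Ψ₀ →
          (∀ a b, Integrable (fun w => SIR.omegaIntegrand P Ψ₁ αx w a b) P) ∧
          SIR.omega P Ψ₁ αx =
            (1 - Matrix.diagonal l) ⊗ₖ (1 : Matrix (Fin r) (Fin r) ℝ)) ∧
      -- the limit law of `T_n(H|d)`
      TendstoInDistribution
        (fun (n : ℕ) ω => SIR.statistic (fun k : Fin n => W k ω) d αx) atTop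
        (fun c : Fin d → ℝ => ∑ j, (1 - l j) * c j)
        (fun _ => Q) (Measure.pi fun _ : Fin d => SIR.chiSquared r) := by
  have hrank : (SIR.mu P).rank = d := by
    rw [SIR.rank_mu hslice, ← hd]
    exact congrArg (fun S : Submodule ℝ (SIR.E p) => Module.finrank ℝ S) hC2
  have hdh : d ≤ h := by
    have h1 := (SIR.mu P).rank_le_width
    rwa [hrank] at h1
  have hdr := SIR.add_le_of_coordinateHypothesis hcov hd hαx hH
  obtain ⟨l, Ψ, hanti, hl, hΨ, hμ⟩ := SIR.exists_frame_diagonal (A := (SIR.mu P)ᵀ * SIR.mu P)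
    (d := d) (by simpa using Matrix.posSemidef_conjTranspose_mul_self (SIR.mu P))
    (by rw [Matrix.rank_transpose_mul_self, hrank])
  refine ⟨l, hanti, hl, ?_, fun Γ₁ Γ₀ s Ψ₁ Ψ₀ hsvd => ?_,
    SIR.tendstoInDistribution_statistic hmom hcov hslice hCS hC1 hC2 hC3 hαx hH hdh hdr hl hΨ hμ
      hlaw hindep⟩
  · rw [SIR.filter_roots_charpoly_mul_comm, hμ, SIR.filter_roots_charpoly_frame hl hΨ]
  · obtain ⟨hΨ₁, hμ₁⟩ := hsvd.transpose_mul_self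
    have hs : ∀ j, 0 < s j ^ 2 := fun j => pow_pos (hsvd.pos j) 2
    have hs' : Antitone fun j => s j ^ 2 := fun i j hij =>
      pow_le_pow_left₀ (hsvd.pos j).le (hsvd.anti hij) 2
    -- both factorizations list the nonzero eigenvalues of `μᵀμ` in decreasing order
    have hls : (fun j => s j ^ 2) = l := by
      refine SIR.antitone_eq_of_map_eq hs' hanti ?_
      rw [← SIR.filter_roots_charpoly_frame hs hΨ₁, ← SIR.filter_roots_charpoly_frame hl hΨ,
        ← hμ₁, ← hμ]
    rw [hls] at hμ₁
    exact SIR.omega_eq hmom hcov hslice hCS hC1 hC2 hC3 hαx hH hl hΨ₁ hμ₁
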